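/- Let $(M,g)$ be a smooth finite-dimensional Riemannian manifold (without boundary) with Riemannian distance $d$, and let $D\subseteq TM$ be a smooth bracket-generating subbundle, i.e. at every point the Lie algebra of vector fields generated by the smooth sections of $D$ spans the tangent space. Let $P$ and $P^\perp$ be the $g$-orthogonal projections of $TM$ onto $D$ and $D^\perp$, and for $q\in\mathbb{N}^+$ put $g_q(v,w)=g(Pv,Pw)+q\,g(P^\perp v,P^\perp w)$. Let $x,y\in M$ and, for every $q\in\mathbb{N}^+$, let $\gamma_q:[0,1]\to M$ be a length-minimising, affinely parametrised (constant speed) geodesic of $g_q$ from $x$ to $y$. Let $\gamma:[0,1]\to M$ be the uniform limit (with respect to $d$) of some subsequence $(\gamma_{q_j})_j$. Let $H^1([0,1],M)$ be the set of maps $c:[0,1]\to M$ such that $f\circ c\in H^1([0,1],\mathbb{R})$ for every smooth $f:M\to\mathbb{R}$, with the coarsest topology making all the semimetrics $$\rho_{a,f}(c_1,c_2)=\Big(\int_0^1\big|(f\circ c_1)^{(a)}(t)-(f\circ c_2)^{(a)}(t)\big|^2\,dt\Big)^{1/2},\qquad f\in C^\infty(M,\mathbb{R}),\ a\in\{0,1\},$$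 continuous, where $u^{(0)}=u$ and $u^{(1)}$ is the weak derivative of $u$. Then $\gamma\in H^1([0,1],M)$, and $(\gamma_{q_j})_j$ has a further subsequence which lies in $H^1([0,1],M)$ and converges to $\gamma$ in $H^1([0,1],M)$. -/

import Mathlib

open Set Filter Topology MeasureTheory Manifold Bundle
open scoped ENNReal ContDiff

noncomputable section

namespace PenalisedGeodesics

/-! ## Distributions on a manifold -/

section Distribution

variable {E : Type*} [NormedAddCommGroup E] [NormedSpace ℝ E]
  {M : Type*} [TopologicalSpace M] [ChartedSpace E M] [IsManifold 𝓘(ℝ, E) ∞ M]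

/-- `D` is a smooth subbundle of `TM`: around every point there is a smooth local frame of `D`,
that is, finitely many smooth vector fields which form a basis of each fibre of `D`. -/
def IsSmoothSubbundle (D : ∀ p : M, Submodule ℝ (TangentSpace 𝓘(ℝ, E) p)) : Prop :=
  ∀ p₀ : M, ∃ U : Set M, IsOpen U ∧ p₀ ∈ U ∧
    ∃ (k : ℕ) (X : Fin k → ∀ p : M, TangentSpace 𝓘(ℝ, E) p),
      (∀ i, ContMDiffOn 𝓘(ℝ, E) 𝓘(ℝ, E).tangent ∞
        (fun p => (⟨p, X i p⟩ : TangentBundle 𝓘(ℝ, E) M)) U) ∧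
      ∀ p ∈ U, LinearIndependent ℝ (fun i => X i p) ∧
        Submodule.span ℝ (range fun i => X i p) = D p

/-- The Lie algebra of vector fields generated by the smooth sections of `D`. -/
inductive LieClosure (D : ∀ p : M, Submodule ℝ (TangentSpace 𝓘(ℝ, E) p)) :
    (∀ p : M, TangentSpace 𝓘(ℝ, E) p) → Prop
  | of_section (X : ∀ p : M, TangentSpace 𝓘(ℝ, E) p)
      (smooth : ContMDiff 𝓘(ℝ, E) 𝓘(ℝ, E).tangent ∞
        (fun p => (⟨p, X p⟩ : TangentBundle 𝓘(ℝ, E) M)))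
      (mem : ∀ p, X p ∈ D p) : LieClosure D X
  | add (X Y : ∀ p : M, TangentSpace 𝓘(ℝ, E) p) (hX : LieClosure D X) (hY : LieClosure D Y) :
      LieClosure D (fun p => X p + Y p)
  | smul (c : ℝ) (X : ∀ p : M, TangentSpace 𝓘(ℝ, E) p) (hX : LieClosure D X) :
      LieClosure D (fun p => c • X p)
  | bracket (X Y : ∀ p : M, TangentSpace 𝓘(ℝ, E) p) (hX : LieClosure D X)
      (hY : LieClosure D Y) : LieClosure D (VectorField.mlieBracket 𝓘(ℝ, E) X Y)

/-- `D` is bracket-generating: its Lie closure spans the tangent space at every point. -/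
def IsBracketGenerating (D : ∀ p : M, Submodule ℝ (TangentSpace 𝓘(ℝ, E) p)) : Prop :=
  ∀ (p : M) (v : TangentSpace 𝓘(ℝ, E) p), ∃ Z, LieClosure D Z ∧ Z p = v

end Distribution

/-! ## The penalised metrics and their minimising geodesics -/

section Metric

variable {E : Type*} [NormedAddCommGroup E] [NormedSpace ℝ E] [FiniteDimensional ℝ E]
  {M : Type*} [TopologicalSpace M] [ChartedSpace E M]

instance finiteDimensional_tangentSpace (p : M) :
    FiniteDimensional ℝ (TangentSpace 𝓘(ℝ, E) p) :=
  inferInstanceAs (FiniteDimensional ℝ E)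

variable [RiemannianBundle (fun p : M => TangentSpace 𝓘(ℝ, E) p)]

/-- The penalised metric `g_q(v, w) = g(P v, P w) + q g(P^⊥ v, P^⊥ w)`, where `P` and `P^⊥` are
the `g`-orthogonal projections of the tangent space onto `D` and onto its orthogonal complement. -/
def penalisedMetric (D : ∀ p : M, Submodule ℝ (TangentSpace 𝓘(ℝ, E) p)) (q : ℕ+) (p : M)
    (v w : TangentSpace 𝓘(ℝ, E) p) : ℝ :=
  inner ℝ ((D p).starProjection v) ((D p).starProjection w) +
    (q : ℝ) * inner ℝ ((D p)ᗮ.starProjection v) ((D p)ᗮ.starProjection w)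

/-- The velocity of a differentiable curve `γ : [0,1] → M` (one-sided at the endpoints). -/
def velocity (γ : unitInterval → M) (t : unitInterval) : TangentSpace 𝓘(ℝ, E) (γ t) :=
  mfderiv (𝓡∂ 1) 𝓘(ℝ, E) γ t 1

/-- The `g_q`-length of a curve, `∫₀¹ √(g_q(γ', γ')) dt`. -/
def penalisedLength (D : ∀ p : M, Submodule ℝ (TangentSpace 𝓘(ℝ, E) p)) (q : ℕ+)
    (γ : unitInterval → M) : ℝ≥0∞ :=
  ∫⁻ t : unitInterval, ENNReal.ofReal
    (Real.sqrt (penalisedMetric D q (γ t) (velocity γ t) (velocity γ t)))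

/-- `γ : [0,1] → M` is a length-minimising geodesic of `g_q` from `x` to `y`, affinely
parametrised. Only `C¹` regularity is asked for (such curves are automatically smooth solutions of
the geodesic equation), and, as in the definition of the Riemannian distance, the competitors are
the `C¹` curves with the same endpoints. -/
structure IsMinimisingGeodesic (D : ∀ p : M, Submodule ℝ (TangentSpace 𝓘(ℝ, E) p)) (q : ℕ+)
    (x y : M) (γ : unitInterval → M) : Prop where
  contMDiff : ContMDiff (𝓡∂ 1) 𝓘(ℝ, E) 1 γ
  source : γ 0 = x
  target : γ 1 = y
  constant_speed : ∃ c : ℝ, ∀ t : unitInterval,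
    penalisedMetric D q (γ t) (velocity γ t) (velocity γ t) = c
  minimising : ∀ σ : unitInterval → M, ContMDiff (𝓡∂ 1) 𝓘(ℝ, E) 1 σ → σ 0 = x → σ 1 = y →
    penalisedLength D q γ ≤ penalisedLength D q σ

end Metric

/-! ## The Sobolev space `H¹([0,1], ℝ)` -/

/-- `η` is a weak derivative of `u` on `[0,1]`; the test functions are the smooth functions with
compact support in the open interval `(0,1)`. -/
def HasWeakDeriv (u η : unitInterval → ℝ) : Prop :=
  ∀ ψ : ℝ → ℝ, ContDiff ℝ ∞ ψ → tsupport ψ ⊆ Ioo 0 1 →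
    ∫ t : unitInterval, deriv ψ t * u t = -∫ t : unitInterval, ψ t * η t

/-- `u ∈ H¹([0,1], ℝ)`. -/
def MemH1 (u : unitInterval → ℝ) : Prop :=
  MemLp u 2 volume ∧ ∃ η : unitInterval → ℝ, MemLp η 2 volume ∧ HasWeakDeriv u η

open Classical in
/-- The weak derivative in `L²` of a function in `H¹([0,1], ℝ)`: it is unique up to a null set, and
the choice of a representative plays no role below. -/
def weakDeriv (u : unitInterval → ℝ) : unitInterval → ℝ :=
  if h : MemH1 u then h.2.choose else 0

/-- The weak derivative of order `a ∈ {0, 1}`. -/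
def weakDerivOrder (a : Fin 2) (u : unitInterval → ℝ) : unitInterval → ℝ :=
  if a = 0 then u else weakDeriv u

/-! ## The Sobolev space `H¹([0,1], M)` -/

section SobolevCurves

variable (E : Type*) [NormedAddCommGroup E] [NormedSpace ℝ E]
  {M : Type*} [TopologicalSpace M] [ChartedSpace E M]

/-- `γ ∈ H¹([0,1], M)`: for every smooth `f : M → ℝ`, `f ∘ γ ∈ H¹([0,1], ℝ)`. -/
def MemH1Curve (γ : unitInterval → M) : Prop :=
  ∀ f : C^∞⟮𝓘(ℝ, E), M; ℝ⟯, MemH1 (f ∘ γ)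

variable (M) in
/-- The set `H¹([0,1], M)`, as a type. -/
structure H1Curve where
  toFun : unitInterval → M
  memH1 : MemH1Curve E toFun

variable {E} in
/-- The semimetric `ρ_{a,f}(γ₁, γ₂) = ‖(f ∘ γ₁)^(a) - (f ∘ γ₂)^(a)‖_{L²}`, for `a ∈ {0, 1}`. -/
def semimetric (a : Fin 2) (f : C^∞⟮𝓘(ℝ, E), M; ℝ⟯) (γ₁ γ₂ : H1Curve E M) : ℝ :=
  Real.sqrt (∫ t : unitInterval, |weakDerivOrder a (f ∘ γ₁.toFun) t - weakDerivOrder a (f ∘ γ₂.toFun) t| ^ 2)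

/-- The topology of `H¹([0,1], M)`: the coarsest one for which all the semimetrics `ρ_{a,f}` are
continuous (in one variable with the other fixed, hence, by symmetry and the triangle inequality,
jointly). -/
instance : TopologicalSpace (H1Curve E M) :=
  ⨅ (a : Fin 2) (f : C^∞⟮𝓘(ℝ, E), M; ℝ⟯) (γ₀ : H1Curve E M),
    TopologicalSpace.induced (fun γ => semimetric a f γ γ₀) inferInstance

end SobolevCurves

end PenalisedGeodesics

end

/-!
The whole subsequence converges in `H¹`; no further extraction is needed. Write `d_q` for the
distance of `g_q` and `L_q = d_q(x, y)` for the constant `g_q`-speed of `γ_q`.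

The `L_q` increase with `q`, and they are bounded because `D` is bracket-generating. This is
Chow's theorem in the quantitative form that nearby points are joined by horizontal curves, whose
`g_q`-length does not depend on `q` (`IsBracketGenerating.exists_nhds_penalisedEDist_le`). Flows
of sections of `D` act on smooth functions by formal exponential series; the leading term of a
group commutator of such series is the commutator of the leading terms, and commutators of
derivations are Lie brackets. So every iterated bracket is the leading term, of some order `a`, of
a composition of horizontal flows for time `ε`, which has cost `O(ε)`. Running these with
`ε = s ^ (1 / a)` yields steerings that move points, to first order, in any prescribed direction, and a
Newton iteration then reaches every nearby point at a total cost bounded by a geometric series.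
Iterated brackets of sections are handled as operators on functions throughout, so that no
Baker–Campbell–Hausdorff formula is needed.

Let `Λ = lim L_{q_j}`. For fixed `q`, every `γ_{q_j}` with `q_j ≥ q` has `g_q`-speed at most `Λ`,
and the limit curve satisfies `d_q(γ(a), γ(b)) ≥ Λ (b - a) - (Λ - L_q)`, since otherwise it would
provide a shortcut from `x` to `y` (`IsMinimisingSequence.le_penalisedEDist_lim`). On an interval
on which all the curves stay in one chart, consider the mean of two curves `γ_{q_j}` and
`γ_{q_k}`. It almost joins `γ(a)` to `γ(b)`, so its `g_q`-length is almost `Λ (b - a)`, while the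
energies of the two curves are almost at most `Λ ^ 2 (b - a)`. By the parallelogram identity for
`g_q` this forces the `L²` distance of the velocities to be small (`integral_norm_sub_sq_le`).
Hence the velocities form a Cauchy sequence in `L²`, first in charts
(`IsMinimisingSequence.chart_velocity`), then for `f ∘ γ_{q_j}` with any smooth `f`, on all of
`[0, 1]`. As the graph of the weak derivative is closed in `L²`, the limit has the required weak
derivatives, and the convergence takes place in `H¹`.
-/

noncomputable section

namespace PenalisedGeodesics

/-! ### The penalised metrics and their distances -/

section PenalisedNorm

variable {E : Type*} [NormedAddCommGroup E] [NormedSpace ℝ E] [FiniteDimensional ℝ E]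
  {M : Type*} [TopologicalSpace M] [ChartedSpace E M]
  [RiemannianBundle (fun p : M => TangentSpace 𝓘(ℝ, E) p)]
  (D : ∀ p : M, Submodule ℝ (TangentSpace 𝓘(ℝ, E) p)) (q : ℕ+)

lemma penalisedMetric_self (p : M) (v : TangentSpace 𝓘(ℝ, E) p) :
    penalisedMetric D q p v v =
      ‖(D p).starProjection v‖ ^ 2 + (q : ℝ) * ‖(D p)ᗮ.starProjection v‖ ^ 2 := by
  simp only [penalisedMetric, real_inner_self_eq_norm_sq]

lemma norm_sq_eq_projections (p : M) (v : TangentSpace 𝓘(ℝ, E) p) :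
    ‖v‖ ^ 2 = ‖(D p).starProjection v‖ ^ 2 + ‖(D p)ᗮ.starProjection v‖ ^ 2 := by
  simpa using Submodule.norm_sq_eq_add_norm_sq_projection v (D p)

lemma one_le_cast_pnat : (1 : ℝ) ≤ (q : ℝ) := by exact_mod_cast q.pos

lemma penalisedMetric_self_eq_norm (p : M) (v : TangentSpace 𝓘(ℝ, E) p) :
    penalisedMetric D q p v v =
      (q : ℝ) * ‖v‖ ^ 2 - ((q : ℝ) - 1) * ‖(D p).starProjection v‖ ^ 2 := by
  rw [penalisedMetric_self, norm_sq_eq_projections D p v]; ring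

lemma penalisedMetric_self_nonneg (p : M) (v : TangentSpace 𝓘(ℝ, E) p) :
    0 ≤ penalisedMetric D q p v v := by
  rw [penalisedMetric_self]; positivity

lemma norm_sq_le_penalisedMetric (p : M) (v : TangentSpace 𝓘(ℝ, E) p) :
    ‖v‖ ^ 2 ≤ penalisedMetric D q p v v := by
  rw [penalisedMetric_self, norm_sq_eq_projections D p v]
  nlinarith [one_le_cast_pnat q, sq_nonneg ‖(D p)ᗮ.starProjection v‖]

lemma penalisedMetric_le_norm_sq (p : M) (v : TangentSpace 𝓘(ℝ, E) p) :
    penalisedMetric D q p v v ≤ (q : ℝ) * ‖v‖ ^ 2 := by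
  rw [penalisedMetric_self, norm_sq_eq_projections D p v]
  nlinarith [one_le_cast_pnat q, sq_nonneg ‖(D p).starProjection v‖]

variable {q} in
lemma penalisedMetric_mono {q' : ℕ+} (h : q ≤ q') (p : M) (v : TangentSpace 𝓘(ℝ, E) p) :
    penalisedMetric D q p v v ≤ penalisedMetric D q' p v v := by
  have : (q : ℝ) ≤ q' := by exact_mod_cast h
  rw [penalisedMetric_self, penalisedMetric_self]
  gcongr

variable {D} in
lemma penalisedMetric_of_mem {p : M} {v : TangentSpace 𝓘(ℝ, E) p} (hv : v ∈ D p) :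
    penalisedMetric D q p v v = ‖v‖ ^ 2 := by
  rw [penalisedMetric_self_eq_norm, (Submodule.starProjection_eq_self_iff).2 hv]; ring

lemma penalisedMetric_smul (p : M) (c : ℝ) (v : TangentSpace 𝓘(ℝ, E) p) :
    penalisedMetric D q p (c • v) (c • v) = c ^ 2 * penalisedMetric D q p v v := by
  simp only [penalisedMetric_self, map_smul, norm_smul, mul_pow, Real.norm_eq_abs, sq_abs]; ring

/-- The parallelogram identity for `g_q`. -/
lemma penalisedMetric_parallelogram (p : M) (v w : TangentSpace 𝓘(ℝ, E) p) :
    penalisedMetric D q p (v + w) (v + w) + penalisedMetric D q p (v - w) (v - w) =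
      2 * (penalisedMetric D q p v v + penalisedMetric D q p w w) := by
  simp only [penalisedMetric, map_add, map_sub, inner_add_left, inner_add_right, inner_sub_left,
    inner_sub_right]
  ring

/-- The value of the quadratic form only depends on the base point and the vector; the vectors are
taken in the model space since the tangent spaces at `p` and `p'` are different types. -/
lemma penalisedMetric_congr {p p' : M} {v v' : E} (hp : p = p') (hv : v = v') :
    penalisedMetric (E := E) D q p v v = penalisedMetric (E := E) D q p' v' v' := by
  subst hp hv; rfl

/-- The norm of `g_q`, as a family of extended norms on the tangent spaces. -/
@[reducible] def penalisedENorm (p : M) : ENorm (TangentSpace 𝓘(ℝ, E) p) :=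
  ⟨fun v => ENNReal.ofReal (Real.sqrt (penalisedMetric D q p v v))⟩

/-- The `g_q`-length over `[a, b]` of a curve defined on the real line. -/
def penalisedPathLength (γ : ℝ → M) (a b : ℝ) : ℝ≥0∞ :=
  letI := penalisedENorm D q
  pathELength 𝓘(ℝ, E) γ a b

/-- The Riemannian distance of `g_q`, with values in `[0, ∞]`. It is the distance which Mathlib
defines for an arbitrary family of extended norms, so that the topology of `M` plays no role. -/
def penalisedEDist (x y : M) : ℝ≥0∞ :=
  letI := penalisedENorm D q
  riemannianEDist 𝓘(ℝ, E) x y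

lemma penalisedENorm_smulClass (p : M) :
    @ENormSMulClass ℝ (TangentSpace 𝓘(ℝ, E) p) _ (penalisedENorm D q p) _ := by
  let _ := penalisedENorm D q p
  refine @ENormSMulClass.mk _ _ _ (penalisedENorm D q p) _ fun c v => ?_
  change ENNReal.ofReal _ = _ * ENNReal.ofReal _
  rw [penalisedMetric_smul, Real.sqrt_mul (sq_nonneg c), Real.sqrt_sq_eq_abs,
    ENNReal.ofReal_mul (abs_nonneg c), ← Real.norm_eq_abs, ofReal_norm]

lemma penalisedPathLength_eq_lintegral (γ : ℝ → M) (a b : ℝ) :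
    penalisedPathLength D q γ a b = ∫⁻ t in Icc a b, ENNReal.ofReal
      (Real.sqrt (penalisedMetric D q (γ t) (mfderivWithin 𝓘(ℝ, ℝ) 𝓘(ℝ, E) γ (Icc a b) t 1)
        (mfderivWithin 𝓘(ℝ, ℝ) 𝓘(ℝ, E) γ (Icc a b) t 1))) := by
  let _ := penalisedENorm D q
  exact pathELength_eq_lintegral_mfderivWithin_Icc

variable {D q} in
lemma penalisedEDist_le_penalisedPathLength {γ : ℝ → M} {a b : ℝ}
    (hγ : ContMDiffOn 𝓘(ℝ, ℝ) 𝓘(ℝ, E) 1 γ (Icc a b)) (hab : a ≤ b) :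
    penalisedEDist D q (γ a) (γ b) ≤ penalisedPathLength D q γ a b := by
  let _ := penalisedENorm D q
  have := fun p : M => penalisedENorm_smulClass D q p
  exact riemannianEDist_le_pathELength hγ rfl rfl hab

lemma penalisedEDist_self (x : M) : penalisedEDist D q x x = 0 := by
  let _ := penalisedENorm D q
  have := fun p : M => penalisedENorm_smulClass D q p
  exact riemannianEDist_self

lemma penalisedEDist_comm (x y : M) : penalisedEDist D q x y = penalisedEDist D q y x := by
  let _ := penalisedENorm D q
  have := fun p : M => penalisedENorm_smulClass D q p
  exact riemannianEDist_comm

lemma penalisedEDist_triangle (x y z : M) :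
    penalisedEDist D q x z ≤ penalisedEDist D q x y + penalisedEDist D q y z := by
  let _ := penalisedENorm D q
  have := fun p : M => penalisedENorm_smulClass D q p
  exact riemannianEDist_triangle

end PenalisedNorm

section PenalisedDistance

variable {E : Type*} [NormedAddCommGroup E] [NormedSpace ℝ E] [FiniteDimensional ℝ E]
  {M : Type*}

lemma penalisedMetric_sqrt_le [TopologicalSpace M] [ChartedSpace E M]
    [RiemannianBundle (fun p : M => TangentSpace 𝓘(ℝ, E) p)]
    (D : ∀ p : M, Submodule ℝ (TangentSpace 𝓘(ℝ, E) p)) (q : ℕ+)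
    (p : M) (v : TangentSpace 𝓘(ℝ, E) p) :
    ENNReal.ofReal (Real.sqrt (penalisedMetric D q p v v)) ≤
      ENNReal.ofReal (Real.sqrt q) * ‖v‖ₑ := by
  rw [← ofReal_norm, ← ENNReal.ofReal_mul (Real.sqrt_nonneg _)]
  refine ENNReal.ofReal_le_ofReal (Real.sqrt_le_iff.2 ⟨by positivity, ?_⟩)
  rw [mul_pow, Real.sq_sqrt (by positivity)]
  exact penalisedMetric_le_norm_sq D q p v

variable [EMetricSpace M] [ChartedSpace E M]
  [RiemannianBundle (fun p : M => TangentSpace 𝓘(ℝ, E) p)]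
  (D : ∀ p : M, Submodule ℝ (TangentSpace 𝓘(ℝ, E) p)) (q : ℕ+)

/-- For fixed `q`, the distance of `g_q` is controlled by that of `g`. -/
lemma penalisedEDist_le_edist [IsRiemannianManifold 𝓘(ℝ, E) M] (x y : M) :
    penalisedEDist D q x y ≤ ENNReal.ofReal (Real.sqrt q) * edist x y := by
  have hq : 0 < Real.sqrt q := Real.sqrt_pos.2 (by exact_mod_cast q.pos)
  rw [IsRiemannianManifold.out (I := 𝓘(ℝ, E)) x y, mul_comm]
  refine (ENNReal.div_le_iff (by simp) (by simp)).1 (le_of_forall_gt fun r hr => ?_)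
  obtain ⟨γ, h0, h1, hγ, hlen⟩ := exists_lt_of_riemannianEDist_lt hr
  refine lt_of_le_of_lt ?_ hlen
  refine (ENNReal.div_le_iff (by simp) (by simp)).2 ?_
  rw [← h0, ← h1]
  refine (penalisedEDist_le_penalisedPathLength hγ zero_le_one).trans ?_
  rw [penalisedPathLength_eq_lintegral, pathELength_eq_lintegral_mfderivWithin_Icc, mul_comm,
    ← lintegral_const_mul' _ _ ENNReal.ofReal_ne_top]
  exact lintegral_mono fun t => penalisedMetric_sqrt_le D q _ _

variable {D q}

/-- The length of a minimising geodesic of `g_q` is the distance of its endpoints. -/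
lemma IsMinimisingGeodesic.penalisedLength_eq {x y : M} {γ : unitInterval → M}
    (h : IsMinimisingGeodesic D q x y γ) : penalisedLength D q γ = penalisedEDist D q x y := by
  let _ := penalisedENorm D q
  change _ = riemannianEDist 𝓘(ℝ, E) x y
  rw [riemannianEDist]
  refine le_antisymm (le_iInf₂ fun σ hσ => ?_) ?_
  · exact h.minimising σ hσ σ.source σ.target
  · exact iInf₂_le (⟨⟨γ, h.contMDiff.continuous⟩, h.source, h.target⟩ : Path x y) h.contMDiff

end PenalisedDistance

/-! ### Continuity of the penalised metrics -/

section Continuity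

/-- The squared norm of an orthogonal projection in terms of the Gram matrix of a basis. -/
lemma norm_sq_starProjection_eq_gram {V : Type*} [NormedAddCommGroup V] [InnerProductSpace ℝ V]
    [FiniteDimensional ℝ V] {k : ℕ} (X : Fin k → V) (hX : LinearIndependent ℝ X)
    (W : Submodule ℝ V) (hW : Submodule.span ℝ (range X) = W) (v : V) :
    ‖W.starProjection v‖ ^ 2 =
      (fun i => inner ℝ (X i) v) ⬝ᵥ
        ((Matrix.gram ℝ X)⁻¹.mulVec fun i => inner ℝ (X i) v) := by
  have hmem : ∀ i, X i ∈ W := fun i => hW ▸ Submodule.subset_span (mem_range_self i)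
  have hP : W.starProjection v ∈ Submodule.span ℝ (range X) :=
    hW ▸ Submodule.starProjection_apply_mem W v
  obtain ⟨c, hc⟩ := (Submodule.mem_span_range_iff_exists_fun ℝ).1 hP
  have hinner : ∀ i, inner ℝ (X i) (W.starProjection v) = inner ℝ (X i) v := fun i => by
    rw [← W.inner_starProjection_left_eq_right, Submodule.starProjection_eq_self_iff.2 (hmem i)]
  have hb : (fun i => inner ℝ (X i) v) = (Matrix.gram ℝ X).mulVec c := by
    ext i
    rw [← hinner i, ← hc, inner_sum]
    simp [Matrix.mulVec, dotProduct, Matrix.gram_apply, inner_smul_right, mul_comm]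
  have hdet : IsUnit (Matrix.gram ℝ X).det :=
    (Matrix.det_gram_ne_zero_iff_linearIndependent.2 hX).isUnit
  rw [← real_inner_self_eq_norm_sq]
  conv_lhs => rw [← hc]
  simp only [sum_inner, inner_smul_left]
  rw [hc]
  simp only [hinner]
  rw [show (fun i => inner ℝ (X i) v) ⬝ᵥ ((Matrix.gram ℝ X)⁻¹.mulVec fun i => inner ℝ (X i) v) =
    (fun i => inner ℝ (X i) v) ⬝ᵥ c by
      conv_lhs => rw [hb, Matrix.mulVec_mulVec, Matrix.nonsing_inv_mul _ hdet, Matrix.one_mulVec]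
      rw [hb]]
  simp [dotProduct, mul_comm]

variable {E : Type*} [NormedAddCommGroup E] [NormedSpace ℝ E] [FiniteDimensional ℝ E]
  {M : Type*} [TopologicalSpace M] [ChartedSpace E M] [IsManifold 𝓘(ℝ, E) ∞ M]
  [RiemannianBundle (fun p : M => TangentSpace 𝓘(ℝ, E) p)]
  [IsContinuousRiemannianBundle E (fun p : M => TangentSpace 𝓘(ℝ, E) p)]
  {D : ∀ p : M, Submodule ℝ (TangentSpace 𝓘(ℝ, E) p)}

/-- The metric `g_q` is a continuous function on the tangent bundle: by the Gram matrix formula, the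
norm of the projection onto `D` is a continuous expression in a local frame. -/
theorem continuous_penalisedMetric (hD : IsSmoothSubbundle D) (q : ℕ+) :
    Continuous fun ξ : TangentBundle 𝓘(ℝ, E) M => penalisedMetric D q ξ.1 ξ.2 ξ.2 := by
  rw [continuous_iff_continuousAt]
  intro ξ₀
  obtain ⟨U, hU, hξU, k, X, hX, hXD⟩ := hD ξ₀.1
  have hproj : Continuous fun ξ : TangentBundle 𝓘(ℝ, E) M => ξ.1 :=
    FiberBundle.continuous_proj E _
  have hid : ContinuousAt (fun ξ : TangentBundle 𝓘(ℝ, E) M =>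
      (⟨ξ.1, ξ.2⟩ : TangentBundle 𝓘(ℝ, E) M)) ξ₀ := continuousAt_id
  have hXc : ∀ i, ContinuousAt (fun ξ : TangentBundle 𝓘(ℝ, E) M =>
      (⟨ξ.1, X i ξ.1⟩ : TangentBundle 𝓘(ℝ, E) M)) ξ₀ := fun i =>
    ContinuousAt.comp (f := fun ξ : TangentBundle 𝓘(ℝ, E) M => ξ.1)
      ((hX i).continuousOn.continuousAt (hU.mem_nhds hξU)) hproj.continuousAt
  have hnorm : ContinuousAt (fun ξ : TangentBundle 𝓘(ℝ, E) M => ‖ξ.2‖ ^ 2) ξ₀ := by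
    simpa only [real_inner_self_eq_norm_sq] using hid.inner_bundle hid
  have hb : ContinuousAt (fun ξ : TangentBundle 𝓘(ℝ, E) M => fun i => inner ℝ (X i ξ.1) ξ.2) ξ₀ :=
    continuousAt_pi.2 fun i => (hXc i).inner_bundle hid
  have hgram : ContinuousAt (fun ξ : TangentBundle 𝓘(ℝ, E) M =>
      Matrix.gram ℝ fun i => X i ξ.1) ξ₀ :=
    continuousAt_pi.2 fun i => continuousAt_pi.2 fun j => (hXc i).inner_bundle (hXc j)
  have hinv : ContinuousAt (fun ξ : TangentBundle 𝓘(ℝ, E) M =>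
      (Matrix.gram ℝ fun i => X i ξ.1)⁻¹) ξ₀ := by
    refine ContinuousAt.comp (g := fun A : Matrix (Fin k) (Fin k) ℝ => A⁻¹)
      (continuousAt_matrix_inv _ ?_) hgram
    have hdet := Matrix.det_gram_ne_zero_iff_linearIndependent.2 (hXD ξ₀.1 hξU).1
    rw [Ring.inverse_eq_inv']
    exact continuousAt_inv₀ hdet
  have hP : ContinuousAt (fun ξ : TangentBundle 𝓘(ℝ, E) M =>
      (fun i => inner ℝ (X i ξ.1) ξ.2) ⬝ᵥ
        ((Matrix.gram ℝ fun i => X i ξ.1)⁻¹.mulVec fun i => inner ℝ (X i ξ.1) ξ.2)) ξ₀ := by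
    have hF : Continuous fun a : (Fin k → ℝ) × Matrix (Fin k) (Fin k) ℝ =>
        a.1 ⬝ᵥ (a.2.mulVec a.1) := by fun_prop
    exact hF.continuousAt.comp (hb.prodMk hinv)
  refine ContinuousAt.congr ((continuousAt_const (y := (q : ℝ))).mul hnorm |>.sub
    ((continuousAt_const (y := (q : ℝ) - 1)).mul hP)) ?_
  filter_upwards [hproj.continuousAt.eventually (hU.mem_nhds hξU)] with ξ hξ
  rw [penalisedMetric_self_eq_norm, norm_sq_starProjection_eq_gram (fun i => X i ξ.1)
    (hXD ξ.1 hξ).1 (D ξ.1) (hXD ξ.1 hξ).2]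
  rfl

end Continuity

/-! ### Vector fields as derivations -/

section VectorFields

variable {E : Type*} [NormedAddCommGroup E] [NormedSpace ℝ E]
  {M : Type*} [TopologicalSpace M] [ChartedSpace E M] [IsManifold 𝓘(ℝ, E) ∞ M]

lemma two_le_infty : (2 : WithTop ℕ∞) ≤ ((⊤ : ℕ∞) : WithTop ℕ∞) :=
  WithTop.coe_le_coe.2 (le_top : (2 : ℕ∞) ≤ ⊤)

/-- `X` is a smooth vector field on `M`. -/
def IsSmoothField (X : ∀ p : M, TangentSpace 𝓘(ℝ, E) p) : Prop :=
  ContMDiff 𝓘(ℝ, E) 𝓘(ℝ, E).tangent ∞ (fun p => (⟨p, X p⟩ : TangentBundle 𝓘(ℝ, E) M))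

/-- The vector field `X` read in the chart at `p₀`. -/
def chartField (p₀ : M) (X : ∀ p : M, TangentSpace 𝓘(ℝ, E) p) (z : E) : E :=
  (mfderiv 𝓘(ℝ, E) 𝓘(ℝ, E) (extChartAt 𝓘(ℝ, E) p₀).symm z).inverse
    (X ((extChartAt 𝓘(ℝ, E) p₀).symm z))

variable {X Y : ∀ p : M, TangentSpace 𝓘(ℝ, E) p}

lemma mdifferentiableAt_chart_symm {p₀ : M} {z : E} (hz : z ∈ (extChartAt 𝓘(ℝ, E) p₀).target) :
    MDifferentiableAt 𝓘(ℝ, E) 𝓘(ℝ, E) (extChartAt 𝓘(ℝ, E) p₀).symm z := by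
  have := mdifferentiableWithinAt_extChartAt_symm (I := 𝓘(ℝ, E)) hz
  rwa [ModelWithCorners.range_eq_univ, mdifferentiableWithinAt_univ] at this

lemma isInvertible_mfderiv_chart_symm {p₀ : M} {z : E}
    (hz : z ∈ (extChartAt 𝓘(ℝ, E) p₀).target) :
    (mfderiv 𝓘(ℝ, E) 𝓘(ℝ, E) (extChartAt 𝓘(ℝ, E) p₀).symm z).IsInvertible := by
  have := isInvertible_mfderivWithin_extChartAt_symm (I := 𝓘(ℝ, E)) hz
  rwa [ModelWithCorners.range_eq_univ, mfderivWithin_univ] at this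

lemma mfderiv_chart_symm_chartField {p₀ : M} {z : E}
    (hz : z ∈ (extChartAt 𝓘(ℝ, E) p₀).target) :
    mfderiv 𝓘(ℝ, E) 𝓘(ℝ, E) (extChartAt 𝓘(ℝ, E) p₀).symm z (chartField (E := E) p₀ X z) =
      X ((extChartAt 𝓘(ℝ, E) p₀).symm z) := by
  obtain ⟨e, he⟩ := isInvertible_mfderiv_chart_symm (p₀ := p₀) hz
  rw [chartField, ← he, ContinuousLinearMap.inverse_equiv]
  exact e.apply_symm_apply _

lemma contDiffOn_chartField [CompleteSpace E] (hX : IsSmoothField X) (p₀ : M) :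
    ContDiffOn ℝ ∞ (chartField p₀ X) (extChartAt 𝓘(ℝ, E) p₀).target := by
  intro z hz
  have h1 : ContMDiffWithinAt 𝓘(ℝ, E) 𝓘(ℝ, E).tangent ∞
      (fun y => (⟨y, VectorField.mpullbackWithin 𝓘(ℝ, E) 𝓘(ℝ, E) (extChartAt 𝓘(ℝ, E) p₀).symm X
        (extChartAt 𝓘(ℝ, E) p₀).target y⟩ : TangentBundle 𝓘(ℝ, E) E))
      (extChartAt 𝓘(ℝ, E) p₀).target z := by
    have hU : IsOpen (extChartAt 𝓘(ℝ, E) p₀).target := isOpen_extChartAt_target p₀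
    refine ContMDiffWithinAt.mpullbackWithin_vectorField (t := univ) (n := ∞)
      (hX.contMDiffAt.contMDiffWithinAt) (contMDiffOn_extChartAt_symm p₀ z hz) ?_ hz
      hU.uniqueMDiffOn (by simp) (mapsTo_univ _ _)
    rw [mfderivWithin_of_isOpen hU hz]
    exact isInvertible_mfderiv_chart_symm hz
  have h2 := (contMDiff_snd_tangentBundle_modelSpace E 𝓘(ℝ, E) (n := ∞)).contMDiffAt
    |>.comp_contMDiffWithinAt _ h1
  refine (contMDiffWithinAt_iff_contDiffWithinAt.1 h2).congr (fun y hy => ?_) ?_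
  · simp only [Function.comp, VectorField.mpullbackWithin,
      mfderivWithin_of_isOpen (isOpen_extChartAt_target p₀) hy]
    rfl
  · simp only [Function.comp, VectorField.mpullbackWithin,
      mfderivWithin_of_isOpen (isOpen_extChartAt_target p₀) hz]
    rfl

variable {F : Type*} [NormedAddCommGroup F] [NormedSpace ℝ F]

lemma mfderiv_apply_eq_fderiv_chart {p₀ : M} {z : E} {g : M → F}
    (hz : z ∈ (extChartAt 𝓘(ℝ, E) p₀).target)
    (hg : MDifferentiableAt 𝓘(ℝ, E) 𝓘(ℝ, F) g ((extChartAt 𝓘(ℝ, E) p₀).symm z)) :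
    mfderiv 𝓘(ℝ, E) 𝓘(ℝ, F) g ((extChartAt 𝓘(ℝ, E) p₀).symm z)
        (X ((extChartAt 𝓘(ℝ, E) p₀).symm z)) =
      fderiv ℝ (g ∘ (extChartAt 𝓘(ℝ, E) p₀).symm) z (chartField (E := E) p₀ X z) := by
  have h := congrArg (mfderiv 𝓘(ℝ, E) 𝓘(ℝ, F) g ((extChartAt 𝓘(ℝ, E) p₀).symm z))
    (mfderiv_chart_symm_chartField (X := X) hz)
  refine h.symm.trans ?_
  rw [← mfderiv_eq_fderiv, mfderiv_comp z hg (mdifferentiableAt_chart_symm hz)]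
  rfl

lemma contMDiff_mfderiv_apply (hX : IsSmoothField X) {f : M → F}
    (hf : ContMDiff 𝓘(ℝ, E) 𝓘(ℝ, F) ∞ f) :
    ContMDiff 𝓘(ℝ, E) 𝓘(ℝ, F) ∞ (fun p => (mfderiv 𝓘(ℝ, E) 𝓘(ℝ, F) f p (X p) : F)) := by
  have h1 : ContMDiff 𝓘(ℝ, E).tangent 𝓘(ℝ, F).tangent ∞ (tangentMap 𝓘(ℝ, E) 𝓘(ℝ, F) f) :=
    hf.contMDiff_tangentMap (by simp)
  exact (contMDiff_snd_tangentBundle_modelSpace F 𝓘(ℝ, F)).comp (h1.comp hX)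

/-- The derivation of the space of smooth `F`-valued functions given by a smooth vector field. -/
def fieldDerivation (X : ∀ p : M, TangentSpace 𝓘(ℝ, E) p) (hX : IsSmoothField X) :
    Module.End ℝ C^∞⟮𝓘(ℝ, E), M; 𝓘(ℝ, F), F⟯ where
  toFun f := ⟨fun p => (mfderiv 𝓘(ℝ, E) 𝓘(ℝ, F) f p (X p) : F),
    contMDiff_mfderiv_apply hX f.contMDiff⟩
  map_add' f g := by
    ext p
    have hf := (f.contMDiff p).mdifferentiableAt (by simp : (∞ : WithTop ℕ∞) ≠ 0)
    have hg := (g.contMDiff p).mdifferentiableAt (by simp : (∞ : WithTop ℕ∞) ≠ 0)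
    exact congrArg (fun L : TangentSpace 𝓘(ℝ, E) p →L[ℝ] F => L (X p)) (mfderiv_add hf hg)
  map_smul' c f := by
    ext p
    have hf := (f.contMDiff p).mdifferentiableAt (by simp : (∞ : WithTop ℕ∞) ≠ 0)
    exact congrArg (fun L : TangentSpace 𝓘(ℝ, E) p →L[ℝ] F => L (X p)) (const_smul_mfderiv hf c)

lemma fieldDerivation_apply (hX : IsSmoothField X) (f : C^∞⟮𝓘(ℝ, E), M; 𝓘(ℝ, F), F⟯) (p : M) :
    fieldDerivation X hX f p = mfderiv 𝓘(ℝ, E) 𝓘(ℝ, F) f p (X p) := rfl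

omit [IsManifold 𝓘(ℝ, E) ∞ M] in
lemma mdifferentiable_of_smooth (f : C^∞⟮𝓘(ℝ, E), M; 𝓘(ℝ, F), F⟯) :
    MDifferentiable 𝓘(ℝ, E) 𝓘(ℝ, F) f :=
  f.contMDiff.mdifferentiable (by simp)

lemma isSmoothField_mlieBracket [CompleteSpace E] (hX : IsSmoothField X) (hY : IsSmoothField Y) :
    IsSmoothField (VectorField.mlieBracket 𝓘(ℝ, E) X Y) := by
  have : IsManifold 𝓘(ℝ, E) (minSmoothness ℝ 2) M := by
    rw [minSmoothness_of_isRCLikeNormedField]; infer_instance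
  have : IsManifold 𝓘(ℝ, E) (minSmoothness ℝ 3) M := by
    rw [minSmoothness_of_isRCLikeNormedField]; infer_instance
  have : IsManifold 𝓘(ℝ, E) (((⊤ : ℕ∞) : WithTop ℕ∞) + 1) M :=
    inferInstanceAs (IsManifold 𝓘(ℝ, E) ∞ M)
  refine ContDiff.mlieBracket_vectorField (n := ⊤) (m := ⊤) hX hY ?_
  rw [minSmoothness_of_isRCLikeNormedField]
  rfl

lemma mfderiv_apply_eq_fderiv_chart_self (p : M) {g : M → F}
    (hg : MDifferentiableAt 𝓘(ℝ, E) 𝓘(ℝ, F) g p) (v : E) :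
    mfderiv 𝓘(ℝ, E) 𝓘(ℝ, F) g p
      (mfderiv 𝓘(ℝ, E) 𝓘(ℝ, E) (extChartAt 𝓘(ℝ, E) p).symm (extChartAt 𝓘(ℝ, E) p p) v) =
      fderiv ℝ (g ∘ (extChartAt 𝓘(ℝ, E) p).symm) (extChartAt 𝓘(ℝ, E) p p) v := by
  have hz : extChartAt 𝓘(ℝ, E) p p ∈ (extChartAt 𝓘(ℝ, E) p).target := mem_extChartAt_target p
  have hp : (extChartAt 𝓘(ℝ, E) p).symm (extChartAt 𝓘(ℝ, E) p p) = p := extChartAt_to_inv p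
  have hg' : MDifferentiableAt 𝓘(ℝ, E) 𝓘(ℝ, F) g
      ((extChartAt 𝓘(ℝ, E) p).symm (extChartAt 𝓘(ℝ, E) p p)) := by rwa [hp]
  rw [← mfderiv_eq_fderiv, mfderiv_comp _ hg' (mdifferentiableAt_chart_symm hz)]
  rw [hp]
  rfl

/-- The Lie bracket on `M` is the Lie bracket of the fields read in a chart. -/
lemma mlieBracket_eq_mfderiv_chart_symm (p : M) :
    VectorField.mlieBracket 𝓘(ℝ, E) X Y p =
      mfderiv 𝓘(ℝ, E) 𝓘(ℝ, E) (extChartAt 𝓘(ℝ, E) p).symm (extChartAt 𝓘(ℝ, E) p p)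
        (VectorField.lieBracket (E := E) ℝ (chartField p X) (chartField p Y)
          (extChartAt 𝓘(ℝ, E) p p)) := by
  have hinv := isInvertible_mfderiv_extChartAt (I := 𝓘(ℝ, E))
    (mem_extChartAt_source (I := 𝓘(ℝ, E)) p)
  have hcomp := mfderiv_extChartAt_comp_mfderivWithin_extChartAt_symm' (I := 𝓘(ℝ, E))
    (mem_extChartAt_source (I := 𝓘(ℝ, E)) p)
  obtain ⟨e, he⟩ := hinv
  rw [ModelWithCorners.range_eq_univ, mfderivWithin_univ, ← he] at hcomp
  rw [← VectorField.mlieBracketWithin_univ, VectorField.mlieBracketWithin_apply, ← he,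
    ContinuousLinearMap.inverse_equiv, ModelWithCorners.range_eq_univ, preimage_univ, inter_univ,
    VectorField.mpullbackWithin_univ, VectorField.mpullbackWithin_univ]
  have huniv := VectorField.lieBracketWithin_univ (𝕜 := ℝ) (V := chartField (E := E) p X)
    (W := chartField (E := E) p Y)
  rw [← huniv]
  refine (ContinuousLinearEquiv.symm_apply_eq e).2 ?_
  exact (congrArg (fun L : E →L[ℝ] E => L (VectorField.lieBracketWithin (E := E) ℝ
    (chartField p X) (chartField p Y) univ (extChartAt 𝓘(ℝ, E) p p))) hcomp).symm

/-- The Lie bracket of vector fields acts on functions as the commutator: in a chart, the second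
derivatives of the function cancel by symmetry. -/
lemma fieldDerivation_mlieBracket [CompleteSpace E] (hX : IsSmoothField X) (hY : IsSmoothField Y)
    (hXY : IsSmoothField (VectorField.mlieBracket 𝓘(ℝ, E) X Y)) :
    (fieldDerivation _ hXY : Module.End ℝ C^∞⟮𝓘(ℝ, E), M; 𝓘(ℝ, F), F⟯) =
      fieldDerivation X hX * fieldDerivation Y hY -
        fieldDerivation Y hY * fieldDerivation X hX := by
  ext f p
  have hU : IsOpen (extChartAt 𝓘(ℝ, E) p).target := isOpen_extChartAt_target p
  have hz : extChartAt 𝓘(ℝ, E) p p ∈ (extChartAt 𝓘(ℝ, E) p).target := mem_extChartAt_target p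
  have hp : (extChartAt 𝓘(ℝ, E) p).symm (extChartAt 𝓘(ℝ, E) p p) = p := extChartAt_to_inv p
  have hself : ∀ (Z : ∀ p : M, TangentSpace 𝓘(ℝ, E) p), Z p = mfderiv 𝓘(ℝ, E) 𝓘(ℝ, E)
      (extChartAt 𝓘(ℝ, E) p).symm (extChartAt 𝓘(ℝ, E) p p)
        (chartField (E := E) p Z (extChartAt 𝓘(ℝ, E) p p)) := fun Z => by
    rw [mfderiv_chart_symm_chartField hz, hp]
  have hfc : ContDiffAt ℝ ∞ (f ∘ (extChartAt 𝓘(ℝ, E) p).symm) (extChartAt 𝓘(ℝ, E) p p) :=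
    ((contMDiffOn_iff_contDiffOn.1 (f.contMDiff.comp_contMDiffOn
      (contMDiffOn_extChartAt_symm p))) _ hz).contDiffAt (hU.mem_nhds hz)
  -- the second-order operator `Z W` in the chart
  have hder : ∀ (Z W : ∀ p : M, TangentSpace 𝓘(ℝ, E) p) (hZ : IsSmoothField Z)
      (hW : IsSmoothField W), fieldDerivation Z hZ (fieldDerivation W hW f) p =
      fderiv ℝ (fderiv ℝ (f ∘ (extChartAt 𝓘(ℝ, E) p).symm)) (extChartAt 𝓘(ℝ, E) p p)
        (chartField p Z (extChartAt 𝓘(ℝ, E) p p)) (chartField p W (extChartAt 𝓘(ℝ, E) p p)) +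
      fderiv ℝ (f ∘ (extChartAt 𝓘(ℝ, E) p).symm) (extChartAt 𝓘(ℝ, E) p p)
        (fderiv ℝ (chartField p W) (extChartAt 𝓘(ℝ, E) p p)
          (chartField p Z (extChartAt 𝓘(ℝ, E) p p))) := by
    intro Z W hZ hW
    rw [fieldDerivation_apply, hself Z, mfderiv_apply_eq_fderiv_chart_self p
      (mdifferentiable_of_smooth _ p)]
    have hcongr : (fieldDerivation W hW f ∘ (extChartAt 𝓘(ℝ, E) p).symm) =ᶠ[
        𝓝 (extChartAt 𝓘(ℝ, E) p p)]
        fun z => fderiv ℝ (f ∘ (extChartAt 𝓘(ℝ, E) p).symm) z (chartField p W z) := by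
      filter_upwards [hU.mem_nhds hz] with z hz'
      exact mfderiv_apply_eq_fderiv_chart hz' (mdifferentiable_of_smooth f _)
    have hd1 : DifferentiableAt ℝ (fderiv ℝ (f ∘ (extChartAt 𝓘(ℝ, E) p).symm))
        (extChartAt 𝓘(ℝ, E) p p) :=
      (hfc.fderiv_right (m := 1)
        (by simpa [one_add_one_eq_two] using two_le_infty)).differentiableAt one_ne_zero
    have hd2 : DifferentiableAt ℝ (chartField p W) (extChartAt 𝓘(ℝ, E) p p) :=
      (((contDiffOn_chartField hW p) _ hz).contDiffAt (hU.mem_nhds hz)).differentiableAt (by simp)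
    rw [hcongr.fderiv_eq, fderiv_clm_apply hd1 hd2]
    simp [add_comm]
  have hsymm := (hfc.isSymmSndFDerivAt (by
    rw [minSmoothness_of_isRCLikeNormedField]; exact two_le_infty))
  change fieldDerivation _ hXY f p = fieldDerivation X hX (fieldDerivation Y hY f) p -
    fieldDerivation Y hY (fieldDerivation X hX f) p
  rw [hder X Y hX hY, hder Y X hY hX, fieldDerivation_apply, mlieBracket_eq_mfderiv_chart_symm,
    mfderiv_apply_eq_fderiv_chart_self p (mdifferentiable_of_smooth f p),
    VectorField.lieBracket, map_sub, hsymm.eq]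
  abel

end VectorFields

/-! ### Local flows and Taylor expansions -/

section Flows

/-- Taylor's formula for a chain of successive derivatives. -/
lemma norm_sub_taylor_le {F : Type*} [NormedAddCommGroup F] [NormedSpace ℝ F] {ε C : ℝ} (N : ℕ)
    {h : ℕ → ℝ → F}
    (hderiv : ∀ k, ∀ t ∈ Icc 0 ε, HasDerivWithinAt (h k) (h (k + 1) t) (Icc 0 ε) t)
    (hC : ∀ t ∈ Icc 0 ε, ‖h N t‖ ≤ C) :
    ∀ t ∈ Icc 0 ε,
      ‖h 0 t - ∑ k ∈ Finset.range N, t ^ k • ((k.factorial : ℝ)⁻¹ • h k 0)‖ ≤ C * t ^ N := by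
  induction N generalizing h with
  | zero => simpa using hC
  | succ N ih =>
    intro t ht
    have hC0 : 0 ≤ C := (norm_nonneg _).trans (hC t ht)
    have ih' := ih (h := fun k => h (k + 1)) (fun k => hderiv (k + 1)) hC
    set g : ℝ → F := fun s =>
      h 0 s - ∑ k ∈ Finset.range (N + 1), s ^ k • ((k.factorial : ℝ)⁻¹ • h k 0) with hg
    have hsub : Icc 0 t ⊆ Icc 0 ε := Icc_subset_Icc_right ht.2
    have hpow : ∀ (k : ℕ) (s : ℝ), HasDerivAt
        (fun s : ℝ => s ^ (k + 1) • (((k + 1).factorial : ℝ)⁻¹ • h (k + 1) 0))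
        (s ^ k • ((k.factorial : ℝ)⁻¹ • h (k + 1) 0)) s := by
      intro k s
      have := (hasDerivAt_pow (k + 1) s).smul_const (((k + 1).factorial : ℝ)⁻¹ • h (k + 1) 0)
      convert! this using 1
      have hk : ((k + 1 : ℕ) : ℝ) ≠ 0 := by positivity
      rw [smul_smul, smul_smul, Nat.factorial_succ]
      congr 1
      push_cast at hk ⊢
      field_simp
    have hgd : ∀ s ∈ Icc 0 t, HasDerivWithinAt g
        (h 1 s - ∑ k ∈ Finset.range N, s ^ k • ((k.factorial : ℝ)⁻¹ • h (k + 1) 0))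
        (Icc 0 t) s := by
      intro s hs
      have h1 := (hderiv 0 s (hsub hs)).mono hsub
      have h2 : HasDerivAt (fun s : ℝ =>
          ∑ k ∈ Finset.range (N + 1), s ^ k • ((k.factorial : ℝ)⁻¹ • h k 0))
          (∑ k ∈ Finset.range N, s ^ k • ((k.factorial : ℝ)⁻¹ • h (k + 1) 0)) s := by
        simp only [Finset.sum_range_succ']
        simpa using (HasDerivAt.fun_sum (u := Finset.range N) fun k _ => hpow k s)
      exact h1.sub h2.hasDerivWithinAt
    have hbound : ∀ s ∈ Ico 0 t,
        ‖h 1 s - ∑ k ∈ Finset.range N, s ^ k • ((k.factorial : ℝ)⁻¹ • h (k + 1) 0)‖ ≤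
          C * t ^ N := by
      intro s hs
      refine (ih' s (hsub ⟨hs.1, hs.2.le⟩)).trans ?_
      have := pow_le_pow_left₀ hs.1 hs.2.le N
      gcongr
    have := norm_image_sub_le_of_norm_deriv_le_segment' hgd hbound t (right_mem_Icc.2 ht.1)
    have hg0 : g 0 = 0 := by
      simp [hg, Finset.sum_range_succ']
    rw [hg0, sub_zero, sub_zero, mul_assoc, ← pow_succ] at this
    exact this

variable {E : Type*} [NormedAddCommGroup E] [NormedSpace ℝ E] [CompleteSpace E]
  {M : Type*} [TopologicalSpace M] [ChartedSpace E M] [IsManifold 𝓘(ℝ, E) ∞ M]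
  {X : ∀ p : M, TangentSpace 𝓘(ℝ, E) p}

/-- A smooth vector field has a flow near every point, on a time interval that is uniform in the
starting point and stays in a prescribed neighbourhood. -/
theorem exists_local_flow (hX : IsSmoothField X) (p₀ : M) :
    ∃ Φ : M → ℝ → M, ∀ K ∈ 𝓝 p₀, ∃ ε > 0, ∀ᶠ p in 𝓝 p₀, Φ p 0 = p ∧
      ContMDiffOn 𝓘(ℝ, ℝ) 𝓘(ℝ, E) 1 (Φ p) (Icc 0 ε) ∧ ∀ t ∈ Icc 0 ε, Φ p t ∈ K ∧
        HasMFDerivWithinAt 𝓘(ℝ, ℝ) 𝓘(ℝ, E) (Φ p) (Icc 0 ε) t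
          ((1 : ℝ →L[ℝ] ℝ).smulRight (X (Φ p t))) := by
  have hU : IsOpen (extChartAt 𝓘(ℝ, E) p₀).target := isOpen_extChartAt_target p₀
  have hz : extChartAt 𝓘(ℝ, E) p₀ p₀ ∈ (extChartAt 𝓘(ℝ, E) p₀).target := mem_extChartAt_target p₀
  have hV := contDiffOn_chartField hX p₀
  -- the flow in the chart, with continuous dependence on the initial point
  obtain ⟨ε, hε, a, r, L, k, hr, hpl⟩ := IsPicardLindelof.of_contDiffAt_one
    (((hV _ hz).contDiffAt (hU.mem_nhds hz)).of_le (by simp))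
  obtain ⟨α, hα, hαc⟩ :=
    (hpl 0).exists_forall_mem_closedBall_eq_hasDerivWithinAt_continuousOn
  simp only [zero_sub, zero_add] at hα hαc
  refine ⟨fun p t => (extChartAt 𝓘(ℝ, E) p₀).symm (α (extChartAt 𝓘(ℝ, E) p₀ p, t)),
    fun K hK => ?_⟩
  have hmem : Metric.closedBall (extChartAt 𝓘(ℝ, E) p₀ p₀) r ×ˢ Icc (-ε) ε ∈
      𝓝 (extChartAt 𝓘(ℝ, E) p₀ p₀, (0 : ℝ)) :=
    prod_mem_nhds (Metric.closedBall_mem_nhds _ (by exact_mod_cast hr))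
      (Icc_mem_nhds (by linarith) hε)
  have hα0 : α (extChartAt 𝓘(ℝ, E) p₀ p₀, 0) = extChartAt 𝓘(ℝ, E) p₀ p₀ :=
    (hα _ (Metric.mem_closedBall_self r.2)).1
  have hαt : Tendsto α (𝓝 (extChartAt 𝓘(ℝ, E) p₀ p₀, (0 : ℝ)))
      (𝓝 (extChartAt 𝓘(ℝ, E) p₀ p₀)) := by
    have := (hαc.continuousAt hmem).tendsto
    rwa [hα0] at this
  have hKT : (extChartAt 𝓘(ℝ, E) p₀).target ∩ (extChartAt 𝓘(ℝ, E) p₀).symm ⁻¹' K ∈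
      𝓝 (extChartAt 𝓘(ℝ, E) p₀ p₀) :=
    inter_mem (hU.mem_nhds hz) ((continuousAt_extChartAt_symm p₀).preimage_mem_nhds
      (by rwa [extChartAt_to_inv]))
  obtain ⟨δ, hδ, hball⟩ := Metric.mem_nhds_iff.1 (inter_mem hmem (hαt hKT))
  have hin : ∀ p, extChartAt 𝓘(ℝ, E) p₀ p ∈ Metric.ball (extChartAt 𝓘(ℝ, E) p₀ p₀) δ →
      ∀ t ∈ Icc (0 : ℝ) (δ / 2), (extChartAt 𝓘(ℝ, E) p₀ p, t) ∈
        Metric.ball (extChartAt 𝓘(ℝ, E) p₀ p₀, (0 : ℝ)) δ := by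
    intro p hp t ht
    rw [Metric.mem_ball, Prod.dist_eq, max_lt_iff]
    refine ⟨hp, ?_⟩
    simp only [Real.dist_eq, sub_zero, abs_of_nonneg ht.1]
    linarith [ht.2]
  refine ⟨δ / 2, half_pos hδ, ?_⟩
  filter_upwards [extChartAt_source_mem_nhds (I := 𝓘(ℝ, E)) p₀,
    (continuousAt_extChartAt (I := 𝓘(ℝ, E)) p₀).preimage_mem_nhds (Metric.ball_mem_nhds _ hδ)]
    with p hps hpb
  have hin' := fun t ht => hball (hin p hpb t ht)
  have hd : ∀ t ∈ Icc 0 (δ / 2), HasDerivWithinAt (fun t => α (extChartAt 𝓘(ℝ, E) p₀ p, t))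
      (chartField p₀ X (α (extChartAt 𝓘(ℝ, E) p₀ p, t))) (Icc 0 (δ / 2)) t := fun t ht =>
    ((hα _ (hin' t ht).1.1).2 t (hin' t ht).1.2).mono fun s hs => (hin' s hs).1.2
  have hC1 : ContDiffOn ℝ 1 (fun t => α (extChartAt 𝓘(ℝ, E) p₀ p, t)) (Icc 0 (δ / 2)) :=
    ODE.contDiffOn_enat_Icc_of_hasDerivWithinAt (n := 1) (f := fun _ => chartField p₀ X)
      (u := (extChartAt 𝓘(ℝ, E) p₀).target)
      ((hV.of_le (by simp)).comp contDiffOn_snd fun x hx => hx.2) hd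
      fun t ht => (hin' t ht).2.1
  have h0 : (0 : ℝ) ∈ Icc 0 (δ / 2) := left_mem_Icc.2 (half_pos hδ).le
  refine ⟨?_, ?_, fun t ht => ⟨(hin' t ht).2.2, ?_⟩⟩
  · rw [(hα _ (hin' 0 h0).1.1).1, (extChartAt 𝓘(ℝ, E) p₀).left_inv hps]
  · exact (contMDiffOn_extChartAt_symm p₀).comp hC1.contMDiffOn fun t ht => (hin' t ht).2.1
  · have h1 := (mdifferentiableAt_chart_symm (p₀ := p₀) (hin' t ht).2.1).hasMFDerivAt
    have h2 := (hd t ht).hasFDerivWithinAt.hasMFDerivWithinAt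
    have h3 := h1.comp_hasMFDerivWithinAt t h2
    refine h3.congr_mfderiv ?_
    refine ContinuousLinearMap.ext_ring ?_
    have := mfderiv_chart_symm_chartField (X := X) (p₀ := p₀) (hin' t ht).2.1
    refine Eq.trans ?_ (this.trans (one_smul ℝ _).symm)
    exact congrArg (mfderiv 𝓘(ℝ, E) 𝓘(ℝ, E) (extChartAt 𝓘(ℝ, E) p₀).symm
      (α (extChartAt 𝓘(ℝ, E) p₀ p, t)))
      (one_smul ℝ (chartField (E := E) p₀ X (α (extChartAt 𝓘(ℝ, E) p₀ p, t))))

end Flows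

/-! ### Leading terms of operator-valued power series -/

section LeadingTerms

variable {R : Type*} [Ring R]

/-- The power series `u` has the form `1 + ε ^ a A + O(ε ^ (a + 1))`. -/
def HasLeadingTerm (u : PowerSeries R) (a : ℕ) (A : R) : Prop :=
  ∃ U : PowerSeries R, u = 1 + PowerSeries.X ^ a * U ∧ PowerSeries.constantCoeff U = A

lemma HasLeadingTerm.constantCoeff {u : PowerSeries R} {a : ℕ} {A : R}
    (h : HasLeadingTerm u a A) (ha : 1 ≤ a) : PowerSeries.constantCoeff u = 1 := by
  obtain ⟨U, rfl, -⟩ := h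
  obtain ⟨b, rfl⟩ : ∃ b, a = b + 1 := ⟨a - 1, by omega⟩
  simp [pow_succ']

lemma constantCoeff_inv_of_eq_one {u : (PowerSeries R)ˣ}
    (h : PowerSeries.constantCoeff (u : PowerSeries R) = 1) :
    PowerSeries.constantCoeff ((u⁻¹ : (PowerSeries R)ˣ) : PowerSeries R) = 1 := by
  have := congrArg (PowerSeries.constantCoeff (R := R)) u.mul_inv
  rwa [map_mul, h, one_mul, map_one] at this

lemma HasLeadingTerm.inv {u : (PowerSeries R)ˣ} {a : ℕ} {A : R}
    (h : HasLeadingTerm (u : PowerSeries R) a A) (ha : 1 ≤ a) :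
    HasLeadingTerm ((u⁻¹ : (PowerSeries R)ˣ) : PowerSeries R) a (-A) := by
  have h1 := constantCoeff_inv_of_eq_one (h.constantCoeff ha)
  obtain ⟨U, hU, hA⟩ := h
  refine ⟨-U * (u⁻¹ : (PowerSeries R)ˣ), ?_, by simp [hA, h1]⟩
  have h2 := u.mul_inv
  rw [hU, add_mul, one_mul] at h2
  rw [neg_mul, mul_neg, ← mul_assoc]
  exact eq_sub_of_add_eq h2 |>.trans (sub_eq_add_neg _ _)

/-- The leading term of a group commutator is the ring commutator of the leading terms. -/
lemma HasLeadingTerm.commutator {u v : (PowerSeries R)ˣ} {a b : ℕ} {A B : R}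
    (hu : HasLeadingTerm (u : PowerSeries R) a A) (hv : HasLeadingTerm (v : PowerSeries R) b B)
    (ha : 1 ≤ a) (hb : 1 ≤ b) :
    HasLeadingTerm ((u * v * u⁻¹ * v⁻¹ : (PowerSeries R)ˣ) : PowerSeries R) (a + b)
      (A * B - B * A) := by
  have hu1 := constantCoeff_inv_of_eq_one (hu.constantCoeff ha)
  have hv1 := constantCoeff_inv_of_eq_one (hv.constantCoeff hb)
  obtain ⟨U, hU, hA⟩ := hu
  obtain ⟨V, hV, hB⟩ := hv
  refine ⟨(U * V - V * U) * (u⁻¹ : (PowerSeries R)ˣ) * (v⁻¹ : (PowerSeries R)ˣ), ?_,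
    by simp [hA, hB, hu1, hv1]⟩
  have hX : ∀ (n : ℕ) (W : PowerSeries R), W * PowerSeries.X ^ n = PowerSeries.X ^ n * W :=
    fun n W => ((PowerSeries.commute_X W).pow_right n).eq
  have key : (u : PowerSeries R) * (v : PowerSeries R) -
      (v : PowerSeries R) * (u : PowerSeries R) = PowerSeries.X ^ (a + b) * (U * V - V * U) := by
    have h1 : PowerSeries.X ^ a * U * (PowerSeries.X ^ b * V) =
        PowerSeries.X ^ (a + b) * (U * V) := by
      rw [mul_assoc, ← mul_assoc U, hX b U, pow_add]; simp only [mul_assoc]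
    have h2 : PowerSeries.X ^ b * V * (PowerSeries.X ^ a * U) =
        PowerSeries.X ^ (a + b) * (V * U) := by
      rw [mul_assoc, ← mul_assoc V, hX a V, add_comm a b, pow_add]; simp only [mul_assoc]
    rw [hU, hV, mul_sub, ← h1, ← h2]
    noncomm_ring
  have h3 : (v : PowerSeries R) * (u : PowerSeries R) * (u⁻¹ : (PowerSeries R)ˣ) *
      (v⁻¹ : (PowerSeries R)ˣ) = 1 := by
    simp [mul_assoc]
  rw [← mul_assoc, ← mul_assoc, ← key, sub_mul, sub_mul, h3]
  push_cast
  abel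

variable [Algebra ℝ R]

/-- The power series `exp (ε A)` in the variable `ε`. -/
def expSeries (A : R) : PowerSeries R :=
  PowerSeries.mk fun k => (k.factorial : ℝ)⁻¹ • A ^ k

lemma hasLeadingTerm_expSeries (A : R) : HasLeadingTerm (expSeries A) 1 A := by
  refine ⟨PowerSeries.mk fun k => ((k + 1).factorial : ℝ)⁻¹ • A ^ (k + 1), ?_, by
    simp [← PowerSeries.coeff_zero_eq_constantCoeff_apply]⟩
  ext n
  cases n with
  | zero => simp [expSeries]
  | succ n => simp [expSeries, PowerSeries.coeff_succ_X_mul, PowerSeries.coeff_one]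

lemma expSeries_mul_expSeries_neg (A : R) : expSeries A * expSeries (-A) = 1 := by
  ext n
  rw [PowerSeries.coeff_mul]
  simp only [expSeries, PowerSeries.coeff_mk, PowerSeries.coeff_one]
  have h := (Commute.neg_right (Commute.refl A)).add_pow' n
  have h2 : ∑ m ∈ Finset.HasAntidiagonal.antidiagonal n, ((m.1.factorial : ℝ)⁻¹ • A ^ m.1) *
      ((m.2.factorial : ℝ)⁻¹ • (-A) ^ m.2) = (n.factorial : ℝ)⁻¹ • (A + -A) ^ n := by
    rw [h, Finset.smul_sum]
    refine Finset.sum_congr rfl fun m hm => ?_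
    rw [Finset.HasAntidiagonal.mem_antidiagonal] at hm
    rw [smul_mul_smul_comm, ← Nat.cast_smul_eq_nsmul ℝ, smul_smul]
    congr 1
    have hc := Nat.choose_mul_factorial_mul_factorial (by omega : m.1 ≤ n)
    rw [show n - m.1 = m.2 by omega] at hc
    have h1 : (m.1.factorial : ℝ) ≠ 0 := by positivity
    have h2 : (m.2.factorial : ℝ) ≠ 0 := by positivity
    have h3 : (n.factorial : ℝ) ≠ 0 := by positivity
    have hc' : ((n.choose m.1 : ℕ) : ℝ) * m.1.factorial * m.2.factorial = n.factorial := by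
      exact_mod_cast hc
    field_simp
    linarith
  rw [h2]
  cases n <;> simp

/-- `exp (ε A)` as a unit. -/
def expUnit (A : R) : (PowerSeries R)ˣ where
  val := expSeries A
  inv := expSeries (-A)
  val_inv := expSeries_mul_expSeries_neg A
  inv_val := by simpa using expSeries_mul_expSeries_neg (-A)

end LeadingTerms

/-! ### Horizontal motions -/

section Reachability

open Asymptotics

variable {E : Type*} [NormedAddCommGroup E] [NormedSpace ℝ E] [FiniteDimensional ℝ E]
  {M : Type*} [TopologicalSpace M] [ChartedSpace E M]
  [RiemannianBundle (fun p : M => TangentSpace 𝓘(ℝ, E) p)]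
  {F : Type*} [NormedAddCommGroup F] [NormedSpace ℝ F]
  {D : ∀ p : M, Submodule ℝ (TangentSpace 𝓘(ℝ, E) p)}

/-- The family of maps `μ ε`, of which only the germ at `p₀` for small `ε ≥ 0` matters, moves points
at a cost `O(ε)` that is uniform in `q`, and `f ∘ μ ε` has the asymptotic expansion
`∑ k, ε ^ k (S_k f)` for every smooth `f`, uniformly near `p₀`. The functions take values in a
vector space `F`, so that a chart can be expanded at once. -/
structure IsMotion (D : ∀ p : M, Submodule ℝ (TangentSpace 𝓘(ℝ, E) p)) (p₀ : M)
    (S : PowerSeries (Module.End ℝ C^∞⟮𝓘(ℝ, E), M; 𝓘(ℝ, F), F⟯)) (μ : ℝ → M → M) : Prop where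
  tendsto : Tendsto (fun x : ℝ × M => μ x.1 x.2) (𝓝[≥] 0 ×ˢ 𝓝 p₀) (𝓝 p₀)
  cost : ∃ C : ℝ, 0 ≤ C ∧ ∀ᶠ x : ℝ × M in 𝓝[≥] 0 ×ˢ 𝓝 p₀, ∀ q : ℕ+,
    penalisedEDist D q x.2 (μ x.1 x.2) ≤ ENNReal.ofReal (C * x.1)
  expansion : ∀ (f : C^∞⟮𝓘(ℝ, E), M; 𝓘(ℝ, F), F⟯) (N : ℕ),
    (fun x : ℝ × M => f (μ x.1 x.2) -
      ∑ k ∈ Finset.range N, x.1 ^ k • (PowerSeries.coeff k S f) x.2)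
      =O[𝓝[≥] 0 ×ˢ 𝓝 p₀] fun x => x.1 ^ N

/-- Motions compose, and their expansions multiply. The motion `μ` is performed first, and its
expansion is the left factor, since functions are pulled back. -/
lemma IsMotion.comp {p₀ : M} {S T : PowerSeries (Module.End ℝ C^∞⟮𝓘(ℝ, E), M; 𝓘(ℝ, F), F⟯)}
    {μ ν : ℝ → M → M} (hμ : IsMotion D p₀ S μ) (hν : IsMotion D p₀ T ν) :
    IsMotion D p₀ (S * T) fun ε p => ν ε (μ ε p) := by
  have hpair : Tendsto (fun x : ℝ × M => (x.1, μ x.1 x.2)) (𝓝[≥] 0 ×ˢ 𝓝 p₀)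
      (𝓝[≥] 0 ×ˢ 𝓝 p₀) := tendsto_fst.prodMk hμ.tendsto
  refine ⟨hν.tendsto.comp hpair, ?_, fun f N => ?_⟩
  · obtain ⟨C, hC0, hC⟩ := hμ.cost
    obtain ⟨C', hC0', hC'⟩ := hν.cost
    refine ⟨C + C', by positivity, ?_⟩
    have hpos : ∀ᶠ x : ℝ × M in 𝓝[≥] 0 ×ˢ 𝓝 p₀, 0 ≤ x.1 :=
      tendsto_fst.eventually self_mem_nhdsWithin
    filter_upwards [hC, hpair.eventually hC', hpos] with x h1 h2 h3 q
    refine (penalisedEDist_triangle D q _ (μ x.1 x.2) _).trans ?_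
    rw [add_mul, ENNReal.ofReal_add (by positivity) (by positivity)]
    exact add_le_add (h1 q) (h2 q)
  · have h1 := (hν.expansion f N).comp_tendsto hpair
    have h2 : ∀ l ∈ Finset.range N, (fun x : ℝ × M => x.1 ^ l •
        ((PowerSeries.coeff l T f) (μ x.1 x.2) - ∑ k ∈ Finset.range (N - l),
          x.1 ^ k • (PowerSeries.coeff k S (PowerSeries.coeff l T f)) x.2))
        =O[𝓝[≥] 0 ×ˢ 𝓝 p₀] fun x => x.1 ^ N := by
      intro l hl
      have := (isBigO_refl (fun x : ℝ × M => x.1 ^ l) (𝓝[≥] 0 ×ˢ 𝓝 p₀)).smul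
        (hμ.expansion (PowerSeries.coeff l T f) (N - l))
      refine this.congr_right fun x => ?_
      rw [smul_eq_mul, ← pow_add, Nat.add_sub_cancel' (Finset.mem_range.1 hl).le]
    refine (h1.add (IsBigO.sum h2)).congr_left fun x => ?_
    simp only [Function.comp, smul_sub, Finset.sum_apply, Finset.sum_sub_distrib]
    have hsum : ∑ n ∈ Finset.range N, x.1 ^ n • (PowerSeries.coeff n (S * T) f) x.2 =
        ∑ l ∈ Finset.range N, x.1 ^ l • ∑ k ∈ Finset.range (N - l),
          x.1 ^ k • (PowerSeries.coeff k S (PowerSeries.coeff l T f)) x.2 := by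
      simp only [Finset.smul_sum, smul_smul, ← pow_add]
      rw [← Finset.sum_range_diag_flip N fun l k => x.1 ^ (l + k) •
        (PowerSeries.coeff k S (PowerSeries.coeff l T f)) x.2]
      refine Finset.sum_congr rfl fun n _ => ?_
      rw [PowerSeries.coeff_mul, ← Finset.Nat.sum_antidiagonal_eq_sum_range_succ
        (fun l k => x.1 ^ (l + k) • (PowerSeries.coeff k S (PowerSeries.coeff l T f)) x.2),
        ← Finset.Nat.sum_antidiagonal_swap]
      have hev : ∀ (s : Finset (ℕ × ℕ))
          (a b : ℕ × ℕ → Module.End ℝ C^∞⟮𝓘(ℝ, E), M; 𝓘(ℝ, F), F⟯),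
          ((∑ m ∈ s, a m * b m) f) x.2 = ∑ m ∈ s, (a m (b m f)) x.2 := by
        intro s a b
        induction s using Finset.cons_induction with
        | empty => simp
        | cons m s hm ih =>
          rw [Finset.sum_cons, Finset.sum_cons, ← ih]
          rfl
      rw [hev, Finset.smul_sum]
      refine Finset.sum_congr rfl fun m hm => ?_
      rw [Finset.HasAntidiagonal.mem_antidiagonal] at hm
      simp only [Prod.fst_swap, Prod.snd_swap]
      rw [hm]
    rw [hsum]
    abel

variable [IsManifold 𝓘(ℝ, E) ∞ M]

/-- The flow of a smooth section of `D` is a motion. -/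
lemma exists_isMotion_flow [IsContinuousRiemannianBundle E (fun p : M => TangentSpace 𝓘(ℝ, E) p)]
    {X : ∀ p : M, TangentSpace 𝓘(ℝ, E) p} (hX : IsSmoothField X) (hXD : ∀ p, X p ∈ D p) (p₀ : M) :
    ∃ Φ, IsMotion D p₀ (F := F) (expSeries (fieldDerivation X hX)) Φ := by
  obtain ⟨Φ, hΦ⟩ := exists_local_flow hX p₀
  refine ⟨fun t p => Φ p t, fun K hK => ?_, ?_, fun f N => ?_⟩
  · obtain ⟨ε, hε, h⟩ := hΦ K hK
    rw [mem_map]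
    filter_upwards [prod_mem_prod (Icc_mem_nhdsGE hε) h] with x hx
    exact (hx.2.2.2 x.1 hx.1).1
  · have hc : Continuous fun p => ‖X p‖ ^ 2 := by
      simpa only [real_inner_self_eq_norm_sq] using hX.continuous.inner_bundle hX.continuous
    obtain ⟨ε, hε, h⟩ := hΦ {p | ‖X p‖ ^ 2 < ‖X p₀‖ ^ 2 + 1}
      (hc.continuousAt.eventually_lt_const (lt_add_one _))
    refine ⟨Real.sqrt (‖X p₀‖ ^ 2 + 1), Real.sqrt_nonneg _, ?_⟩
    filter_upwards [prod_mem_prod (Icc_mem_nhdsGE hε) h] with x hx q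
    obtain ⟨⟨hx0, hxε⟩, hp, hC1, hder⟩ := hx
    have hsub : Icc 0 x.1 ⊆ Icc 0 ε := Icc_subset_Icc_right hxε
    have := penalisedEDist_le_penalisedPathLength (D := D) (q := q) (hC1.mono hsub) hx0
    rw [hp] at this
    refine this.trans ?_
    rcases hx0.eq_or_lt with h0 | h0
    · rw [penalisedPathLength_eq_lintegral, ← h0]; simp
    rw [penalisedPathLength_eq_lintegral]
    calc _ ≤ ∫⁻ t in Icc 0 x.1, ENNReal.ofReal (Real.sqrt (‖X p₀‖ ^ 2 + 1)) := by
          refine setLIntegral_mono' measurableSet_Icc fun t ht => ?_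
          obtain ⟨hK, hd⟩ := hder t (hsub ht)
          have hd' := ((hd.mono hsub).mfderivWithin
            ((uniqueDiffOn_Icc h0).uniqueMDiffOn t ht))
          have hv : (mfderivWithin 𝓘(ℝ, ℝ) 𝓘(ℝ, E) (Φ x.2) (Icc 0 x.1) t) (1 : ℝ) =
              X (Φ x.2 t) := by
            rw [hd']
            exact one_smul ℝ _
          have hv' := congrArg (fun v => penalisedMetric D q (Φ x.2 t) v v) hv
          refine ENNReal.ofReal_le_ofReal (Real.sqrt_le_sqrt ?_)
          refine (hv'.trans (penalisedMetric_of_mem q (hXD _))).le.trans (le_of_lt hK)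
      _ = ENNReal.ofReal (Real.sqrt (‖X p₀‖ ^ 2 + 1) * x.1) := by
          rw [setLIntegral_const, Real.volume_Icc, sub_zero,
            ENNReal.ofReal_mul (Real.sqrt_nonneg _)]
  · set A : Module.End ℝ C^∞⟮𝓘(ℝ, E), M; 𝓘(ℝ, F), F⟯ := fieldDerivation X hX
    obtain ⟨ε, hε, h⟩ := hΦ {p | ‖(A ^ N) f p‖ < ‖(A ^ N) f p₀‖ + 1}
      ((((A ^ N) f).contMDiff.continuous.norm.continuousAt).eventually_lt_const (lt_add_one _))
    refine IsBigO.of_bound (‖(A ^ N) f p₀‖ + 1) ?_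
    filter_upwards [prod_mem_prod (Icc_mem_nhdsGE hε) h] with x hx
    obtain ⟨hx0, hp, hC1, hder⟩ := hx
    have hT := norm_sub_taylor_le N (h := fun k t => (A ^ k) f (Φ x.2 t)) (ε := ε)
      (C := ‖(A ^ N) f p₀‖ + 1) (fun k t ht => ?_) (fun t ht => (hder t ht).1.le) x.1 hx0
    · simp only [hp, pow_zero] at hT
      rw [norm_pow, Real.norm_of_nonneg hx0.1]
      simp only [expSeries, PowerSeries.coeff_mk]
      exact hT
    · have hf := (mdifferentiable_of_smooth ((A ^ k) f) (Φ x.2 t)).hasMFDerivAt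
      have h3 : HasFDerivWithinAt (fun s => (A ^ k) f (Φ x.2 s))
          ((show E →L[ℝ] F from mfderiv 𝓘(ℝ, E) 𝓘(ℝ, F) ((A ^ k) f) (Φ x.2 t)).comp
            ((1 : ℝ →L[ℝ] ℝ).smulRight (show E from X (Φ x.2 t)))) (Icc 0 ε) t :=
        (hf.comp_hasMFDerivWithinAt t (hder t ht).2).hasFDerivWithinAt
      have h4 := h3.hasDerivWithinAt
      rw [pow_succ']
      convert! h4 using 1
      exact (congrArg (mfderiv 𝓘(ℝ, E) 𝓘(ℝ, F) ((A ^ k) f) (Φ x.2 t))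
        (one_smul ℝ (X (Φ x.2 t)))).symm

end Reachability

/-! ### Iterated brackets as leading terms -/

section LieAlgebra

variable {E : Type*} [NormedAddCommGroup E] [NormedSpace ℝ E] [FiniteDimensional ℝ E]
  {M : Type*} [TopologicalSpace M] [ChartedSpace E M]
  [RiemannianBundle (fun p : M => TangentSpace 𝓘(ℝ, E) p)]
  {F : Type*} [NormedAddCommGroup F] [NormedSpace ℝ F]
  {D : ∀ p : M, Submodule ℝ (TangentSpace 𝓘(ℝ, E) p)} {p₀ : M}

/-- The operator `A` on smooth functions is the leading term of a motion near `p₀`, and `-A` that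
of its inverse. -/
def IsLeadingMotion (D : ∀ p : M, Submodule ℝ (TangentSpace 𝓘(ℝ, E) p)) (p₀ : M)
    (A : Module.End ℝ C^∞⟮𝓘(ℝ, E), M; 𝓘(ℝ, F), F⟯) : Prop :=
  ∃ a : ℕ, 1 ≤ a ∧ ∃ u : (PowerSeries (Module.End ℝ C^∞⟮𝓘(ℝ, E), M; 𝓘(ℝ, F), F⟯))ˣ,
    HasLeadingTerm (u : PowerSeries _) a A ∧ (∃ μ, IsMotion (F := F) D p₀ (u : PowerSeries _) μ) ∧
      ∃ μ, IsMotion (F := F) D p₀ ((u⁻¹ : (PowerSeries _)ˣ) : PowerSeries _) μ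

lemma IsLeadingMotion.neg {A : Module.End ℝ C^∞⟮𝓘(ℝ, E), M; 𝓘(ℝ, F), F⟯}
    (h : IsLeadingMotion D p₀ A) : IsLeadingMotion D p₀ (-A) := by
  obtain ⟨a, ha, u, hu, h1, h2⟩ := h
  exact ⟨a, ha, u⁻¹, hu.inv ha, h2, by rwa [inv_inv]⟩

lemma IsLeadingMotion.commutator {A B : Module.End ℝ C^∞⟮𝓘(ℝ, E), M; 𝓘(ℝ, F), F⟯}
    (hA : IsLeadingMotion D p₀ A) (hB : IsLeadingMotion D p₀ B) :
    IsLeadingMotion D p₀ (A * B - B * A) := by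
  obtain ⟨a, ha, u, hu, ⟨μ, hμ⟩, ⟨μ', hμ'⟩⟩ := hA
  obtain ⟨b, hb, v, hv, ⟨ν, hν⟩, ⟨ν', hν'⟩⟩ := hB
  refine ⟨a + b, by omega, u * v * u⁻¹ * v⁻¹, hu.commutator hv ha hb, ?_, ?_⟩
  · simp only [Units.val_mul]
    exact ⟨_, ((hμ.comp hν).comp hμ').comp hν'⟩
  · rw [show (u * v * u⁻¹ * v⁻¹)⁻¹ = v * u * v⁻¹ * u⁻¹ by group]
    simp only [Units.val_mul]
    exact ⟨_, ((hν.comp hμ).comp hν').comp hμ'⟩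

variable [IsManifold 𝓘(ℝ, E) ∞ M]

lemma isLeadingMotion_of_section
    [IsContinuousRiemannianBundle E (fun p : M => TangentSpace 𝓘(ℝ, E) p)]
    {X : ∀ p : M, TangentSpace 𝓘(ℝ, E) p} (hX : IsSmoothField X) (hXD : ∀ p, X p ∈ D p) :
    IsLeadingMotion D p₀
      (fieldDerivation X hX : Module.End ℝ C^∞⟮𝓘(ℝ, E), M; 𝓘(ℝ, F), F⟯) := by
  have hX' : IsSmoothField (fun p => -X p) := ContMDiff.neg_section hX
  have hneg : (fieldDerivation _ hX' : Module.End ℝ C^∞⟮𝓘(ℝ, E), M; 𝓘(ℝ, F), F⟯) =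
      -fieldDerivation (F := F) X hX := by
    ext f p
    exact map_neg (mfderiv 𝓘(ℝ, E) 𝓘(ℝ, F) f p) (X p)
  refine ⟨1, le_rfl, expUnit (fieldDerivation X hX), hasLeadingTerm_expSeries _,
    exists_isMotion_flow hX hXD p₀, ?_⟩
  have := exists_isMotion_flow (F := F) (D := D) hX' (fun p => neg_mem (hXD p)) p₀
  rwa [hneg] at this

/-- If a set is closed under commutators, so is its span. -/
lemma commutator_mem_span {R : Type*} [Ring R] [Algebra ℝ R] {s : Set R}
    (hs : ∀ x ∈ s, ∀ y ∈ s, x * y - y * x ∈ s) {x y : R} (hx : x ∈ Submodule.span ℝ s)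
    (hy : y ∈ Submodule.span ℝ s) : x * y - y * x ∈ Submodule.span ℝ s := by
  refine Submodule.span_induction₂ (p := fun x y _ _ => x * y - y * x ∈ Submodule.span ℝ s)
    (fun x y hx hy => Submodule.subset_span (hs x hx y hy)) (by simp) (by simp)
    (fun x y z _ _ _ h1 h2 => ?_) (fun x y z _ _ _ h1 h2 => ?_)
    (fun r x y _ _ h => ?_) (fun r x y _ _ h => ?_) hx hy
  · convert! add_mem h1 h2 using 1; noncomm_ring
  · convert! add_mem h1 h2 using 1; noncomm_ring
  · convert! Submodule.smul_mem _ r h using 1; simp [smul_sub]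
  · convert! Submodule.smul_mem _ r h using 1; simp [smul_sub]

/-- The Lie algebra generated by the sections of `D` acts on functions through linear combinations
of leading terms of motions. -/
lemma LieClosure.exists_mem_span
    [IsContinuousRiemannianBundle E (fun p : M => TangentSpace 𝓘(ℝ, E) p)]
    {Z : ∀ p : M, TangentSpace 𝓘(ℝ, E) p} (hZ : LieClosure D Z) (p₀ : M) :
    ∃ h : IsSmoothField Z, (fieldDerivation Z h : Module.End ℝ C^∞⟮𝓘(ℝ, E), M; 𝓘(ℝ, F), F⟯) ∈
      Submodule.span ℝ {A | IsLeadingMotion D p₀ A} := by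
  induction hZ with
  | of_section X smooth mem =>
    exact ⟨smooth, Submodule.subset_span (isLeadingMotion_of_section smooth mem)⟩
  | add X Y _ _ ihX ihY =>
    obtain ⟨hX, hX'⟩ := ihX
    obtain ⟨hY, hY'⟩ := ihY
    refine ⟨ContMDiff.add_section hX hY, ?_⟩
    convert! add_mem hX' hY' using 1
    ext f p
    exact map_add (mfderiv 𝓘(ℝ, E) 𝓘(ℝ, F) f p) (X p) (Y p)
  | smul c X _ ihX =>
    obtain ⟨hX, hX'⟩ := ihX
    refine ⟨ContMDiff.const_smul_section hX, ?_⟩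
    convert! Submodule.smul_mem _ c hX' using 1
    ext f p
    exact map_smul (mfderiv 𝓘(ℝ, E) 𝓘(ℝ, F) f p) c (X p)
  | bracket X Y _ _ ihX ihY =>
    obtain ⟨hX, hX'⟩ := ihX
    obtain ⟨hY, hY'⟩ := ihY
    refine ⟨isSmoothField_mlieBracket hX hY, ?_⟩
    rw [fieldDerivation_mlieBracket hX hY]
    refine commutator_mem_span (fun A hA B hB => ?_) hX' hY'
    rw [mem_ofPred_eq] at *
    exact hA.commutator hB

end LieAlgebra

/-! ### Steering in every direction -/

section Steering

open Asymptotics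

variable {E : Type*} [NormedAddCommGroup E] [NormedSpace ℝ E] [FiniteDimensional ℝ E]
  {M : Type*} [TopologicalSpace M] [ChartedSpace E M]
  [RiemannianBundle (fun p : M => TangentSpace 𝓘(ℝ, E) p)]
  {D : ∀ p : M, Submodule ℝ (TangentSpace 𝓘(ℝ, E) p)} {p₀ : M}

/-- Near `p₀`, one can move every point `p` to a point `μ c p` at which the function `Ξ` has changed
by `L c`, up to an error `o(c)`, at a cost which is uniform in `q` and at most a multiple of a
positive power of `‖c‖`. -/
structure IsSteering (D : ∀ p : M, Submodule ℝ (TangentSpace 𝓘(ℝ, E) p)) (p₀ : M)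
    (Ξ : M → E) (L : E → E) (μ : E → M → M) : Prop where
  tendsto : Tendsto (fun x : E × M => μ x.1 x.2) (𝓝 0 ×ˢ 𝓝 p₀) (𝓝 p₀)
  cost : ∃ C : ℝ, 0 ≤ C ∧ ∃ θ : ℝ, 0 < θ ∧ ∀ᶠ x : E × M in 𝓝 0 ×ˢ 𝓝 p₀, ∀ q : ℕ+,
    penalisedEDist D q x.2 (μ x.1 x.2) ≤ ENNReal.ofReal (C * ‖x.1‖ ^ θ)
  approx : (fun x : E × M => Ξ (μ x.1 x.2) - Ξ x.2 - L x.1) =o[𝓝 0 ×ˢ 𝓝 p₀] fun x => x.1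

lemma IsSteering.congr {Ξ : M → E} {L L' : E → E} {μ : E → M → M} (h : IsSteering D p₀ Ξ L μ)
    (hL : ∀ c, L c = L' c) : IsSteering D p₀ Ξ L' μ :=
  funext hL ▸ h

lemma isSteering_zero (Ξ : M → E) : IsSteering D p₀ Ξ 0 fun _ p => p :=
  ⟨tendsto_snd, ⟨0, le_rfl, 1, one_pos, .of_forall fun x q => by simp [penalisedEDist_self]⟩,
    by simp⟩

lemma IsSteering.comp {Ξ : M → E} {L L' : E → E} {μ ν : E → M → M}
    (hμ : IsSteering D p₀ Ξ L μ) (hν : IsSteering D p₀ Ξ L' ν) :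
    IsSteering D p₀ Ξ (L + L') fun c p => ν c (μ c p) := by
  have hpair : Tendsto (fun x : E × M => (x.1, μ x.1 x.2)) (𝓝 0 ×ˢ 𝓝 p₀) (𝓝 0 ×ˢ 𝓝 p₀) :=
    tendsto_fst.prodMk hμ.tendsto
  refine ⟨hν.tendsto.comp hpair, ?_, ?_⟩
  · obtain ⟨C, hC0, θ, hθ, hC⟩ := hμ.cost
    obtain ⟨C', hC0', θ', hθ', hC'⟩ := hν.cost
    refine ⟨C + C', by positivity, min θ θ', lt_min hθ hθ', ?_⟩
    have hsmall : ∀ᶠ x : E × M in 𝓝 0 ×ˢ 𝓝 p₀, ‖x.1‖ ≤ 1 :=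
      tendsto_fst.eventually ((continuous_norm.tendsto' (0 : E) 0 norm_zero).eventually_le_const
        one_pos)
    filter_upwards [hC, hpair.eventually hC', hsmall] with x h1 h2 h3 q
    refine (penalisedEDist_triangle D q _ (μ x.1 x.2) _).trans ?_
    rw [add_mul, ENNReal.ofReal_add (by positivity) (by positivity)]
    refine add_le_add ((h1 q).trans ?_) ((h2 q).trans ?_)
    · exact ENNReal.ofReal_le_ofReal (mul_le_mul_of_nonneg_left
        (Real.rpow_le_rpow_of_exponent_ge' (norm_nonneg _) h3 (lt_min hθ hθ').le
          (min_le_left _ _)) hC0)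
    · exact ENNReal.ofReal_le_ofReal (mul_le_mul_of_nonneg_left
        (Real.rpow_le_rpow_of_exponent_ge' (norm_nonneg _) h3 (lt_min hθ hθ').le
          (min_le_right _ _)) hC0')
  · have h2 := IsLittleO.comp_tendsto (g := fun x : E × M => x.1)
      (k := fun x : E × M => (x.1, μ x.1 x.2)) hν.approx hpair
    refine (hμ.approx.add h2).congr_left fun x => ?_
    simp only [Function.comp, Pi.add_apply]
    abel

/-- A motion with leading term `ε ^ a A`, run with parameter `ε = (ℓ c)₊ ^ (1 / a)`, changes `Ξ` by
`(ℓ c)₊ A Ξ` to first order. -/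
lemma IsLeadingMotion.exists_isSteering_posPart
    {A : Module.End ℝ C^∞⟮𝓘(ℝ, E), M; 𝓘(ℝ, E), E⟯} (hA : IsLeadingMotion D p₀ A)
    (Ξ : C^∞⟮𝓘(ℝ, E), M; 𝓘(ℝ, E), E⟯) (ℓ : E →L[ℝ] ℝ) :
    ∃ μ, IsSteering D p₀ Ξ (fun c => max (ℓ c) 0 • A Ξ p₀) μ := by
  obtain ⟨a, ha, u, ⟨U, hU, hUA⟩, ⟨μ, hμ⟩, -⟩ := hA
  have ha0 : a ≠ 0 := by omega
  have ha' : (0 : ℝ) < (a : ℝ)⁻¹ := by positivity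
  set s : E → ℝ := fun c => max (ℓ c) 0 with hs
  set e : E → ℝ := fun c => s c ^ (a : ℝ)⁻¹ with he
  have hs0 : ∀ c, 0 ≤ s c := fun c => le_max_right _ _
  have hpow : ∀ c, e c ^ a = s c := fun c => Real.rpow_inv_natCast_pow (hs0 c) ha0
  have hsle : ∀ c, s c ≤ ‖ℓ‖ * ‖c‖ := fun c =>
    max_le ((le_abs_self _).trans (ℓ.le_opNorm c)) (by positivity)
  have hecont : Tendsto e (𝓝 0) (𝓝 0) := by
    have h1 : Continuous e := ((ℓ.continuous.max continuous_const).rpow_const fun _ => .inr ha'.le)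
    exact h1.tendsto' 0 0 (by simp [he, hs, Real.zero_rpow ha'.ne'])
  have hpair : Tendsto (fun x : E × M => (e x.1, x.2)) (𝓝 0 ×ˢ 𝓝 p₀) (𝓝[≥] 0 ×ˢ 𝓝 p₀) := by
    refine Tendsto.prodMk ?_ tendsto_snd
    exact tendsto_nhdsWithin_iff.2 ⟨hecont.comp tendsto_fst,
      .of_forall fun x => Real.rpow_nonneg (hs0 _) _⟩
  have hsO : (fun x : E × M => s x.1) =O[𝓝 0 ×ˢ 𝓝 p₀] fun x => x.1 :=
    IsBigO.of_bound ‖ℓ‖ (.of_forall fun x => by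
      rw [Real.norm_of_nonneg (hs0 _)]; exact hsle _)
  refine ⟨fun c p => μ (e c) p, hμ.tendsto.comp hpair, ?_, ?_⟩
  · obtain ⟨C, hC0, hC⟩ := hμ.cost
    refine ⟨C * ‖ℓ‖ ^ (a : ℝ)⁻¹, by positivity, (a : ℝ)⁻¹, ha', ?_⟩
    filter_upwards [hpair.eventually hC] with x hx q
    refine (hx q).trans (ENNReal.ofReal_le_ofReal ?_)
    rw [mul_assoc, ← Real.mul_rpow (norm_nonneg _) (norm_nonneg _)]
    exact mul_le_mul_of_nonneg_left (Real.rpow_le_rpow (hs0 _) (hsle _) ha'.le) hC0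
  · have h1 := (hμ.expansion Ξ (a + 1)).comp_tendsto hpair
    have h2 : (fun x : E × M => e x.1 ^ (a + 1)) =o[𝓝 0 ×ˢ 𝓝 p₀] fun x => x.1 := by
      have h3 : (fun x : E × M => e x.1) =o[𝓝 0 ×ˢ 𝓝 p₀] fun _ => (1 : ℝ) :=
        (isLittleO_one_iff ℝ).2 (hecont.comp tendsto_fst)
      refine ((h3.mul_isBigO hsO.norm_right).congr (fun x => ?_) (fun x => ?_)).of_norm_right
      · rw [pow_succ', hpow]
      · rw [one_mul]
    have h4 : (fun x : E × M => s x.1 • (A Ξ x.2 - A Ξ p₀)) =o[𝓝 0 ×ˢ 𝓝 p₀] fun x => x.1 := by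
      have h5 : (fun x : E × M => A Ξ x.2 - A Ξ p₀) =o[𝓝 0 ×ˢ 𝓝 p₀] fun _ => (1 : ℝ) := by
        refine (isLittleO_one_iff ℝ).2 ?_
        have := ((A Ξ).contMDiff.continuous.tendsto p₀).comp
          (tendsto_snd : Tendsto (Prod.snd : E × M → M) (𝓝 0 ×ˢ 𝓝 p₀) (𝓝 p₀))
        simpa using this.sub_const (A Ξ p₀)
      refine (hsO.norm_right.smul_isLittleO h5).congr_right (fun x => ?_) |>.of_norm_right
      rw [smul_eq_mul, mul_one]
    refine ((h1.trans_isLittleO h2).add h4).congr_left fun x => ?_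
    have hsum : ∑ k ∈ Finset.range (a + 1), e x.1 ^ k •
        (PowerSeries.coeff k (u : PowerSeries (Module.End ℝ C^∞⟮𝓘(ℝ, E), M; 𝓘(ℝ, E), E⟯)) Ξ) x.2 =
          Ξ x.2 + s x.1 • A Ξ x.2 := by
      have hc : ∀ k, PowerSeries.coeff k
          (u : PowerSeries (Module.End ℝ C^∞⟮𝓘(ℝ, E), M; 𝓘(ℝ, E), E⟯)) =
          (if k = 0 then 1 else 0) + if a ≤ k then PowerSeries.coeff (k - a) U else 0 := by
        intro k
        rw [hU, map_add, PowerSeries.coeff_one, PowerSeries.coeff_X_pow_mul']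
      rw [Finset.sum_range_succ, Finset.sum_eq_single 0, hc 0, hc a, hpow]
      · rw [if_pos rfl, if_neg (by omega : ¬ a ≤ 0), if_neg ha0, if_pos le_rfl, Nat.sub_self,
          PowerSeries.coeff_zero_eq_constantCoeff_apply, hUA, zero_add, pow_zero, one_smul,
          add_zero]
        rfl
      · intro k hk hk0
        rw [hc k, if_neg hk0, if_neg (by have := Finset.mem_range.1 hk; omega), add_zero]
        exact smul_zero _
      · intro h
        exact absurd (Finset.mem_range.2 (by omega)) h
    simp only [Function.comp]
    rw [hsum, smul_sub]
    abel

/-- The negative part of `ℓ` is covered by the inverse motion, with leading term `-A`. -/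
lemma IsLeadingMotion.exists_isSteering
    {A : Module.End ℝ C^∞⟮𝓘(ℝ, E), M; 𝓘(ℝ, E), E⟯} (hA : IsLeadingMotion D p₀ A)
    (Ξ : C^∞⟮𝓘(ℝ, E), M; 𝓘(ℝ, E), E⟯) (ℓ : E →L[ℝ] ℝ) :
    ∃ μ, IsSteering D p₀ Ξ (fun c => ℓ c • A Ξ p₀) μ := by
  obtain ⟨μ, hμ⟩ := hA.exists_isSteering_posPart Ξ ℓ
  obtain ⟨ν, hν⟩ := hA.neg.exists_isSteering_posPart Ξ (-ℓ)
  refine ⟨_, (hμ.comp hν).congr fun c => ?_⟩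
  have : (-A) Ξ p₀ = -(A Ξ p₀) := rfl
  simp only [Pi.add_apply, this, neg_apply, smul_neg, ← sub_eq_add_neg,
    ← sub_smul]
  congr 1
  rcases le_total (ℓ c) 0 with h | h
  · rw [max_eq_right h, max_eq_left (by linarith)]; ring
  · rw [max_eq_left h, max_eq_right (by linarith)]; ring

variable [IsManifold 𝓘(ℝ, E) ∞ M]

/-- If `D` is bracket-generating and `Ξ` is a submersion at `p₀`, then `Ξ` can be steered in
every direction. -/
lemma IsBracketGenerating.exists_isSteering
    [IsContinuousRiemannianBundle E (fun p : M => TangentSpace 𝓘(ℝ, E) p)]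
    (hD : IsBracketGenerating D) (Ξ : C^∞⟮𝓘(ℝ, E), M; 𝓘(ℝ, E), E⟯)
    (hΞ : Function.Surjective (mfderiv 𝓘(ℝ, E) 𝓘(ℝ, E) Ξ p₀)) :
    ∃ μ, IsSteering D p₀ Ξ id μ := by
  have hspan : ∀ A ∈ Submodule.span ℝ {A | IsLeadingMotion (F := E) D p₀ A}, ∀ ℓ : E →L[ℝ] ℝ,
      ∃ μ, IsSteering D p₀ Ξ (fun c => ℓ c • A Ξ p₀) μ := by
    intro A hA
    induction hA using Submodule.span_induction with
    | mem A hA => exact fun ℓ => IsLeadingMotion.exists_isSteering hA Ξ ℓ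
    | zero =>
      exact fun ℓ => ⟨_, (isSteering_zero Ξ).congr fun c => (smul_zero _).symm⟩
    | add A B _ _ hA hB =>
      intro ℓ
      obtain ⟨μ, hμ⟩ := hA ℓ
      obtain ⟨ν, hν⟩ := hB ℓ
      exact ⟨_, (hμ.comp hν).congr fun c => (smul_add _ _ _).symm⟩
    | smul r A _ hA =>
      intro ℓ
      obtain ⟨μ, hμ⟩ := hA (r • ℓ)
      refine ⟨_, hμ.congr fun c => ?_⟩
      change (r * ℓ c) • A Ξ p₀ = ℓ c • r • A Ξ p₀
      rw [smul_smul, mul_comm]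
  have hall : ∀ (w : E) (ℓ : E →L[ℝ] ℝ), ∃ μ, IsSteering D p₀ Ξ (fun c => ℓ c • w) μ := by
    intro w ℓ
    obtain ⟨v, hv⟩ := hΞ w
    obtain ⟨Z, hZ, hZv⟩ := hD p₀ v
    obtain ⟨h, hmem⟩ := hZ.exists_mem_span (F := E) p₀
    have := hspan _ hmem ℓ
    rwa [fieldDerivation_apply, hZv, hv] at this
  -- sum over a basis, to steer along the identity
  set b := Module.finBasis ℝ E
  have hfin : ∀ s : Finset (Fin (Module.finrank ℝ E)),
      ∃ μ, IsSteering D p₀ Ξ (fun c => ∑ i ∈ s, b.coord i c • b i) μ := by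
    intro s
    induction s using Finset.cons_induction with
    | empty => exact ⟨_, isSteering_zero _⟩
    | cons i s hi ih =>
      obtain ⟨μ, hμ⟩ := ih
      obtain ⟨ν, hν⟩ := hall (b i) (LinearMap.toContinuousLinearMap (b.coord i))
      refine ⟨_, (hν.comp hμ).congr fun c => ?_⟩
      rw [Finset.sum_cons]
      rfl
  obtain ⟨μ, hμ⟩ := hfin Finset.univ
  exact ⟨μ, hμ.congr b.sum_repr⟩

end Steering

/-! ### Chow's theorem with bounds uniform in the penalty -/

section UniformBound

open Asymptotics

variable {E : Type*} [NormedAddCommGroup E] [NormedSpace ℝ E] [FiniteDimensional ℝ E]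
  {M : Type*}

/-- A chart extends to a smooth map on the whole manifold, up to shrinking its domain. -/
lemma exists_smooth_eventuallyEq_extChartAt [TopologicalSpace M] [T2Space M] [ChartedSpace E M]
    [IsManifold 𝓘(ℝ, E) ∞ M] (p₀ : M) :
    ∃ Ξ : C^∞⟮𝓘(ℝ, E), M; 𝓘(ℝ, E), E⟯, Ξ =ᶠ[𝓝 p₀] extChartAt 𝓘(ℝ, E) p₀ := by
  obtain ⟨f⟩ : Nonempty (SmoothBumpFunction 𝓘(ℝ, E) p₀) := inferInstance
  refine ⟨⟨fun p => f p • extChartAt 𝓘(ℝ, E) p₀ p, f.contMDiff_smul contMDiffOn_extChartAt⟩, ?_⟩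
  filter_upwards [f.eventuallyEq_one] with p hp
  change f p • extChartAt 𝓘(ℝ, E) p₀ p = _
  rw [hp]
  exact one_smul ℝ _

variable [EMetricSpace M] [ChartedSpace E M] [IsManifold 𝓘(ℝ, E) ∞ M]
  [RiemannianBundle (fun p : M => TangentSpace 𝓘(ℝ, E) p)]
  [IsContinuousRiemannianBundle E (fun p : M => TangentSpace 𝓘(ℝ, E) p)]
  [IsRiemannianManifold 𝓘(ℝ, E) M]
  {D : ∀ p : M, Submodule ℝ (TangentSpace 𝓘(ℝ, E) p)}

/-- Chow's theorem, quantitatively: nearby points are at bounded distance, uniformly in `q`. The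
points are joined by steering repeatedly, Newton's method fashion: each step halves the remaining
distance in the chart, so that the costs of the steps are bounded by a geometric series. -/
lemma IsBracketGenerating.exists_nhds_penalisedEDist_le (hD : IsBracketGenerating D) (p₀ : M) :
    ∃ V ∈ 𝓝 p₀, ∃ C : ℝ, ∀ p ∈ V, ∀ z ∈ V, ∀ q : ℕ+, penalisedEDist D q p z ≤ ENNReal.ofReal C := by
  obtain ⟨Ξ, hΞ⟩ := exists_smooth_eventuallyEq_extChartAt (E := E) p₀
  have hsurj : Function.Surjective (mfderiv 𝓘(ℝ, E) 𝓘(ℝ, E) Ξ p₀) := by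
    rw [hΞ.mfderiv_eq]
    exact (isInvertible_mfderiv_extChartAt (mem_extChartAt_source p₀)).bijective.surjective
  obtain ⟨μ, hμ⟩ := hD.exists_isSteering Ξ hsurj
  have hΞ₀ : Ξ p₀ = extChartAt 𝓘(ℝ, E) p₀ p₀ := hΞ.self_of_nhds
  -- the neighbourhood on which `Ξ` is a chart
  set W : Set M := {p | Ξ p = extChartAt 𝓘(ℝ, E) p₀ p} ∩ (extChartAt 𝓘(ℝ, E) p₀).source with hW
  have hWn : W ∈ 𝓝 p₀ := inter_mem hΞ (extChartAt_source_mem_nhds p₀)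
  have hWinv : ∀ p ∈ W, (extChartAt 𝓘(ℝ, E) p₀).symm (Ξ p) = p := fun p hp => by
    rw [hp.1, (extChartAt 𝓘(ℝ, E) p₀).left_inv hp.2]
  obtain ⟨C, hC0, θ, hθ, hcost⟩ := hμ.cost
  have hev := hcost.and ((hμ.approx.bound (half_pos one_pos)).and (hμ.tendsto.eventually hWn))
  obtain ⟨s, hs, N, hN, hsN⟩ := mem_prod_iff.1 hev
  obtain ⟨δ, hδ, hδs⟩ := Metric.mem_nhds_iff.1 hs
  have hNρ : (extChartAt 𝓘(ℝ, E) p₀).symm ⁻¹' N ∈ 𝓝 (Ξ p₀) := by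
    rw [hΞ₀]
    refine (continuousAt_extChartAt_symm (I := 𝓘(ℝ, E)) p₀).preimage_mem_nhds ?_
    rwa [extChartAt_to_inv]
  obtain ⟨ρ, hρ, hρN⟩ := Metric.mem_nhds_iff.1 hNρ
  -- the iterates stay within `3 r` of `p₀` in the chart, and the steps are at most `2 r`
  obtain ⟨r, hr, hr1, hr2, hr3⟩ : ∃ r : ℝ, 0 < r ∧ 3 * r ≤ ρ ∧ 2 * r < δ ∧ 2 * r ≤ 1 := by
    refine ⟨min (ρ / 3) (min (δ / 3) (1 / 2)), by positivity, ?_, ?_, ?_⟩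
    · linarith [min_le_left (ρ / 3) (min (δ / 3) (1 / 2))]
    · linarith [(min_le_right (ρ / 3) (min (δ / 3) (1 / 2))).trans (min_le_left _ _)]
    · linarith [(min_le_right (ρ / 3) (min (δ / 3) (1 / 2))).trans (min_le_right _ _)]
  set κ : ℝ := (1 / 2) ^ θ with hκ
  have hκ0 : 0 ≤ κ := by positivity
  have hκ1 : κ < 1 := Real.rpow_lt_one (by norm_num) (by norm_num) hθ
  refine ⟨{p ∈ W | Ξ p ∈ Metric.ball (Ξ p₀) r}, inter_mem hWn
    (Ξ.contMDiff.continuous.continuousAt.preimage_mem_nhds (Metric.ball_mem_nhds _ hr)),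
    C * (1 - κ)⁻¹, fun p hp z hz q => ?_⟩
  -- each point is steered towards `z`; the steering error halves the remaining distance
  set P : ℕ → M := fun k => (fun p => μ (Ξ z - Ξ p) p)^[k] p with hP
  have hPsucc : ∀ k, P (k + 1) = μ (Ξ z - Ξ (P k)) (P k) := fun k =>
    Function.iterate_succ_apply' _ _ _
  have hin : ∀ k, P k ∈ W → ‖Ξ z - Ξ (P k)‖ ≤ (1 / 2) ^ k * (2 * r) →
      (Ξ z - Ξ (P k), P k) ∈ s ×ˢ N := by
    intro k h1 h2
    have h3 : ‖Ξ z - Ξ (P k)‖ ≤ 2 * r := h2.trans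
      (mul_le_of_le_one_left (by positivity) (pow_le_one₀ (by norm_num) (by norm_num)))
    refine ⟨hδs (by rw [mem_ball_zero_iff]; linarith), ?_⟩
    rw [← hWinv _ h1]
    refine hρN ?_
    have h4 : dist (Ξ z) (Ξ p₀) < r := hz.2
    rw [Metric.mem_ball]
    calc dist (Ξ (P k)) (Ξ p₀) ≤ dist (Ξ (P k)) (Ξ z) + dist (Ξ z) (Ξ p₀) := dist_triangle _ _ _
      _ < 2 * r + r := by
          rw [dist_comm, dist_eq_norm]
          linarith
      _ ≤ ρ := by linarith
  have hinv : ∀ k, P k ∈ W ∧ ‖Ξ z - Ξ (P k)‖ ≤ (1 / 2) ^ k * (2 * r) := by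
    intro k
    induction k with
    | zero =>
      refine ⟨hp.1, ?_⟩
      have h4 : dist (Ξ z) (Ξ p₀) < r := hz.2
      have h5 : dist (Ξ p) (Ξ p₀) < r := hp.2
      have := dist_triangle_right (Ξ z) (Ξ p) (Ξ p₀)
      rw [pow_zero, one_mul, ← dist_eq_norm]
      change dist (Ξ z) (Ξ p) ≤ _
      linarith
    | succ k ih =>
      obtain ⟨-, h2, h3⟩ := hsN (hin k ih.1 ih.2)
      rw [← hPsucc] at h2 h3
      refine ⟨h3, ?_⟩
      have : Ξ z - Ξ (P (k + 1)) = -(Ξ (P (k + 1)) - Ξ (P k) - id (Ξ z - Ξ (P k))) := by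
        simp only [id]; abel
      rw [this, norm_neg, pow_succ']
      refine h2.trans ?_
      have := ih.2
      simp only
      linarith
  have hstep : ∀ k, penalisedEDist D q (P k) (P (k + 1)) ≤ ENNReal.ofReal (C * κ ^ k) := by
    intro k
    obtain ⟨h1, -⟩ := hsN (hin k (hinv k).1 (hinv k).2)
    rw [hPsucc]
    refine (h1 q).trans (ENNReal.ofReal_le_ofReal (mul_le_mul_of_nonneg_left ?_ hC0))
    have h2 : ‖Ξ z - Ξ (P k)‖ ≤ (1 / 2) ^ k := (hinv k).2.trans
      (mul_le_of_le_one_right (by positivity) hr3)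
    calc ‖Ξ z - Ξ (P k)‖ ^ θ ≤ ((1 / 2 : ℝ) ^ k) ^ θ := Real.rpow_le_rpow (norm_nonneg _) h2 hθ.le
      _ = κ ^ k := by
          rw [hκ, ← Real.rpow_natCast, ← Real.rpow_natCast, ← Real.rpow_mul (by norm_num),
            ← Real.rpow_mul (by norm_num), mul_comm]
  have hsum : ∀ n, penalisedEDist D q p (P n) ≤
      ENNReal.ofReal (C * ∑ k ∈ Finset.range n, κ ^ k) := by
    intro n
    induction n with
    | zero => exact (penalisedEDist_self D q p).le.trans zero_le
    | succ n ih =>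
      refine (penalisedEDist_triangle D q p (P n) _).trans ?_
      rw [Finset.sum_range_succ, mul_add, ENNReal.ofReal_add (mul_nonneg hC0
        (Finset.sum_nonneg fun k _ => pow_nonneg hκ0 k)) (by positivity)]
      exact add_le_add ih (hstep n)
  have hlim : Tendsto P atTop (𝓝 z) := by
    have h1 : Tendsto (fun k => Ξ (P k)) atTop (𝓝 (Ξ z)) := by
      rw [tendsto_iff_norm_sub_tendsto_zero]
      refine squeeze_zero (fun _ => norm_nonneg _) (fun k => ?_)
        (((tendsto_pow_atTop_nhds_zero_of_lt_one (by norm_num) (by norm_num :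
          (1 / 2 : ℝ) < 1)).mul_const (2 * r)).trans_eq (by rw [zero_mul]))
      rw [norm_sub_rev]
      exact (hinv k).2
    have h2 : ContinuousAt (extChartAt 𝓘(ℝ, E) p₀).symm (Ξ z) := by
      rw [hz.1.1]
      exact continuousAt_extChartAt_symm' hz.1.2
    have h3 := h2.tendsto.comp h1
    rw [hWinv z hz.1] at h3
    exact h3.congr fun k => hWinv _ (hinv k).1
  -- for fixed `q`, the distance of `P n` to `z` tends to zero, though not uniformly in `q`
  have hlim' : Tendsto (fun n => ENNReal.ofReal (C * (1 - κ)⁻¹) +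
      ENNReal.ofReal (Real.sqrt q) * edist (P n) z) atTop (𝓝 (ENNReal.ofReal (C * (1 - κ)⁻¹))) := by
    have h1 : Tendsto (fun n => edist (P n) z) atTop (𝓝 0) := tendsto_iff_edist_tendsto_0.1 hlim
    have h2 := ENNReal.Tendsto.const_mul (a := ENNReal.ofReal (Real.sqrt q)) h1
      (.inr ENNReal.ofReal_ne_top)
    rw [mul_zero] at h2
    simpa using tendsto_const_nhds.add h2
  refine ge_of_tendsto' hlim' fun n => ?_
  refine (penalisedEDist_triangle D q p (P n) z).trans (add_le_add ((hsum n).trans ?_)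
    (penalisedEDist_le_edist D q _ _))
  refine ENNReal.ofReal_le_ofReal (mul_le_mul_of_nonneg_left ?_ hC0)
  rw [← tsum_geometric_of_lt_one hκ0 hκ1]
  exact (summable_geometric_of_lt_one hκ0 hκ1).sum_le_tsum _ fun k _ => pow_nonneg hκ0 k

/-- The distances `d_q` between two points of a connected component are bounded. -/
lemma IsBracketGenerating.exists_penalisedEDist_le (hD : IsBracketGenerating D) {x y : M}
    (hxy : Joined x y) : ∃ C : ℝ, ∀ q : ℕ+, penalisedEDist D q x y ≤ ENNReal.ofReal C := by
  obtain ⟨c⟩ := hxy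
  set S : Set unitInterval := {t | ∃ C : ℝ, ∀ q : ℕ+, penalisedEDist D q x (c t) ≤ ENNReal.ofReal C}
  have hS : ∀ t, ∃ V ∈ 𝓝 t, ∀ s ∈ V, (s ∈ S ↔ t ∈ S) := by
    intro t
    obtain ⟨V, hV, C, hC⟩ := hD.exists_nhds_penalisedEDist_le (c t)
    have key : ∀ s s', c s ∈ V → c s' ∈ V → s ∈ S → s' ∈ S := by
      rintro s s' hs hs' ⟨C', hC'⟩
      refine ⟨max C' 0 + max C 0, fun q => (penalisedEDist_triangle D q x (c s) _).trans ?_⟩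
      rw [ENNReal.ofReal_add (le_max_right _ _) (le_max_right _ _)]
      exact add_le_add ((hC' q).trans (ENNReal.ofReal_le_ofReal (le_max_left _ _)))
        ((hC _ hs _ hs' q).trans (ENNReal.ofReal_le_ofReal (le_max_left _ _)))
    exact ⟨c ⁻¹' V, c.continuous.continuousAt.preimage_mem_nhds hV, fun s hs =>
      ⟨key s t hs (mem_of_mem_nhds hV), key t s (mem_of_mem_nhds hV) hs⟩⟩
  have hopen : IsOpen S := isOpen_iff_mem_nhds.2 fun t ht => by
    obtain ⟨V, hV, h⟩ := hS t
    exact mem_of_superset hV fun s hs => (h s hs).2 ht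
  have hclosed : IsClosed S := ⟨isOpen_iff_mem_nhds.2 fun t ht => by
    obtain ⟨V, hV, h⟩ := hS t
    exact mem_of_superset hV fun s hs hs' => ht ((h s hs).1 hs')⟩
  have h0 : (0 : unitInterval) ∈ S := ⟨0, fun q => by rw [c.source, penalisedEDist_self]; simp⟩
  have h1 : (1 : unitInterval) ∈ S := by
    rw [IsClopen.eq_univ ⟨hclosed, hopen⟩ ⟨0, h0⟩]
    trivial
  obtain ⟨C, hC⟩ := h1
  exact ⟨C, fun q => c.target ▸ hC q⟩

end UniformBound

/-! ### Sequences of minimising geodesics -/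

section MinimisingSequences

variable {E : Type*} [NormedAddCommGroup E] [NormedSpace ℝ E] [FiniteDimensional ℝ E]
  {M : Type*} [EMetricSpace M] [ChartedSpace E M]
  [RiemannianBundle (fun p : M => TangentSpace 𝓘(ℝ, E) p)]
  {D : ∀ p : M, Submodule ℝ (TangentSpace 𝓘(ℝ, E) p)}

/-- The value of `g_q` on the velocity at time `t` of a curve defined on the real line, of which
only the restriction to `[0, 1]` matters. -/
def speedSq (D : ∀ p : M, Submodule ℝ (TangentSpace 𝓘(ℝ, E) p)) (q : ℕ+) (c : ℝ → M) (t : ℝ) : ℝ :=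
  penalisedMetric D q (c t) (mfderivWithin 𝓘(ℝ, ℝ) 𝓘(ℝ, E) c (Icc 0 1) t 1)
    (mfderivWithin 𝓘(ℝ, ℝ) 𝓘(ℝ, E) c (Icc 0 1) t 1)

lemma penalisedMetric_velocity (q : ℕ+) (c : unitInterval → M) (t : unitInterval) :
    penalisedMetric D q (c t) (velocity c t) (velocity c t) =
      speedSq D q (c ∘ projIcc 0 1 zero_le_one) t := by
  have h : (c ∘ projIcc 0 1 zero_le_one) (t : ℝ) = c t := by simp
  have hv : (mfderivWithin 𝓘(ℝ, ℝ) 𝓘(ℝ, E) (c ∘ projIcc 0 1 zero_le_one) (Icc 0 1) t 1 : E) =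
    (velocity c t : E) := mfderivWithin_comp_projIcc_one (x := 0) (y := 1)
  exact penalisedMetric_congr D q h.symm hv.symm

lemma speedSq_eq_of_subset {q : ℕ+} {c : ℝ → M}
    (hc : ContMDiffOn 𝓘(ℝ, ℝ) 𝓘(ℝ, E) 1 c (Icc 0 1)) {a b t : ℝ} (hab : a < b)
    (h : Icc a b ⊆ Icc 0 1) (ht : t ∈ Icc a b) :
    penalisedMetric D q (c t) (mfderivWithin 𝓘(ℝ, ℝ) 𝓘(ℝ, E) c (Icc a b) t 1)
      (mfderivWithin 𝓘(ℝ, ℝ) 𝓘(ℝ, E) c (Icc a b) t 1) = speedSq D q c t := by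
  have h1 : MDifferentiableWithinAt 𝓘(ℝ, ℝ) 𝓘(ℝ, E) c (Icc 0 1) t :=
    (hc t (h ht)).mdifferentiableWithinAt one_ne_zero
  rw [h1.mfderivWithin_mono ((uniqueDiffOn_Icc hab).uniqueMDiffOn t ht) h]
  rfl

/-- A minimising geodesic runs at constant speed equal to the distance of its endpoints. -/
lemma IsMinimisingGeodesic.exists_speed {q : ℕ+} {x y : M} {γ : unitInterval → M}
    (h : IsMinimisingGeodesic D q x y γ) :
    ∃ L : ℝ, 0 ≤ L ∧ penalisedEDist D q x y = ENNReal.ofReal L ∧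
      ∀ t ∈ Icc (0 : ℝ) 1, speedSq D q (γ ∘ projIcc 0 1 zero_le_one) t = L ^ 2 := by
  obtain ⟨c, hc⟩ := h.constant_speed
  have hc0 : 0 ≤ c := hc 0 ▸ penalisedMetric_self_nonneg D q _ _
  refine ⟨Real.sqrt c, Real.sqrt_nonneg _, ?_, fun t ht => ?_⟩
  · rw [← h.penalisedLength_eq, penalisedLength]
    simp [hc]
  · rw [Real.sq_sqrt hc0, ← hc ⟨t, ht⟩, penalisedMetric_velocity]

lemma IsMinimisingGeodesic.penalisedEDist_mono {q q' : ℕ+} {x y : M} {γ γ' : unitInterval → M}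
    (h : IsMinimisingGeodesic D q x y γ) (h' : IsMinimisingGeodesic D q' x y γ') (hq : q ≤ q') :
    penalisedEDist D q x y ≤ penalisedEDist D q' x y := by
  rw [← h.penalisedLength_eq, ← h'.penalisedLength_eq]
  refine (h.minimising γ' h'.contMDiff h'.source h'.target).trans (lintegral_mono fun t => ?_)
  exact ENNReal.ofReal_le_ofReal (Real.sqrt_le_sqrt (penalisedMetric_mono D hq _ _))

/-- The curves `c j` run at constant speed `L j` with respect to the metric of parameter `q j`, and
`L j` is the distance of their endpoints; they converge uniformly to `γ`, and the `L j` to their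
supremum `Λ`. All curves are defined on the real line, but only `[0, 1]` matters. -/
structure IsMinimisingSequence (D : ∀ p : M, Submodule ℝ (TangentSpace 𝓘(ℝ, E) p)) (q : ℕ → ℕ+)
    (L : ℕ → ℝ) (Λ : ℝ) (c : ℕ → ℝ → M) (γ : ℝ → M) : Prop where
  monotone : Monotone q
  contMDiffOn : ∀ j, ContMDiffOn 𝓘(ℝ, ℝ) 𝓘(ℝ, E) 1 (c j) (Icc 0 1)
  speed_nonneg : ∀ j, 0 ≤ L j
  speed : ∀ j, ∀ t ∈ Icc (0 : ℝ) 1, speedSq D (q j) (c j) t = L j ^ 2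
  speed_le : ∀ j, L j ≤ Λ
  tendsto_speed : Tendsto L atTop (𝓝 Λ)
  tendstoUniformlyOn : TendstoUniformlyOn c γ atTop (Icc 0 1)
  edist_eq : ∀ j, penalisedEDist D (q j) (γ 0) (γ 1) = ENNReal.ofReal (L j)

namespace IsMinimisingSequence

variable {q : ℕ → ℕ+} {L : ℕ → ℝ} {Λ : ℝ} {c : ℕ → ℝ → M} {γ : ℝ → M}

lemma nonneg (h : IsMinimisingSequence D q L Λ c γ) : 0 ≤ Λ :=
  (h.speed_nonneg 0).trans (h.speed_le 0)

lemma continuousOn (h : IsMinimisingSequence D q L Λ c γ) : ContinuousOn γ (Icc 0 1) :=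
  h.tendstoUniformlyOn.continuousOn (.of_forall fun j => (h.contMDiffOn j).continuousOn)

lemma speedSq_le (h : IsMinimisingSequence D q L Λ c γ) {i j : ℕ} (hij : i ≤ j) {t : ℝ}
    (ht : t ∈ Icc (0 : ℝ) 1) : speedSq D (q i) (c j) t ≤ Λ ^ 2 :=
  (penalisedMetric_mono D (h.monotone hij) _ _).trans ((h.speed j t ht).le.trans
    (pow_le_pow_left₀ (h.speed_nonneg j) (h.speed_le j) 2))

lemma penalisedEDist_le (h : IsMinimisingSequence D q L Λ c γ) {i j : ℕ} (hij : i ≤ j) {a b : ℝ}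
    (hab : a ≤ b) (hsub : Icc a b ⊆ Icc 0 1) :
    penalisedEDist D (q i) (c j a) (c j b) ≤ ENNReal.ofReal (Λ * (b - a)) := by
  rcases hab.eq_or_lt with rfl | hlt
  · rw [penalisedEDist_self]; exact zero_le
  refine (penalisedEDist_le_penalisedPathLength ((h.contMDiffOn j).mono hsub) hab).trans ?_
  rw [penalisedPathLength_eq_lintegral]
  calc _ ≤ ∫⁻ t in Icc a b, ENNReal.ofReal Λ := by
        refine setLIntegral_mono' measurableSet_Icc fun t ht => ENNReal.ofReal_le_ofReal ?_
        rw [speedSq_eq_of_subset (h.contMDiffOn j) hlt hsub ht]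
        exact Real.sqrt_le_iff.2 ⟨h.nonneg, h.speedSq_le hij (hsub ht)⟩
    _ = ENNReal.ofReal (Λ * (b - a)) := by
        rw [setLIntegral_const, Real.volume_Icc, ENNReal.ofReal_mul h.nonneg]

variable [IsRiemannianManifold 𝓘(ℝ, E) M]

lemma penalisedEDist_lim_le (h : IsMinimisingSequence D q L Λ c γ) (i : ℕ) {a b : ℝ}
    (hab : a ≤ b) (hsub : Icc a b ⊆ Icc 0 1) :
    penalisedEDist D (q i) (γ a) (γ b) ≤ ENNReal.ofReal (Λ * (b - a)) := by
  have hpt : ∀ t ∈ Icc a b, Tendsto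
      (fun j => ENNReal.ofReal (Real.sqrt (q i)) * edist (γ t) (c j t)) atTop (𝓝 0) := by
    intro t ht
    have h1 := tendsto_iff_edist_tendsto_0.1 (h.tendstoUniformlyOn.tendsto_at (hsub ht))
    simp only [edist_comm _ (γ t)] at h1
    have h2 := ENNReal.Tendsto.const_mul (a := ENNReal.ofReal (Real.sqrt (q i))) h1
      (.inr ENNReal.ofReal_ne_top)
    rwa [mul_zero] at h2
  have hlim := ((hpt a (left_mem_Icc.2 hab)).add
    (tendsto_const_nhds (x := ENNReal.ofReal (Λ * (b - a))))).add (hpt b (right_mem_Icc.2 hab))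
  rw [zero_add, add_zero] at hlim
  refine ge_of_tendsto hlim ?_
  filter_upwards [eventually_ge_atTop i] with j hj
  refine (penalisedEDist_triangle D (q i) _ (c j b) _).trans (add_le_add
    ((penalisedEDist_triangle D (q i) _ (c j a) _).trans (add_le_add
      (penalisedEDist_le_edist D _ _ _) (h.penalisedEDist_le hj hab hsub))) ?_)
  rw [penalisedEDist_comm]
  exact penalisedEDist_le_edist D _ _ _

/-- No piece of the limit curve can be much shorter than `Λ (b - a)`, since the curve would then
be a shortcut between its endpoints. -/
lemma le_penalisedEDist_lim (h : IsMinimisingSequence D q L Λ c γ) (i : ℕ) {a b : ℝ}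
    (ha : 0 ≤ a) (hab : a ≤ b) (hb : b ≤ 1) :
    ENNReal.ofReal (L i) ≤
      ENNReal.ofReal (Λ * (1 - (b - a))) + penalisedEDist D (q i) (γ a) (γ b) := by
  have h1 := h.penalisedEDist_lim_le i ha (Icc_subset_Icc_right (hab.trans hb))
  have h2 := h.penalisedEDist_lim_le i hb (Icc_subset_Icc_left (ha.trans hab))
  rw [← h.edist_eq i]
  refine (penalisedEDist_triangle D (q i) _ (γ b) _).trans ((add_le_add_left
    (penalisedEDist_triangle D (q i) _ (γ a) _) _).trans ?_)
  rw [show Λ * (1 - (b - a)) = Λ * (a - 0) + Λ * (1 - b) by ring, ENNReal.ofReal_add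
    (mul_nonneg h.nonneg (by linarith)) (mul_nonneg h.nonneg (by linarith)), add_right_comm]
  gcongr

/-- The lower bound for the distance of points of the limit curve holds, up to an arbitrarily
small error, for all nearby points. -/
lemma eventually_le_penalisedEDist (h : IsMinimisingSequence D q L Λ c γ) (i : ℕ) {a b : ℝ}
    (ha : 0 ≤ a) (hab : a ≤ b) (hb : b ≤ 1) {ι : Type*} {l : Filter ι} {P Q : ι → M}
    (hP : Tendsto P l (𝓝 (γ a))) (hQ : Tendsto Q l (𝓝 (γ b))) {ε : ℝ} (hε : 0 < ε) :
    ∀ᶠ k in l, ENNReal.ofReal (L i - Λ * (1 - (b - a)) - ε) ≤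
      penalisedEDist D (q i) (P k) (Q k) := by
  have h1 := tendsto_iff_edist_tendsto_0.1 hP
  have h2 := tendsto_iff_edist_tendsto_0.1 hQ
  have h3 := ENNReal.Tendsto.const_mul (a := ENNReal.ofReal (Real.sqrt (q i))) (h1.add h2)
    (.inr ENNReal.ofReal_ne_top)
  rw [add_zero, mul_zero] at h3
  filter_upwards [h3.eventually_le_const (ENNReal.ofReal_pos.2 hε)] with k hk
  have h4 : penalisedEDist D (q i) (γ a) (γ b) ≤
      ENNReal.ofReal ε + penalisedEDist D (q i) (P k) (Q k) := by
    refine (penalisedEDist_triangle D (q i) _ (Q k) _).trans ((add_le_add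
      (penalisedEDist_triangle D (q i) _ (P k) _) le_rfl).trans ?_)
    rw [mul_add] at hk
    rw [add_right_comm]
    refine (add_le_add ?_ le_rfl)
    refine (add_le_add ?_ ?_).trans hk
    · rw [penalisedEDist_comm]; exact penalisedEDist_le_edist D _ _ _
    · exact penalisedEDist_le_edist D _ _ _
  have h5 := (h.le_penalisedEDist_lim i ha hab hb).trans (add_le_add le_rfl h4)
  rw [ENNReal.ofReal_sub _ hε.le, ENNReal.ofReal_sub _ (mul_nonneg h.nonneg (by linarith)),
    tsub_le_iff_left, tsub_le_iff_left]
  exact h5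

end IsMinimisingSequence

end MinimisingSequences

/-! ### The midpoint estimate -/

section MidpointEstimate

variable {E : Type*} [NormedAddCommGroup E] [NormedSpace ℝ E]

/-- The parallelogram identity bounds the `L²` distance of two velocities of energy about `Λ ^ 2` by
the amount by which the length of their mean falls short of that of a curve of speed `Λ`. -/
lemma integral_norm_sub_sq_le {G : E → E → ℝ} {a b m Λ η ℓ : ℝ} (hab : a ≤ b) {w v₁ v₂ : ℝ → E}
    (hΛ : 0 ≤ Λ) (hm0 : 0 ≤ m)
    (hpar : ∀ t ∈ Icc a b, G (w t) ((1 / 2 : ℝ) • (v₁ t - v₂ t)) +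
      G (w t) ((1 / 2 : ℝ) • (v₁ t + v₂ t)) = (G (w t) (v₁ t) + G (w t) (v₂ t)) / 2)
    (hm : ∀ t ∈ Icc a b, ∀ v, m * ‖v‖ ^ 2 ≤ G (w t) v)
    (h₁ : ∀ t ∈ Icc a b, G (w t) (v₁ t) ≤ Λ ^ 2 + η)
    (h₂ : ∀ t ∈ Icc a b, G (w t) (v₂ t) ≤ Λ ^ 2 + η)
    (hv₁ : ContinuousOn v₁ (Icc a b)) (hv₂ : ContinuousOn v₂ (Icc a b))
    (hG : ContinuousOn (fun t => G (w t) ((1 / 2 : ℝ) • (v₁ t + v₂ t))) (Icc a b))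
    (hℓ : ℓ ≤ ∫ t in a..b, Real.sqrt (G (w t) ((1 / 2 : ℝ) • (v₁ t + v₂ t)))) :
    m / 4 * ∫ t in a..b, ‖v₁ t - v₂ t‖ ^ 2 ≤ (2 * Λ ^ 2 + η) * (b - a) - 2 * Λ * ℓ := by
  have hu : uIcc a b = Icc a b := uIcc_of_le hab
  have hS : ContinuousOn (fun t => Real.sqrt (G (w t) ((1 / 2 : ℝ) • (v₁ t + v₂ t)))) (uIcc a b) :=
    hu ▸ hG.sqrt
  have hI : ContinuousOn (fun t => m / 4 * ‖v₁ t - v₂ t‖ ^ 2) (uIcc a b) :=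
    hu ▸ continuousOn_const.mul ((hv₁.sub hv₂).norm.pow 2)
  have hmono : ∫ t in a..b, m / 4 * ‖v₁ t - v₂ t‖ ^ 2 ≤ ∫ t in a..b, ((2 * Λ ^ 2 + η) -
      2 * Λ * Real.sqrt (G (w t) ((1 / 2 : ℝ) • (v₁ t + v₂ t)))) := by
    refine intervalIntegral.integral_mono_on hab hI.intervalIntegrable
      (ContinuousOn.intervalIntegrable (continuousOn_const.sub (continuousOn_const.mul hS)))
      fun t ht => ?_
    have e1 := hm t ht ((1 / 2 : ℝ) • (v₁ t - v₂ t))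
    have e2 : 0 ≤ G (w t) ((1 / 2 : ℝ) • (v₁ t + v₂ t)) :=
      (by positivity : (0 : ℝ) ≤ m * ‖(1 / 2 : ℝ) • (v₁ t + v₂ t)‖ ^ 2).trans (hm t ht _)
    have e3 := hpar t ht
    have e4 := Real.sq_sqrt e2
    -- the energy of the mean is at least `2 Λ` times its speed, minus `Λ ^ 2`
    have e5 := sq_nonneg (Real.sqrt (G (w t) ((1 / 2 : ℝ) • (v₁ t + v₂ t))) - Λ)
    rw [norm_smul, mul_pow] at e1
    norm_num at e1
    have e6 := h₁ t ht
    have e7 := h₂ t ht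
    norm_num at e3 e4 e5 ⊢
    nlinarith
  rw [intervalIntegral.integral_const_mul, intervalIntegral.integral_sub
    (by simp) (hS.intervalIntegrable.const_mul (2 * Λ)),
    intervalIntegral.integral_const, intervalIntegral.integral_const_mul, smul_eq_mul] at hmono
  nlinarith

end MidpointEstimate

/-! ### The penalised metrics in a chart -/

section ChartMetric

variable {E : Type*} [NormedAddCommGroup E] [NormedSpace ℝ E] [FiniteDimensional ℝ E]
  {M : Type*} [TopologicalSpace M] [ChartedSpace E M]
  [RiemannianBundle (fun p : M => TangentSpace 𝓘(ℝ, E) p)]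
  (D : ∀ p : M, Submodule ℝ (TangentSpace 𝓘(ℝ, E) p)) (q : ℕ+) (p₀ : M)

/-- The quadratic form of `g_q`, read in the chart at `p₀`. -/
def chartMetric (z v : E) : ℝ :=
  penalisedMetric D q ((extChartAt 𝓘(ℝ, E) p₀).symm z)
    (mfderiv 𝓘(ℝ, E) 𝓘(ℝ, E) (extChartAt 𝓘(ℝ, E) p₀).symm z v)
    (mfderiv 𝓘(ℝ, E) 𝓘(ℝ, E) (extChartAt 𝓘(ℝ, E) p₀).symm z v)

lemma chartMetric_smul (z : E) (r : ℝ) (v : E) :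
    chartMetric D q p₀ z (r • v) = r ^ 2 * chartMetric D q p₀ z v := by
  refine Eq.trans ?_ (penalisedMetric_smul D q _ r _)
  exact congrArg (fun u => penalisedMetric D q ((extChartAt 𝓘(ℝ, E) p₀).symm z) u u)
    (map_smul (mfderiv 𝓘(ℝ, E) 𝓘(ℝ, E) (extChartAt 𝓘(ℝ, E) p₀).symm z) r v)

lemma chartMetric_parallelogram (z v w : E) :
    chartMetric D q p₀ z ((1 / 2 : ℝ) • (v - w)) + chartMetric D q p₀ z ((1 / 2 : ℝ) • (v + w)) =
      (chartMetric D q p₀ z v + chartMetric D q p₀ z w) / 2 := by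
  set A := mfderiv 𝓘(ℝ, E) 𝓘(ℝ, E) (extChartAt 𝓘(ℝ, E) p₀).symm z
  have h1 := penalisedMetric_parallelogram D q _ (A v) (A w)
  have h2 : chartMetric D q p₀ z (v + w) = penalisedMetric D q _ (A v + A w) (A v + A w) :=
    congrArg (fun u => penalisedMetric D q ((extChartAt 𝓘(ℝ, E) p₀).symm z) u u) (map_add A v w)
  have h3 : chartMetric D q p₀ z (v - w) = penalisedMetric D q _ (A v - A w) (A v - A w) :=
    congrArg (fun u => penalisedMetric D q ((extChartAt 𝓘(ℝ, E) p₀).symm z) u u) (map_sub A v w)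
  rw [← h2, ← h3] at h1
  change _ = 2 * (chartMetric D q p₀ z v + chartMetric D q p₀ z w) at h1
  rw [chartMetric_smul, chartMetric_smul]
  linarith

variable [IsManifold 𝓘(ℝ, E) ∞ M]

lemma chartMetric_extChartAt {p : M} (hp : p ∈ (extChartAt 𝓘(ℝ, E) p₀).source)
    (v : TangentSpace 𝓘(ℝ, E) p) :
    chartMetric D q p₀ (extChartAt 𝓘(ℝ, E) p₀ p)
      (mfderiv 𝓘(ℝ, E) 𝓘(ℝ, E) (extChartAt 𝓘(ℝ, E) p₀) p v) = penalisedMetric D q p v v := by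
  refine penalisedMetric_congr D q ((extChartAt 𝓘(ℝ, E) p₀).left_inv hp) ?_
  have h := mfderivWithin_extChartAt_symm_comp_mfderiv_extChartAt' (I := 𝓘(ℝ, E)) hp
  rw [ModelWithCorners.range_eq_univ, mfderivWithin_univ] at h
  exact congrArg (fun A : E →L[ℝ] E => A v) h

lemma continuousOn_chartMetric
    [IsContinuousRiemannianBundle E (fun p : M => TangentSpace 𝓘(ℝ, E) p)]
    (hD : IsSmoothSubbundle D) :
    ContinuousOn (fun x : E × E => chartMetric D q p₀ x.1 x.2)
      ((extChartAt 𝓘(ℝ, E) p₀).target ×ˢ univ) := by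
  have hU : IsOpen (extChartAt 𝓘(ℝ, E) p₀).target := isOpen_extChartAt_target p₀
  have h1 : ContinuousOn (tangentMapWithin 𝓘(ℝ, E) 𝓘(ℝ, E) (extChartAt 𝓘(ℝ, E) p₀).symm
      (extChartAt 𝓘(ℝ, E) p₀).target) (Bundle.TotalSpace.proj ⁻¹' (extChartAt 𝓘(ℝ, E) p₀).target) :=
    (contMDiffOn_extChartAt_symm (n := (⊤ : ℕ∞)) p₀).continuousOn_tangentMapWithin
      (by exact_mod_cast le_top) hU.uniqueMDiffOn
  have h2 : Continuous fun x : E × E => (⟨x.1, x.2⟩ : TangentBundle 𝓘(ℝ, E) E) :=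
    (tangentBundleModelSpaceHomeomorph 𝓘(ℝ, E)).symm.continuous
  refine ((continuous_penalisedMetric hD q).comp_continuousOn
    (h1.comp h2.continuousOn fun x hx => hx.1)).congr fun x hx => ?_
  simp only [chartMetric, Function.comp, tangentMapWithin]
  rw [mfderivWithin_of_isOpen hU hx.1]

/-- On compact sets, the metrics `g_q` are bounded below by a multiple of the Euclidean norm, which
does not depend on `q`. -/
lemma exists_mul_norm_sq_le_chartMetric
    [IsContinuousRiemannianBundle E (fun p : M => TangentSpace 𝓘(ℝ, E) p)]
    (hD : IsSmoothSubbundle D) {K : Set E} (hK : IsCompact K)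
    (hKt : K ⊆ (extChartAt 𝓘(ℝ, E) p₀).target) :
    ∃ m : ℝ, 0 < m ∧ ∀ q : ℕ+, ∀ z ∈ K, ∀ v, m * ‖v‖ ^ 2 ≤ chartMetric D q p₀ z v := by
  have hpos : ∀ x ∈ K ×ˢ Metric.sphere (0 : E) 1, 0 < chartMetric D 1 p₀ x.1 x.2 := by
    rintro ⟨z, v⟩ ⟨hz, hv⟩
    have h1 : mfderiv 𝓘(ℝ, E) 𝓘(ℝ, E) (extChartAt 𝓘(ℝ, E) p₀).symm z v ≠ 0 := by
      intro h0
      have := (isInvertible_mfderiv_chart_symm (hKt hz)).bijective.injective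
        (h0.trans (map_zero (mfderiv 𝓘(ℝ, E) 𝓘(ℝ, E) (extChartAt 𝓘(ℝ, E) p₀).symm z)).symm)
      rw [mem_sphere_zero_iff_norm] at hv
      rw [show v = 0 from this, norm_zero] at hv
      exact zero_ne_one hv
    exact (by positivity :
      0 < ‖mfderiv 𝓘(ℝ, E) 𝓘(ℝ, E) (extChartAt 𝓘(ℝ, E) p₀).symm z v‖ ^ 2).trans_le
        (norm_sq_le_penalisedMetric D 1 _ _)
  obtain ⟨m, hm, hmK⟩ := (hK.prod (isCompact_sphere (0 : E) 1)).exists_forall_le'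
    ((continuousOn_chartMetric D 1 p₀ hD).mono (prod_mono hKt (subset_univ _))) hpos
  refine ⟨m, hm, fun q z hz v => ?_⟩
  refine le_trans ?_ (penalisedMetric_mono D one_le _ _ :
    chartMetric D 1 p₀ z v ≤ chartMetric D q p₀ z v)
  rcases eq_or_ne v 0 with rfl | hv
  · rw [norm_zero, zero_pow two_ne_zero, mul_zero]
    exact penalisedMetric_self_nonneg _ _ _ _
  · have h1 := hmK (z, ‖v‖⁻¹ • v) ⟨hz, by
      rw [mem_sphere_zero_iff_norm, norm_smul, norm_inv, norm_norm, inv_mul_cancel₀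
        (norm_ne_zero_iff.2 hv)]⟩
    rw [chartMetric_smul] at h1
    have h2 : 0 < ‖v‖ := norm_pos_iff.2 hv
    rw [inv_pow, inv_mul_eq_div, le_div_iff₀ (by positivity)] at h1
    exact h1

/-- A curve in the chart bounds the distance of its endpoints. -/
lemma penalisedEDist_chart_le
    [IsContinuousRiemannianBundle E (fun p : M => TangentSpace 𝓘(ℝ, E) p)]
    (hD : IsSmoothSubbundle D) {w : ℝ → E} {a b : ℝ} (hab : a < b)
    (hw : ContDiffOn ℝ 1 w (Icc a b)) (hwt : MapsTo w (Icc a b) (extChartAt 𝓘(ℝ, E) p₀).target) :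
    penalisedEDist D q ((extChartAt 𝓘(ℝ, E) p₀).symm (w a)) ((extChartAt 𝓘(ℝ, E) p₀).symm (w b)) ≤
      ENNReal.ofReal (∫ t in a..b,
        Real.sqrt (chartMetric D q p₀ (w t) (derivWithin w (Icc a b) t))) := by
  have hw' : ContMDiffOn 𝓘(ℝ, ℝ) 𝓘(ℝ, E) 1 w (Icc a b) := hw.contMDiffOn
  have hcurve : ContMDiffOn 𝓘(ℝ, ℝ) 𝓘(ℝ, E) 1 ((extChartAt 𝓘(ℝ, E) p₀).symm ∘ w) (Icc a b) :=
    ((contMDiffOn_extChartAt_symm (n := (⊤ : ℕ∞)) p₀).of_le (by exact_mod_cast le_top)).comp hw' hwt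
  have hint : ContinuousOn (fun t => Real.sqrt (chartMetric D q p₀ (w t)
      (derivWithin w (Icc a b) t))) (Icc a b) :=
    ((continuousOn_chartMetric D q p₀ hD).comp (hw.continuousOn.prodMk
      (hw.continuousOn_derivWithin (uniqueDiffOn_Icc hab) le_rfl))
        fun t ht => ⟨hwt ht, mem_univ _⟩).sqrt
  refine (penalisedEDist_le_penalisedPathLength hcurve hab.le).trans ?_
  rw [penalisedPathLength_eq_lintegral, intervalIntegral.integral_of_le hab.le,
    ← integral_Icc_eq_integral_Ioc, ofReal_integral_eq_lintegral_ofReal hint.integrableOn_Icc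
      (.of_forall fun t => Real.sqrt_nonneg _)]
  refine setLIntegral_mono' measurableSet_Icc fun t ht => le_of_eq ?_
  have h1 : mfderivWithin 𝓘(ℝ, ℝ) 𝓘(ℝ, E) ((extChartAt 𝓘(ℝ, E) p₀).symm ∘ w) (Icc a b) t (1 : ℝ) =
      mfderiv 𝓘(ℝ, E) 𝓘(ℝ, E) (extChartAt 𝓘(ℝ, E) p₀).symm (w t) (derivWithin w (Icc a b) t) := by
    rw [mfderiv_comp_mfderivWithin t (mdifferentiableAt_chart_symm (hwt ht))
      ((hw' t ht).mdifferentiableWithinAt one_ne_zero)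
      ((uniqueDiffOn_Icc hab).uniqueMDiffOn t ht), mfderivWithin_eq_fderivWithin]
    rfl
  exact congrArg (fun v => ENNReal.ofReal (Real.sqrt (penalisedMetric D q
    ((extChartAt 𝓘(ℝ, E) p₀).symm (w t)) v v))) h1

end ChartMetric

section ChartMetricCurve

variable {E : Type*} [NormedAddCommGroup E] [NormedSpace ℝ E] [FiniteDimensional ℝ E]
  {M : Type*} [EMetricSpace M] [ChartedSpace E M] [IsManifold 𝓘(ℝ, E) ∞ M]
  [RiemannianBundle (fun p : M => TangentSpace 𝓘(ℝ, E) p)]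
  (D : ∀ p : M, Submodule ℝ (TangentSpace 𝓘(ℝ, E) p)) (q : ℕ+) (p₀ : M)

variable {c : ℝ → M} {a b : ℝ}

omit [FiniteDimensional ℝ E] [RiemannianBundle (fun p : M => TangentSpace 𝓘(ℝ, E) p)] in
lemma contDiffOn_chart_comp (hc : ContMDiffOn 𝓘(ℝ, ℝ) 𝓘(ℝ, E) 1 c (Icc 0 1))
    (h : Icc a b ⊆ Icc 0 1) (hs : MapsTo c (Icc a b) (extChartAt 𝓘(ℝ, E) p₀).source) :
    ContDiffOn ℝ 1 (extChartAt 𝓘(ℝ, E) p₀ ∘ c) (Icc a b) := by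
  have h1 : ContMDiffOn 𝓘(ℝ, E) 𝓘(ℝ, E) 1 (extChartAt 𝓘(ℝ, E) p₀)
      (extChartAt 𝓘(ℝ, E) p₀).source := by
    rw [extChartAt_source]
    exact (contMDiffOn_extChartAt (n := (⊤ : ℕ∞))).of_le (by exact_mod_cast le_top)
  exact (h1.comp (hc.mono h) hs).contDiffOn

lemma chartMetric_derivWithin (hc : ContMDiffOn 𝓘(ℝ, ℝ) 𝓘(ℝ, E) 1 c (Icc 0 1)) (hab : a < b)
    (h : Icc a b ⊆ Icc 0 1) (hs : MapsTo c (Icc a b) (extChartAt 𝓘(ℝ, E) p₀).source)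
    {t : ℝ} (ht : t ∈ Icc a b) :
    chartMetric D q p₀ (extChartAt 𝓘(ℝ, E) p₀ (c t))
      (derivWithin (extChartAt 𝓘(ℝ, E) p₀ ∘ c) (Icc a b) t) = speedSq D q c t := by
  have h1 : MDifferentiableAt 𝓘(ℝ, E) 𝓘(ℝ, E) (extChartAt 𝓘(ℝ, E) p₀) (c t) :=
    mdifferentiableAt_extChartAt (extChartAt_source 𝓘(ℝ, E) p₀ ▸ hs ht)
  have h2 : MDifferentiableWithinAt 𝓘(ℝ, ℝ) 𝓘(ℝ, E) c (Icc a b) t :=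
    ((hc.mono h) t ht).mdifferentiableWithinAt one_ne_zero
  have h3 : derivWithin (extChartAt 𝓘(ℝ, E) p₀ ∘ c) (Icc a b) t =
      mfderiv 𝓘(ℝ, E) 𝓘(ℝ, E) (extChartAt 𝓘(ℝ, E) p₀) (c t)
        (mfderivWithin 𝓘(ℝ, ℝ) 𝓘(ℝ, E) c (Icc a b) t 1) := by
    have h4 := mfderiv_comp_mfderivWithin t h1 h2 ((uniqueDiffOn_Icc hab).uniqueMDiffOn t ht)
    rw [mfderivWithin_eq_fderivWithin] at h4
    exact congrArg (fun A : ℝ →L[ℝ] E => A 1) h4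
  rw [h3, ← speedSq_eq_of_subset hc hab h ht]
  exact chartMetric_extChartAt D q p₀ (hs ht) _

end ChartMetricCurve

/-! ### Convergence of the velocities -/

section LocalConvergence

variable {E : Type*} [NormedAddCommGroup E] [NormedSpace ℝ E] [FiniteDimensional ℝ E]
  {M : Type*} [EMetricSpace M]

lemma tendsto_zero_of_forall_le {ι : Type*} {l : Filter ι} {f : ι → ℝ} {A : ℝ} (hf : ∀ x, 0 ≤ f x)
    (h : ∀ ε : ℝ, 0 < ε → ∀ᶠ x in l, f x ≤ A * ε) : Tendsto f l (𝓝 0) := by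
  rw [Metric.tendsto_nhds]
  intro δ hδ
  filter_upwards [h (δ / (|A| + 1)) (by positivity)] with x hx
  rw [Real.dist_eq, sub_zero, abs_of_nonneg (hf x)]
  refine hx.trans_lt ?_
  rw [mul_div_assoc', div_lt_iff₀ (by positivity)]
  nlinarith [le_abs_self A]

/-- Composition with a function which is continuous at the points of the (compact) image of the
limit preserves uniform convergence. -/
lemma tendstoUniformlyOn_comp_of_continuousAt {X α Z : Type*} [UniformSpace X] [UniformSpace Z]
    {c : ℕ → α → X} {γ : α → X} {s : Set α} (h : TendstoUniformlyOn c γ atTop s)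
    (hs : IsCompact (γ '' s)) {g : X → Z} (hg : ∀ t ∈ s, ContinuousAt g (γ t)) :
    TendstoUniformlyOn (fun j => g ∘ c j) (g ∘ γ) atTop s := by
  intro r hr
  have h1 := hs.uniformContinuousAt_of_continuousAt g
    (fun x hx => by obtain ⟨t, ht, rfl⟩ := hx; exact hg t ht) hr
  filter_upwards [h _ h1] with j hj t ht
  exact hj t ht ⟨t, ht, rfl⟩

/-- Uniform convergence on a compact set brings the image into any open set that contains the image
of the limit. -/
lemma eventually_mapsTo_of_tendstoUniformlyOn {α : Type*} {c : ℕ → α → M} {γ : α → M} {s : Set α}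
    (h : TendstoUniformlyOn c γ atTop s) (hs : IsCompact (γ '' s)) {U : Set M} (hU : IsOpen U)
    (hγU : MapsTo γ s U) : ∀ᶠ j in atTop, MapsTo (c j) s U := by
  obtain ⟨δ, hδ, hδU⟩ := hs.exists_thickening_subset_open hU hγU.image_subset
  filter_upwards [EMetric.tendstoUniformlyOn_iff.1 h (ENNReal.ofReal δ) (ENNReal.ofReal_pos.2 hδ)]
    with j hj t ht
  refine hδU (mem_of_mem_of_subset ?_ subset_rfl)
  rw [Metric.thickening, mem_ofPred_eq]
  refine (Metric.infEDist_le_edist_of_mem (mem_image_of_mem γ ht)).trans_lt ?_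
  rw [edist_comm]
  exact hj t ht

variable [ChartedSpace E M] [IsManifold 𝓘(ℝ, E) ∞ M]
  [RiemannianBundle (fun p : M => TangentSpace 𝓘(ℝ, E) p)]
  [IsContinuousRiemannianBundle E (fun p : M => TangentSpace 𝓘(ℝ, E) p)]
  {D : ∀ p : M, Submodule ℝ (TangentSpace 𝓘(ℝ, E) p)}
  {q : ℕ → ℕ+} {L : ℕ → ℝ} {Λ : ℝ} {c : ℕ → ℝ → M} {γ : ℝ → M}

/-- The midpoint estimate for two curves in the chart which are so close to each other that the
change of the metric between them and their mean only raises the energies by `η`. -/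
lemma chart_integral_norm_sub_sq_le (hD : IsSmoothSubbundle D) {q : ℕ+} {p₀ : M} {a b m Λ η ℓ ρ : ℝ}
    (hab : a < b) (hΛ : 0 ≤ Λ) (hm0 : 0 ≤ m) {K : Set E} (hKc : Convex ℝ K)
    (hKt : K ⊆ (extChartAt 𝓘(ℝ, E) p₀).target)
    (hm : ∀ z ∈ K, ∀ v, m * ‖v‖ ^ 2 ≤ chartMetric D q p₀ z v) {u₁ u₂ : ℝ → E}
    (hu₁ : ContDiffOn ℝ 1 u₁ (Icc a b)) (hu₂ : ContDiffOn ℝ 1 u₂ (Icc a b))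
    (hK₁ : MapsTo u₁ (Icc a b) K) (hK₂ : MapsTo u₂ (Icc a b) K)
    (hclose : ∀ t ∈ Icc a b, ‖u₁ t - u₂ t‖ < ρ)
    (h₁ : ∀ t ∈ Icc a b, ∀ z ∈ K, dist z (u₁ t) < ρ →
      chartMetric D q p₀ z (derivWithin u₁ (Icc a b) t) ≤ Λ ^ 2 + η)
    (h₂ : ∀ t ∈ Icc a b, ∀ z ∈ K, dist z (u₂ t) < ρ →
      chartMetric D q p₀ z (derivWithin u₂ (Icc a b) t) ≤ Λ ^ 2 + η)
    (hdist : ENNReal.ofReal ℓ ≤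
      penalisedEDist D q ((extChartAt 𝓘(ℝ, E) p₀).symm ((1 / 2 : ℝ) • (u₁ a + u₂ a)))
        ((extChartAt 𝓘(ℝ, E) p₀).symm ((1 / 2 : ℝ) • (u₁ b + u₂ b)))) :
    m / 4 * ∫ t in a..b, ‖derivWithin u₁ (Icc a b) t - derivWithin u₂ (Icc a b) t‖ ^ 2 ≤
      (2 * Λ ^ 2 + η) * (b - a) - 2 * Λ * ℓ := by
  set w : ℝ → E := fun t => (1 / 2 : ℝ) • (u₁ t + u₂ t) with hw
  have hwC : ContDiffOn ℝ 1 w (Icc a b) := (hu₁.add hu₂).const_smul (1 / 2 : ℝ)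
  have hwK : MapsTo w (Icc a b) K := fun t ht => by
    have := hKc (hK₁ ht) (hK₂ ht) (a := 1 / 2) (b := 1 / 2) (by norm_num) (by norm_num)
      (by norm_num)
    rwa [← smul_add] at this
  have hwd : ∀ t ∈ Icc a b, derivWithin w (Icc a b) t =
      (1 / 2 : ℝ) • (derivWithin u₁ (Icc a b) t + derivWithin u₂ (Icc a b) t) := by
    intro t ht
    have d1 := ((hu₁.differentiableOn one_ne_zero) t ht).hasDerivWithinAt
    have d2 := ((hu₂.differentiableOn one_ne_zero) t ht).hasDerivWithinAt
    exact ((d1.add d2).const_smul (1 / 2 : ℝ)).derivWithin (uniqueDiffOn_Icc hab t ht)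
  have hv₁ := hu₁.continuousOn_derivWithin (uniqueDiffOn_Icc hab) le_rfl
  have hv₂ := hu₂.continuousOn_derivWithin (uniqueDiffOn_Icc hab) le_rfl
  have hw1 : ∀ t ∈ Icc a b, dist (w t) (u₁ t) < ρ := fun t ht => by
    have e : w t - u₁ t = (-(1 / 2) : ℝ) • (u₁ t - u₂ t) := by
      simp only [hw]; module
    rw [dist_eq_norm, e, norm_smul]
    norm_num
    linarith [hclose t ht, norm_nonneg (u₁ t - u₂ t)]
  have hw2 : ∀ t ∈ Icc a b, dist (w t) (u₂ t) < ρ := fun t ht => by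
    have e : w t - u₂ t = (1 / 2 : ℝ) • (u₁ t - u₂ t) := by
      simp only [hw]; module
    rw [dist_eq_norm, e, norm_smul]
    norm_num
    linarith [hclose t ht, norm_nonneg (u₁ t - u₂ t)]
  have hpair : ContinuousOn (fun t => (w t,
      (1 / 2 : ℝ) • (derivWithin u₁ (Icc a b) t + derivWithin u₂ (Icc a b) t))) (Icc a b) :=
    hwC.continuousOn.prodMk ((hv₁.add hv₂).const_smul (1 / 2 : ℝ))
  have hGc := (continuousOn_chartMetric D q p₀ hD).comp hpair
    fun t ht => ⟨hKt (hwK ht), mem_univ _⟩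
  have hlen := hdist.trans (penalisedEDist_chart_le D q p₀ hD hab hwC fun t ht => hKt (hwK ht))
  rw [ENNReal.ofReal_le_ofReal_iff (intervalIntegral.integral_nonneg hab.le fun t _ =>
    Real.sqrt_nonneg _)] at hlen
  refine integral_norm_sub_sq_le (G := chartMetric D q p₀) (w := w) hab.le hΛ hm0
    (fun t _ => chartMetric_parallelogram D q p₀ _ _ _) (fun t ht => hm _ (hwK ht))
    (fun t ht => h₁ t ht _ (hwK ht) (hw1 t ht)) (fun t ht => h₂ t ht _ (hwK ht) (hw2 t ht))
    hv₁ hv₂ hGc (hlen.trans_eq ?_)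
  refine intervalIntegral.integral_congr fun t ht => ?_
  rw [uIcc_of_le hab.le] at ht
  simp only [hwd t ht]

variable [IsRiemannianManifold 𝓘(ℝ, E) M]

namespace IsMinimisingSequence

/-- The velocities, read in a chart, form a Cauchy sequence in `L²` and are uniformly bounded. -/
lemma chart_velocity (h : IsMinimisingSequence D q L Λ c γ) (hD : IsSmoothSubbundle D) {p₀ : M}
    {a b : ℝ} (hab : a < b) (hsub : Icc a b ⊆ Icc 0 1) {K : Set E} (hK : IsCompact K)
    (hKc : Convex ℝ K) (hKt : K ⊆ (extChartAt 𝓘(ℝ, E) p₀).target)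
    (hγ : MapsTo γ (Icc a b) (extChartAt 𝓘(ℝ, E) p₀).source)
    (hcs : ∀ᶠ j in atTop, MapsTo (c j) (Icc a b) (extChartAt 𝓘(ℝ, E) p₀).source)
    (hcK : ∀ᶠ j in atTop, MapsTo (extChartAt 𝓘(ℝ, E) p₀ ∘ c j) (Icc a b) K) :
    (∃ B : ℝ, ∀ᶠ j in atTop, ∀ t ∈ Icc a b,
      ‖derivWithin (extChartAt 𝓘(ℝ, E) p₀ ∘ c j) (Icc a b) t‖ ≤ B) ∧
    Tendsto (fun x : ℕ × ℕ => ∫ t in a..b,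
      ‖derivWithin (extChartAt 𝓘(ℝ, E) p₀ ∘ c x.1) (Icc a b) t -
        derivWithin (extChartAt 𝓘(ℝ, E) p₀ ∘ c x.2) (Icc a b) t‖ ^ 2) (atTop ×ˢ atTop) (𝓝 0) := by
  obtain ⟨m, hm, hmK⟩ := exists_mul_norm_sq_le_chartMetric D p₀ hD hK hKt
  set φ := extChartAt 𝓘(ℝ, E) p₀ with hφ
  set u : ℕ → ℝ → E := fun j => φ ∘ c j with hu
  set v : ℕ → ℝ → E := fun j => derivWithin (u j) (Icc a b) with hv
  have hΛ := h.nonneg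
  have hΓ : IsCompact (γ '' Icc a b) :=
    isCompact_Icc.image_of_continuousOn (h.continuousOn.mono hsub)
  have hunif : TendstoUniformlyOn u (φ ∘ γ) atTop (Icc a b) :=
    tendstoUniformlyOn_comp_of_continuousAt (h.tendstoUniformlyOn.mono hsub) hΓ fun t ht =>
      continuousAt_extChartAt' (hγ ht)
  set B := Real.sqrt (Λ ^ 2 / m) with hB
  have hspeed : ∀ i, ∀ᶠ j in atTop, ∀ t ∈ Icc a b,
      chartMetric D (q i) p₀ (u j t) (v j t) ≤ Λ ^ 2 := by
    intro i
    filter_upwards [eventually_ge_atTop i, hcs] with j hj hjs t ht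
    have := chartMetric_derivWithin D (q i) p₀ (h.contMDiffOn j) hab hsub hjs ht
    exact this.le.trans (h.speedSq_le hj (hsub ht))
  have hbound : ∀ᶠ j in atTop, ∀ t ∈ Icc a b, ‖v j t‖ ≤ B := by
    filter_upwards [hspeed 0, hcK] with j hj hjK t ht
    refine Real.le_sqrt_of_sq_le ?_
    rw [le_div_iff₀ hm, mul_comm]
    exact (hmK (q 0) _ (hjK ht) _).trans (hj t ht)
  refine ⟨⟨B, hbound⟩, ?_⟩
  have hnonneg : ∀ x : ℕ × ℕ, 0 ≤ ∫ t in a..b, ‖v x.1 t - v x.2 t‖ ^ 2 := fun x =>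
    intervalIntegral.integral_nonneg hab.le fun t _ => by positivity
  -- it suffices to bound the integral by a multiple of every `ε`
  have key : ∀ ε : ℝ, 0 < ε → ∀ᶠ x : ℕ × ℕ in atTop ×ˢ atTop,
      ∫ t in a..b, ‖v x.1 t - v x.2 t‖ ^ 2 ≤ (4 / m * (b - a + 4 * Λ)) * ε := by
    intro ε hε
    -- fix the metric of a parameter `q i` for which the speed is already close to its limit
    obtain ⟨i, hi⟩ := (h.tendsto_speed.eventually_const_lt (sub_lt_self Λ hε)).exists
    have hcont := continuousOn_chartMetric D (q i) p₀ hD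
    have huc := (hK.prod (isCompact_closedBall (0 : E) B)).uniformContinuousOn_of_continuous
      (hcont.mono (prod_mono hKt (subset_univ _)))
    obtain ⟨ρ, hρ, hρG⟩ := Metric.uniformContinuousOn_iff.1 huc ε hε
    set w : ℕ × ℕ → ℝ → E := fun x t => (1 / 2 : ℝ) • (u x.1 t + u x.2 t) with hw
    have hwlim : ∀ t ∈ Icc a b, Tendsto (fun x : ℕ × ℕ => φ.symm (w x t)) (atTop ×ˢ atTop)
        (𝓝 (γ t)) := by
      intro t ht
      have h1 := hunif.tendsto_at ht
      have h2 : Tendsto (fun x : ℕ × ℕ => w x t) (atTop ×ˢ atTop)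
          (𝓝 ((1 / 2 : ℝ) • ((φ ∘ γ) t + (φ ∘ γ) t))) :=
        ((h1.comp tendsto_fst).add (h1.comp tendsto_snd)).const_smul _
      rw [← two_smul ℝ, smul_smul, one_div_mul_cancel two_ne_zero, one_smul] at h2
      have h3 := (continuousAt_extChartAt_symm' (hγ ht)).tendsto.comp h2
      rwa [φ.left_inv (hγ ht)] at h3
    have hdist := h.eventually_le_penalisedEDist i (hsub (left_mem_Icc.2 hab.le)).1 hab.le
      (hsub (right_mem_Icc.2 hab.le)).2 (hwlim a (left_mem_Icc.2 hab.le))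
      (hwlim b (right_mem_Icc.2 hab.le)) hε
    have hclose : ∀ᶠ x : ℕ × ℕ in atTop ×ˢ atTop, ∀ t ∈ Icc a b, ‖u x.1 t - u x.2 t‖ < ρ := by
      have h1 := Metric.tendstoUniformlyOn_iff.1 hunif (ρ / 2) (half_pos hρ)
      filter_upwards [h1.prod_mk h1] with x hx t ht
      rw [← dist_eq_norm]
      linarith [dist_triangle_left (u x.1 t) (u x.2 t) ((φ ∘ γ) t), hx.1 t ht, hx.2 t ht]
    have hall := (hspeed i).and (hbound.and (hcs.and hcK))
    filter_upwards [hdist, hclose, hall.prod_mk hall] with x hx1 hx2 hx3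
    obtain ⟨⟨hs1, hb1, hcs1, hK1⟩, ⟨hs2, hb2, hcs2, hK2⟩⟩ := hx3
    have hu1 := contDiffOn_chart_comp p₀ (h.contMDiffOn x.1) hsub hcs1
    have hu2 := contDiffOn_chart_comp p₀ (h.contMDiffOn x.2) hsub hcs2
    have henergy : ∀ j, (∀ t ∈ Icc a b, chartMetric D (q i) p₀ (u j t) (v j t) ≤ Λ ^ 2) →
        (∀ t ∈ Icc a b, ‖v j t‖ ≤ B) → MapsTo (u j) (Icc a b) K →
        ∀ t ∈ Icc a b, ∀ z ∈ K, dist z (u j t) < ρ →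
          chartMetric D (q i) p₀ z (v j t) ≤ Λ ^ 2 + ε := by
      intro j hs hb hjK t ht z hz hj
      have hball : v j t ∈ Metric.closedBall (0 : E) B := mem_closedBall_zero_iff.2 (hb t ht)
      have := hρG (z, v j t) ⟨hz, hball⟩ (u j t, v j t) ⟨hjK ht, hball⟩ (by
        rw [Prod.dist_eq, dist_self, max_eq_left dist_nonneg]; exact hj)
      rw [Real.dist_eq] at this
      have h2 := (abs_lt.1 this).2
      simp only at h2
      linarith [hs t ht]
    have := chart_integral_norm_sub_sq_le hD hab hΛ hm.le hKc hKt (hmK (q i)) hu1 hu2 hK1 hK2 hx2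
      (henergy x.1 hs1 hb1 hK1) (henergy x.2 hs2 hb2 hK2) hx1
    have h6 : m / 4 * ∫ t in a..b, ‖v x.1 t - v x.2 t‖ ^ 2 ≤ (b - a + 4 * Λ) * ε := by
      nlinarith
    have h7 := mul_le_mul_of_nonneg_left h6 (by positivity : 0 ≤ 4 / m)
    rwa [← mul_assoc, ← mul_assoc, show 4 / m * (m / 4) = 1 by field_simp, one_mul] at h7
  exact tendsto_zero_of_forall_le hnonneg key

omit [IsContinuousRiemannianBundle E (fun p : M => TangentSpace 𝓘(ℝ, E) p)]
  [IsManifold 𝓘(ℝ, E) ∞ M] [IsRiemannianManifold 𝓘(ℝ, E) M] in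
lemma contDiffOn_comp (h : IsMinimisingSequence D q L Λ c γ) (f : C^∞⟮𝓘(ℝ, E), M; ℝ⟯) (j : ℕ) :
    ContDiffOn ℝ 1 (f ∘ c j) (Icc 0 1) :=
  ((f.contMDiff.of_le (by exact_mod_cast le_top)).comp_contMDiffOn (h.contMDiffOn j)).contDiffOn

omit [IsContinuousRiemannianBundle E (fun p : M => TangentSpace 𝓘(ℝ, E) p)]
  [IsManifold 𝓘(ℝ, E) ∞ M] [IsRiemannianManifold 𝓘(ℝ, E) M] in
lemma continuousOn_derivWithin_comp (h : IsMinimisingSequence D q L Λ c γ)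
    (f : C^∞⟮𝓘(ℝ, E), M; ℝ⟯) (j : ℕ) : ContinuousOn (derivWithin (f ∘ c j) (Icc 0 1)) (Icc 0 1) :=
  (h.contDiffOn_comp f j).continuousOn_derivWithin uniqueDiffOn_Icc_zero_one le_rfl

/-- Near every time, the derivatives along the curves of a smooth function form a Cauchy sequence
in `L²`. -/
lemma exists_isOpen_tendsto_integral (h : IsMinimisingSequence D q L Λ c γ)
    (hD : IsSmoothSubbundle D) {t₀ : ℝ} (ht₀ : t₀ ∈ Icc (0 : ℝ) 1) :
    ∃ V : Set ℝ, IsOpen V ∧ t₀ ∈ V ∧ ∀ a b, a < b → Icc a b ⊆ Icc 0 1 → Icc a b ⊆ V →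
      ∀ f : C^∞⟮𝓘(ℝ, E), M; ℝ⟯, Tendsto (fun x : ℕ × ℕ => ∫ t in a..b,
        (derivWithin (f ∘ c x.1) (Icc 0 1) t - derivWithin (f ∘ c x.2) (Icc 0 1) t) ^ 2)
        (atTop ×ˢ atTop) (𝓝 0) := by
  set p₀ := γ t₀ with hp₀
  set φ := extChartAt 𝓘(ℝ, E) p₀ with hφ
  have hopen : IsOpen φ.target := isOpen_extChartAt_target p₀
  obtain ⟨r, hr, hrt⟩ := Metric.nhds_basis_closedBall.mem_iff.1
    (hopen.mem_nhds (mem_extChartAt_target p₀))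
  set K := Metric.closedBall (φ p₀) r
  set U : Set M := φ.source ∩ φ ⁻¹' Metric.ball (φ p₀) r with hUdef
  have hU : IsOpen U := isOpen_extChartAt_preimage' p₀ Metric.isOpen_ball
  have hpU : γ t₀ ∈ U := ⟨mem_extChartAt_source p₀, Metric.mem_ball_self hr⟩
  obtain ⟨V, hV, htV, hVU⟩ := mem_nhdsWithin.1
    ((h.continuousOn t₀ ht₀).preimage_mem_nhdsWithin (hU.mem_nhds hpU))
  refine ⟨V, hV, htV, fun a b hab hsub habV f => ?_⟩
  have hγU : MapsTo γ (Icc a b) U := fun t ht => hVU ⟨habV ht, hsub ht⟩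
  have hΓ : IsCompact (γ '' Icc a b) :=
    isCompact_Icc.image_of_continuousOn (h.continuousOn.mono hsub)
  have hun := h.tendstoUniformlyOn.mono hsub
  have hcU := eventually_mapsTo_of_tendstoUniformlyOn hun hΓ hU hγU
  have hcs : ∀ᶠ j in atTop, MapsTo (c j) (Icc a b) φ.source := by
    filter_upwards [hcU] with j hj t ht using (hj ht).1
  obtain ⟨⟨B, hB⟩, hlim⟩ := h.chart_velocity hD hab hsub (isCompact_closedBall _ _)
    (convex_closedBall _ _) hrt (fun t ht => (hγU ht).1) hcs (by
      filter_upwards [hcU] with j hj t ht using Metric.ball_subset_closedBall (hj ht).2)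
  set F : E → ℝ := f ∘ φ.symm with hF
  have hFC : ContDiffOn ℝ 1 F φ.target :=
    ((f.contMDiff.of_le (by exact_mod_cast le_top)).comp_contMDiffOn
      ((contMDiffOn_extChartAt_symm (n := (⊤ : ℕ∞)) p₀).of_le
        (by exact_mod_cast le_top))).contDiffOn
  have hF' : ContinuousOn (fderiv ℝ F) φ.target := hFC.continuousOn_fderiv_of_isOpen hopen le_rfl
  set g : M → E →L[ℝ] ℝ := fun p => fderiv ℝ F (φ p) with hg
  have hgc : ∀ p ∈ φ.source, ContinuousAt g p := fun p hp =>
    ContinuousAt.comp (f := φ) (hF'.continuousAt (hopen.mem_nhds (φ.map_source hp)))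
      (continuousAt_extChartAt' hp)
  have hgun := tendstoUniformlyOn_comp_of_continuousAt hun hΓ (g := g)
    fun t ht => hgc _ (hγU ht).1
  obtain ⟨C, hC⟩ := isCompact_Icc.exists_bound_of_continuousOn (f := g ∘ γ) (s := Icc a b)
    fun t ht => (hgc _ (hγU ht).1).comp_continuousWithinAt (h.continuousOn.mono hsub t ht)
  -- the chain rule, in the chart
  have hder : ∀ᶠ j in atTop, ∀ t ∈ Icc a b, derivWithin (f ∘ c j) (Icc 0 1) t =
      g (c j t) (derivWithin (φ ∘ c j) (Icc a b) t) := by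
    filter_upwards [hcs] with j hj t ht
    have hu := contDiffOn_chart_comp p₀ (h.contMDiffOn j) hsub hj
    have d1 := ((hu.differentiableOn one_ne_zero) t ht).hasDerivWithinAt
    have d2 : HasFDerivAt F (fderiv ℝ F (φ (c j t))) ((φ ∘ c j) t) :=
      ((hFC.differentiableOn one_ne_zero).differentiableAt
        (hopen.mem_nhds (φ.map_source (hj ht)))).hasFDerivAt
    have d3 := d2.comp_hasDerivWithinAt t d1
    have d4 : HasDerivWithinAt (f ∘ c j) (fderiv ℝ F (φ (c j t))
        (derivWithin (φ ∘ c j) (Icc a b) t)) (Icc a b) t :=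
      d3.congr_of_mem (fun s hs => by simp [hF, φ.left_inv (hj hs)]) ht
    have d5 := (((h.contDiffOn_comp f j).differentiableOn one_ne_zero) t
      (hsub ht)).hasDerivWithinAt.mono hsub
    exact (uniqueDiffOn_Icc hab t ht).eq_deriv _ d5 d4
  have hnonneg : ∀ x : ℕ × ℕ, 0 ≤ ∫ t in a..b, (derivWithin (f ∘ c x.1) (Icc 0 1) t -
      derivWithin (f ∘ c x.2) (Icc 0 1) t) ^ 2 := fun x =>
    intervalIntegral.integral_nonneg hab.le fun t _ => sq_nonneg _
  refine tendsto_zero_of_forall_le (A := 2 * B ^ 2 * (b - a) + 2 * (C + 1) ^ 2) hnonneg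
    fun ε hε => ?_
  have hgclose : ∀ᶠ x : ℕ × ℕ in atTop ×ˢ atTop, ∀ t ∈ Icc a b,
      ‖g (c x.1 t) - g (c x.2 t)‖ ≤ Real.sqrt ε := by
    have h1 := Metric.tendstoUniformlyOn_iff.1 hgun (Real.sqrt ε / 2) (by positivity)
    filter_upwards [h1.prod_mk h1] with x hx t ht
    have e1 := hx.1 t ht
    have e2 := hx.2 t ht
    have e3 := dist_triangle_left ((g ∘ c x.1) t) ((g ∘ c x.2) t) ((g ∘ γ) t)
    rw [← dist_eq_norm]
    simp only [Function.comp] at e1 e2 e3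
    linarith
  have hgb : ∀ᶠ j in atTop, ∀ t ∈ Icc a b, ‖g (c j t)‖ ≤ C + 1 := by
    filter_upwards [Metric.tendstoUniformlyOn_iff.1 hgun 1 one_pos] with j hj t ht
    have e1 := hj t ht
    have e2 := hC t ht
    rw [dist_eq_norm] at e1
    have e3 := norm_sub_norm_le ((g ∘ c j) t) ((g ∘ γ) t)
    rw [norm_sub_rev] at e3
    simp only [Function.comp] at e1 e2 e3
    linarith
  have hall := (hB.and hgb).and (hder.and hcs)
  filter_upwards [hgclose, hall.prod_mk hall, hlim.eventually_le_const hε] with x hx1 hx2 hx3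
  obtain ⟨⟨⟨hB1, -⟩, hd1, hs1⟩, ⟨⟨-, hg2⟩, hd2, hs2⟩⟩ := hx2
  have hv : ∀ j, MapsTo (c j) (Icc a b) φ.source →
      ContinuousOn (derivWithin (φ ∘ c j) (Icc a b)) (Icc a b) := fun j hj =>
    (contDiffOn_chart_comp p₀ (h.contMDiffOn j) hsub hj).continuousOn_derivWithin
      (uniqueDiffOn_Icc hab) le_rfl
  have hu : uIcc a b = Icc a b := uIcc_of_le hab.le
  have hI1 : ContinuousOn (fun t => (derivWithin (f ∘ c x.1) (Icc 0 1) t -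
      derivWithin (f ∘ c x.2) (Icc 0 1) t) ^ 2) (uIcc a b) :=
    hu ▸ (((h.continuousOn_derivWithin_comp f x.1).sub
      (h.continuousOn_derivWithin_comp f x.2)).pow 2).mono hsub
  have hI2 : ContinuousOn (fun t => ‖derivWithin (φ ∘ c x.1) (Icc a b) t -
      derivWithin (φ ∘ c x.2) (Icc a b) t‖ ^ 2) (uIcc a b) :=
    hu ▸ ((hv _ hs1).sub (hv _ hs2)).norm.pow 2
  calc _ ≤ ∫ t in a..b, (2 * (ε * B ^ 2) + 2 * (C + 1) ^ 2 *
        ‖derivWithin (φ ∘ c x.1) (Icc a b) t - derivWithin (φ ∘ c x.2) (Icc a b) t‖ ^ 2) := by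
        refine intervalIntegral.integral_mono_on hab.le hI1.intervalIntegrable
          (ContinuousOn.intervalIntegrable (continuousOn_const.add (continuousOn_const.mul hI2)))
          fun t ht => ?_
        rw [hd1 t ht, hd2 t ht]
        set v₁ := derivWithin (φ ∘ c x.1) (Icc a b) t
        set v₂ := derivWithin (φ ∘ c x.2) (Icc a b) t
        -- the difference of the derivatives comes from the covectors and from the velocities
        have e1 : g (c x.1 t) v₁ - g (c x.2 t) v₂ =
            (g (c x.1 t) - g (c x.2 t)) v₁ + g (c x.2 t) (v₁ - v₂) := by
          rw [map_sub, sub_apply]; ring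
        have e2 : |(g (c x.1 t) - g (c x.2 t)) v₁| ≤ Real.sqrt ε * B :=
          ((g (c x.1 t) - g (c x.2 t)).le_opNorm v₁).trans
            (mul_le_mul (hx1 t ht) (hB1 t ht) (norm_nonneg _) (Real.sqrt_nonneg _))
        have e3 : |g (c x.2 t) (v₁ - v₂)| ≤ (C + 1) * ‖v₁ - v₂‖ :=
          ((g (c x.2 t)).le_opNorm _).trans (mul_le_mul_of_nonneg_right (hg2 t ht) (norm_nonneg _))
        have e4 := pow_le_pow_left₀ (abs_nonneg _) e2 2
        have e5 := pow_le_pow_left₀ (abs_nonneg _) e3 2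
        rw [sq_abs, mul_pow, Real.sq_sqrt hε.le] at e4
        rw [sq_abs, mul_pow] at e5
        rw [e1]
        linarith [add_sq_le (a := (g (c x.1 t) - g (c x.2 t)) v₁) (b := g (c x.2 t) (v₁ - v₂))]
    _ = 2 * (ε * B ^ 2) * (b - a) + 2 * (C + 1) ^ 2 * ∫ t in a..b,
        ‖derivWithin (φ ∘ c x.1) (Icc a b) t - derivWithin (φ ∘ c x.2) (Icc a b) t‖ ^ 2 := by
        rw [intervalIntegral.integral_add (by simp) (hI2.intervalIntegrable.const_mul _),
          intervalIntegral.integral_const, intervalIntegral.integral_const_mul, smul_eq_mul]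
        ring
    _ ≤ (2 * B ^ 2 * (b - a) + 2 * (C + 1) ^ 2) * ε := by
        have := mul_le_mul_of_nonneg_left hx3 (by positivity : 0 ≤ 2 * (C + 1) ^ 2)
        linarith

/-- The derivatives along the curves of a smooth function form a Cauchy sequence in `L²`. -/
lemma tendsto_integral_derivWithin_sub_sq (h : IsMinimisingSequence D q L Λ c γ)
    (hD : IsSmoothSubbundle D) (f : C^∞⟮𝓘(ℝ, E), M; ℝ⟯) :
    Tendsto (fun x : ℕ × ℕ => ∫ t in (0 : ℝ)..1,
      (derivWithin (f ∘ c x.1) (Icc 0 1) t - derivWithin (f ∘ c x.2) (Icc 0 1) t) ^ 2)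
      (atTop ×ˢ atTop) (𝓝 0) := by
  choose! V hV hmem hVlim using fun t (ht : t ∈ Icc (0 : ℝ) 1) =>
    h.exists_isOpen_tendsto_integral hD ht
  -- cut the unit interval into pieces to which the local result applies
  obtain ⟨s, hs0, hsm, ⟨n, hn⟩, hsub⟩ := exists_monotone_Icc_subset_open_cover_unitInterval
    (c := fun t : unitInterval => (Subtype.val ⁻¹' V t : Set unitInterval))
    (fun t => (hV t t.2).preimage continuous_subtype_val)
    (fun t _ => mem_iUnion.2 ⟨t, hmem t t.2⟩)
  have hint : ∀ (x : ℕ × ℕ) (a b : unitInterval), IntervalIntegrable (fun t =>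
      (derivWithin (f ∘ c x.1) (Icc 0 1) t - derivWithin (f ∘ c x.2) (Icc 0 1) t) ^ 2)
      volume a b := fun x a b =>
    ContinuousOn.intervalIntegrable ((((h.continuousOn_derivWithin_comp f x.1).sub
      (h.continuousOn_derivWithin_comp f x.2)).pow 2).mono
        (ordConnected_Icc.uIcc_subset a.2 b.2))
  have key : ∀ k, Tendsto (fun x : ℕ × ℕ => ∫ t in (0 : ℝ)..(s k),
      (derivWithin (f ∘ c x.1) (Icc 0 1) t - derivWithin (f ∘ c x.2) (Icc 0 1) t) ^ 2)
      (atTop ×ˢ atTop) (𝓝 0) := by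
    intro k
    induction k with
    | zero => simp [hs0]
    | succ k ih =>
      rcases (hsm k.le_succ).eq_or_lt with heq | hlt
      · rwa [← heq]
      · obtain ⟨i, hi⟩ := hsub k
        have hsub' : Icc (s k : ℝ) (s (k + 1)) ⊆ Icc 0 1 :=
          Icc_subset_Icc (s k).2.1 (s (k + 1)).2.2
        have h1 := hVlim i i.2 (s k) (s (k + 1)) hlt hsub'
          (fun t ht => hi (show (⟨t, hsub' ht⟩ : unitInterval) ∈ Icc (s k) (s (k + 1)) from
            ⟨ht.1, ht.2⟩)) f
        have h2 := ih.add h1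
        rw [add_zero] at h2
        exact h2.congr fun x =>
          intervalIntegral.integral_add_adjacent_intervals (hint x 0 (s k)) (hint x _ _)
  have := key n
  rwa [hn n le_rfl] at this

end IsMinimisingSequence

end LocalConvergence

/-! ### Weak derivatives on the unit interval -/

section Sobolev

lemma integral_unitInterval (F : ℝ → ℝ) : ∫ t : unitInterval, F t = ∫ t in (0 : ℝ)..1, F t := by
  rw [intervalIntegral.integral_of_le zero_le_one, ← integral_Icc_eq_integral_Ioc]
  exact integral_subtype_comap measurableSet_Icc F

lemma memLp_of_continuous {F : unitInterval → ℝ} (hF : Continuous F) : MemLp F 2 volume := by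
  obtain ⟨C, hC⟩ := isCompact_univ.exists_bound_of_continuousOn hF.continuousOn
  exact .of_bound hF.aestronglyMeasurable C (.of_forall fun t => hC t (mem_univ t))

lemma memLp_of_continuousOn {F : ℝ → ℝ} (hF : ContinuousOn F (Icc 0 1)) :
    MemLp (fun t : unitInterval => F t) 2 volume :=
  memLp_of_continuous (hF.comp_continuous continuous_subtype_val fun t => t.2)

lemma inner_toLp {F G : unitInterval → ℝ} (hF : MemLp F 2 volume) (hG : MemLp G 2 volume) :
    inner ℝ (hF.toLp F) (hG.toLp G) = ∫ t, F t * G t := by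
  rw [L2.inner_def]
  refine integral_congr_ae ?_
  filter_upwards [hF.coeFn_toLp, hG.coeFn_toLp] with t h1 h2
  rw [h1, h2]
  exact mul_comm _ _

lemma dist_toLp {F G : unitInterval → ℝ} (hF : MemLp F 2 volume) (hG : MemLp G 2 volume) :
    dist (hF.toLp F) (hG.toLp G) = Real.sqrt (∫ t, |F t - G t| ^ 2) := by
  rw [dist_eq_norm, ← MemLp.toLp_sub hF hG, norm_eq_sqrt_real_inner, inner_toLp]
  simp only [sq_abs, Pi.sub_apply, ← sq]

lemma memLp_test {ψ : ℝ → ℝ} (hψ : ContDiff ℝ ∞ ψ) :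
    MemLp (fun t : unitInterval => ψ t) 2 volume :=
  memLp_of_continuousOn hψ.continuous.continuousOn

lemma memLp_deriv_test {ψ : ℝ → ℝ} (hψ : ContDiff ℝ ∞ ψ) :
    MemLp (fun t : unitInterval => deriv ψ t) 2 volume :=
  memLp_of_continuousOn (hψ.continuous_deriv (by simp)).continuousOn

/-- Integration by parts: the classical derivative of a `C¹` function is a weak derivative. -/
lemma hasWeakDeriv_of_contDiffOn {U : ℝ → ℝ} (hU : ContDiffOn ℝ 1 U (Icc 0 1)) :
    HasWeakDeriv (fun t => U t) (fun t => derivWithin U (Icc 0 1) t) := by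
  intro ψ hψ hsupp
  rw [integral_unitInterval (fun t => deriv ψ t * U t),
    integral_unitInterval (fun t => ψ t * derivWithin U (Icc 0 1) t)]
  have h01 : uIcc (0 : ℝ) 1 = Icc 0 1 := uIcc_of_le zero_le_one
  have hψ0 : ψ 0 = 0 := image_eq_zero_of_notMem_tsupport fun h => lt_irrefl _ (hsupp h).1
  have hψ1 : ψ 1 = 0 := image_eq_zero_of_notMem_tsupport fun h => lt_irrefl _ (hsupp h).2
  have hparts := intervalIntegral.integral_mul_deriv_eq_deriv_mul_of_hasDeriv_right
    (a := 0) (b := 1) (u := ψ) (v := U) (u' := deriv ψ) (v' := derivWithin U (Icc 0 1))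
    hψ.continuous.continuousOn (h01 ▸ hU.continuousOn)
    (fun t _ => (hψ.differentiable (by simp) t).hasDerivAt.hasDerivWithinAt)
    (fun t ht => ?_) ((hψ.continuous_deriv (by simp)).intervalIntegrable 0 1)
    (ContinuousOn.intervalIntegrable
      (h01 ▸ hU.continuousOn_derivWithin uniqueDiffOn_Icc_zero_one le_rfl))
  · rw [hparts, hψ0, hψ1]
    ring
  · rw [min_eq_left zero_le_one, max_eq_right zero_le_one] at ht
    have h1 := ((hU.differentiableOn one_ne_zero) t (Ioo_subset_Icc_self ht)).hasDerivWithinAt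
    exact (h1.hasDerivAt (Icc_mem_nhds ht.1 ht.2)).hasDerivWithinAt

/-- The graph of the weak derivative is closed in `L² × L²`. -/
lemma HasWeakDeriv.of_tendsto {u η : ℕ → unitInterval → ℝ} {u' η' : unitInterval → ℝ}
    (hu : ∀ j, MemLp (u j) 2 volume) (hη : ∀ j, MemLp (η j) 2 volume) (hu' : MemLp u' 2 volume)
    (hη' : MemLp η' 2 volume) (h : ∀ j, HasWeakDeriv (u j) (η j))
    (hulim : Tendsto (fun j => (hu j).toLp (u j)) atTop (𝓝 (hu'.toLp u')))
    (hηlim : Tendsto (fun j => (hη j).toLp (η j)) atTop (𝓝 (hη'.toLp η'))) :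
    HasWeakDeriv u' η' := by
  intro ψ hψ hsupp
  have h1 : Tendsto (fun j => inner ℝ ((memLp_deriv_test hψ).toLp _) ((hu j).toLp (u j))) atTop
      (𝓝 (inner ℝ ((memLp_deriv_test hψ).toLp _) (hu'.toLp u'))) :=
    tendsto_const_nhds.inner hulim
  have h2 : Tendsto (fun j => -inner ℝ ((memLp_test hψ).toLp _) ((hη j).toLp (η j))) atTop
      (𝓝 (-inner ℝ ((memLp_test hψ).toLp _) (hη'.toLp η'))) :=
    (tendsto_const_nhds.inner hηlim).neg
  simp only [inner_toLp] at h1 h2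
  exact tendsto_nhds_unique h1 (h2.congr fun j => (h j ψ hψ hsupp).symm)

/-- Weak derivatives are unique almost everywhere. -/
lemma HasWeakDeriv.ae_eq {u η η' : unitInterval → ℝ} (hη : MemLp η 2 volume)
    (hη' : MemLp η' 2 volume) (h : HasWeakDeriv u η) (h' : HasWeakDeriv u η') :
    η =ᵐ[volume] η' := by
  -- the difference, extended to the real line
  set f : ℝ → ℝ := fun t => (η - η') (projIcc 0 1 zero_le_one t) with hf
  have hfη : ∀ t : unitInterval, f t = η t - η' t := fun t => by simp [hf]
  have hmem := hη.sub hη'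
  have hint : IntegrableOn f (Icc 0 1) volume := by
    have h1 : Integrable (f ∘ Subtype.val) (volume : Measure unitInterval) :=
      (hmem.integrable one_le_two).congr (.of_forall fun t => (hfη t).symm)
    exact (unitInterval.measurePreserving_coe.integrable_comp_emb
      unitInterval.measurableEmbedding_coe).1 h1
  have hzero := isOpen_Ioo.ae_eq_zero_of_integral_contDiff_smul_eq_zero (U := Ioo (0 : ℝ) 1)
    (f := f) (μ := volume) ((hint.mono_set Ioo_subset_Icc_self).locallyIntegrableOn) ?_
  · have h2 : ∀ᵐ t ∂(volume.restrict unitInterval), t ∈ Ioo (0 : ℝ) 1 → f t = 0 :=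
      ae_restrict_of_ae hzero
    have h3 := unitInterval.measurePreserving_coe.quasiMeasurePreserving.ae h2
    have h0 : ∀ᵐ t : unitInterval, t ≠ 0 := by
      rw [ae_iff]; simp
    have h1 : ∀ᵐ t : unitInterval, t ≠ 1 := by
      rw [ae_iff]; simp
    filter_upwards [h3, h0, h1] with t ht ht0 ht1
    have := ht ⟨unitInterval.pos_iff_ne_zero.2 ht0, unitInterval.lt_one_iff_ne_one.2 ht1⟩
    rw [hfη] at this
    exact sub_eq_zero.1 this
  · intro ψ hψ _ hsupp
    have e1 : ∫ t, ψ t • f t = ∫ t in Icc (0 : ℝ) 1, ψ t • f t := by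
      refine (setIntegral_eq_integral_of_forall_compl_eq_zero fun t ht => ?_).symm
      rw [image_eq_zero_of_notMem_tsupport fun h => ht (Ioo_subset_Icc_self (hsupp h)), zero_smul]
    rw [e1, ← integral_subtype_comap measurableSet_Icc (fun t => ψ t • f t)]
    have e2 : ∀ t : unitInterval, ψ t • f t = ψ t * η t - ψ t * η' t := fun t => by
      rw [hfη, smul_eq_mul, mul_sub]
    change ∫ t : unitInterval, ψ t • f t = 0
    simp only [e2]
    have e5 : ∫ t : unitInterval, (ψ t * η t - ψ t * η' t) =
        (∫ t : unitInterval, ψ t * η t) - ∫ t : unitInterval, ψ t * η' t :=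
      integral_sub ((memLp_test hψ).integrable_mul hη) ((memLp_test hψ).integrable_mul hη')
    rw [e5]
    have e3 := h ψ hψ hsupp
    have e4 := h' ψ hψ hsupp
    linarith

lemma MemH1.memLp_weakDeriv {u : unitInterval → ℝ} (hu : MemH1 u) :
    MemLp (weakDeriv u) 2 volume := by
  rw [weakDeriv, dif_pos hu]
  exact hu.2.choose_spec.1

lemma MemH1.weakDeriv_ae_eq {u η : unitInterval → ℝ} (hu : MemH1 u) (hη : MemLp η 2 volume)
    (h : HasWeakDeriv u η) : weakDeriv u =ᵐ[volume] η := by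
  refine HasWeakDeriv.ae_eq hu.memLp_weakDeriv hη ?_ h
  rw [weakDeriv, dif_pos hu]
  exact hu.2.choose_spec.2

lemma MemH1.memLp_weakDerivOrder {u : unitInterval → ℝ} (hu : MemH1 u) (a : Fin 2) :
    MemLp (weakDerivOrder a u) 2 volume := by
  unfold weakDerivOrder
  split_ifs
  exacts [hu.1, hu.memLp_weakDeriv]

end Sobolev

/-! ### Convergence of Sobolev curves -/

section SobolevTopology

variable {E : Type*} [NormedAddCommGroup E] [NormedSpace ℝ E]
  {M : Type*} [TopologicalSpace M] [ChartedSpace E M]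

lemma semimetric_eq_dist (a : Fin 2) (f : C^∞⟮𝓘(ℝ, E), M; ℝ⟯) (γ₁ γ₂ : H1Curve E M) :
    semimetric a f γ₁ γ₂ = dist (((γ₁.memH1 f).memLp_weakDerivOrder a).toLp _)
      (((γ₂.memH1 f).memLp_weakDerivOrder a).toLp _) := by
  rw [dist_toLp]
  rfl

/-- Convergence in `H¹([0,1], M)` follows from the convergence in `L²` of all smooth functions along
the curves, and of their weak derivatives. -/
lemma tendsto_H1Curve {ι : Type*} {l : Filter ι} {c : ι → H1Curve E M} {γ : H1Curve E M}
    (h : ∀ (f : C^∞⟮𝓘(ℝ, E), M; ℝ⟯) (a : Fin 2),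
      Tendsto (fun k => (((c k).memH1 f).memLp_weakDerivOrder a).toLp _) l
        (𝓝 (((γ.memH1 f).memLp_weakDerivOrder a).toLp _))) : Tendsto c l (𝓝 γ) := by
  simp only [nhds_iInf, nhds_induced, tendsto_iInf, tendsto_comap_iff]
  intro a f γ₀
  simp only [Function.comp_def, semimetric_eq_dist]
  exact (h f a).dist tendsto_const_nhds

end SobolevTopology

/-! ### Convergence of the geodesics in the Sobolev topology -/

section Conclusion

lemma tendsto_toLp_of_tendstoUniformly {u : ℕ → unitInterval → ℝ} {u' : unitInterval → ℝ}
    (hu : ∀ j, MemLp (u j) 2 volume) (hu' : MemLp u' 2 volume)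
    (h : TendstoUniformly u u' atTop) :
    Tendsto (fun j => (hu j).toLp (u j)) atTop (𝓝 (hu'.toLp u')) := by
  rw [Metric.tendsto_nhds]
  intro ε hε
  filter_upwards [Metric.tendstoUniformly_iff.1 h (ε / 2) (half_pos hε)] with j hj
  rw [dist_toLp]
  refine lt_of_le_of_lt (Real.sqrt_le_iff.2 ⟨(half_pos hε).le, ?_⟩) (half_lt_self hε)
  have h1 : ‖∫ t, |u j t - u' t| ^ 2‖ ≤
      (ε / 2) ^ 2 * (volume : Measure unitInterval).real univ := by
    refine norm_integral_le_of_norm_le_const (.of_forall fun t => ?_)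
    rw [norm_pow, Real.norm_eq_abs, abs_abs, abs_sub_comm]
    exact pow_le_pow_left₀ (abs_nonneg _) (hj t).le 2
  rw [probReal_univ, mul_one] at h1
  exact (le_abs_self _).trans h1

variable {E : Type*} [NormedAddCommGroup E] [NormedSpace ℝ E] [FiniteDimensional ℝ E]
  {M : Type*} [EMetricSpace M] [ChartedSpace E M] [IsManifold 𝓘(ℝ, E) ∞ M]
  [RiemannianBundle (fun p : M => TangentSpace 𝓘(ℝ, E) p)]
  [IsContinuousRiemannianBundle E (fun p : M => TangentSpace 𝓘(ℝ, E) p)]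
  [IsRiemannianManifold 𝓘(ℝ, E) M]
  {D : ∀ p : M, Submodule ℝ (TangentSpace 𝓘(ℝ, E) p)} {γ : ℕ → unitInterval → M}
  {γlim : unitInterval → M}

/-- The speeds of the geodesics converge: they increase with the metric, and are bounded by Chow's
theorem. -/
lemma exists_isMinimisingSequence (hD : IsBracketGenerating D) {x y : M} {φ : ℕ → ℕ+}
    (hγ : ∀ j, IsMinimisingGeodesic D (φ j) x y (γ j)) (hφ : Monotone φ)
    (hlim : TendstoUniformly γ γlim atTop) :
    ∃ (L : ℕ → ℝ) (Λ : ℝ), IsMinimisingSequence D φ L Λ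
      (fun j => γ j ∘ projIcc 0 1 zero_le_one) (γlim ∘ projIcc 0 1 zero_le_one) := by
  choose L hL0 hLd hLs using fun j => (hγ j).exists_speed
  have hmono : Monotone L := fun i j hij => by
    have := (hγ i).penalisedEDist_mono (hγ j) (hφ hij)
    rwa [hLd, hLd, ENNReal.ofReal_le_ofReal_iff (hL0 j)] at this
  have hxy : Joined x y :=
    ⟨⟨⟨γ 0, (hγ 0).contMDiff.continuous⟩, (hγ 0).source, (hγ 0).target⟩⟩
  obtain ⟨C, hC⟩ := hD.exists_penalisedEDist_le hxy
  have hbdd : BddAbove (range L) := ⟨max C 0, by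
    rintro _ ⟨j, rfl⟩
    have := (hC (φ j)).trans (ENNReal.ofReal_le_ofReal (le_max_left C 0))
    rwa [hLd, ENNReal.ofReal_le_ofReal_iff (le_max_right _ _)] at this⟩
  have hx : γlim 0 = x := tendsto_nhds_unique (hlim.tendsto_at 0)
    (tendsto_const_nhds.congr fun j => (hγ j).source.symm)
  have hy : γlim 1 = y := tendsto_nhds_unique (hlim.tendsto_at 1)
    (tendsto_const_nhds.congr fun j => (hγ j).target.symm)
  exact ⟨L, ⨆ j, L j, hφ, fun j => (hγ j).contMDiff.comp_contMDiffOn contMDiffOn_projIcc, hL0, hLs,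
    le_ciSup hbdd, tendsto_atTop_ciSup hmono hbdd, (hlim.comp _).tendstoUniformlyOn, fun j => by
      simp [hx, hy, hLd]⟩

namespace IsMinimisingSequence

variable {q : ℕ → ℕ+} {L : ℕ → ℝ} {Λ : ℝ}

/-- Smooth functions along the curves have weak derivatives which converge in `L²` to a weak
derivative of their limit. -/
lemma exists_hasWeakDeriv (h : IsMinimisingSequence D q L Λ
      (fun j => γ j ∘ projIcc 0 1 zero_le_one) (γlim ∘ projIcc 0 1 zero_le_one))
    (hD : IsSmoothSubbundle D) (hγ : ∀ j, Continuous (γ j)) (hlim : TendstoUniformly γ γlim atTop)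
    (f : C^∞⟮𝓘(ℝ, E), M; ℝ⟯) :
    ∃ (hu : ∀ j, MemLp (f ∘ γ j) 2 volume) (hu' : MemLp (f ∘ γlim) 2 volume)
      (η : ℕ → unitInterval → ℝ) (η' : unitInterval → ℝ) (hη : ∀ j, MemLp (η j) 2 volume)
      (hη' : MemLp η' 2 volume), (∀ j, HasWeakDeriv (f ∘ γ j) (η j)) ∧
      HasWeakDeriv (f ∘ γlim) η' ∧
      Tendsto (fun j => (hu j).toLp (f ∘ γ j)) atTop (𝓝 (hu'.toLp (f ∘ γlim))) ∧
      Tendsto (fun j => (hη j).toLp (η j)) atTop (𝓝 (hη'.toLp η')) := by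
  have hf : Continuous f := f.contMDiff.continuous
  have hcont : Continuous γlim := hlim.continuous (.of_forall hγ)
  have hu : ∀ j, MemLp (f ∘ γ j) 2 volume := fun j => memLp_of_continuous (hf.comp (hγ j))
  have hu' : MemLp (f ∘ γlim) 2 volume := memLp_of_continuous (hf.comp hcont)
  have hulim : Tendsto (fun j => (hu j).toLp (f ∘ γ j)) atTop (𝓝 (hu'.toLp (f ∘ γlim))) := by
    refine tendsto_toLp_of_tendstoUniformly hu hu' ?_
    rw [← tendstoUniformlyOn_univ] at hlim ⊢
    exact tendstoUniformlyOn_comp_of_continuousAt hlim (isCompact_univ.image hcont)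
      fun t _ => hf.continuousAt
  have hη : ∀ j, MemLp (fun t : unitInterval =>
      derivWithin (f ∘ γ j ∘ projIcc 0 1 zero_le_one) (Icc 0 1) t) 2 volume := fun j =>
    memLp_of_continuousOn (h.continuousOn_derivWithin_comp f j)
  have hweak : ∀ j, HasWeakDeriv (f ∘ γ j) (fun t : unitInterval =>
      derivWithin (f ∘ γ j ∘ projIcc 0 1 zero_le_one) (Icc 0 1) t) := fun j => by
    convert hasWeakDeriv_of_contDiffOn (h.contDiffOn_comp f j) using 1
    funext t
    simp
  have hcauchy : CauchySeq fun j => (hη j).toLp _ := by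
    rw [cauchySeq_iff_tendsto_dist_atTop_0, ← prod_atTop_atTop_eq]
    have h1 := (h.tendsto_integral_derivWithin_sub_sq hD f).sqrt
    rw [Real.sqrt_zero] at h1
    refine h1.congr fun x => ?_
    rw [dist_toLp, ← integral_unitInterval]
    simp only [sq_abs]
  obtain ⟨g, hg⟩ := cauchySeq_tendsto_of_complete hcauchy
  have hg' : (Lp.memLp g).toLp g = g := Lp.toLp_coeFn g _
  rw [← hg'] at hg
  exact ⟨hu, hu', _, g, hη, Lp.memLp g, hweak,
    HasWeakDeriv.of_tendsto hu hη hu' (Lp.memLp g) hweak hulim hg, hulim, hg⟩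

end IsMinimisingSequence

end Conclusion

end PenalisedGeodesics

end

theorem theorem3p3
    {E : Type*} [NormedAddCommGroup E] [NormedSpace ℝ E] [FiniteDimensional ℝ E]
    {M : Type*} [EMetricSpace M] [ChartedSpace E M] [IsManifold 𝓘(ℝ, E) ∞ M]
    [RiemannianBundle (fun p : M => TangentSpace 𝓘(ℝ, E) p)]
    [IsContMDiffRiemannianBundle 𝓘(ℝ, E) ∞ E (fun p : M => TangentSpace 𝓘(ℝ, E) p)]
    [IsRiemannianManifold 𝓘(ℝ, E) M]
    (D : ∀ p : M, Submodule ℝ (TangentSpace 𝓘(ℝ, E) p))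
    (hD : PenalisedGeodesics.IsSmoothSubbundle D)
    (hbracket : PenalisedGeodesics.IsBracketGenerating D)
    (x y : M) (γ : ℕ+ → unitInterval → M)
    (hγ : ∀ q : ℕ+, PenalisedGeodesics.IsMinimisingGeodesic D q x y (γ q))
    (φ : ℕ → ℕ+) (hφ : StrictMono φ) (γlim : unitInterval → M)
    (hlim : TendstoUniformly (fun j => γ (φ j)) γlim atTop) :
    ∃ hγlim : PenalisedGeodesics.MemH1Curve E γlim,
      ∃ (ψ : ℕ → ℕ) (hmem : ∀ k : ℕ, PenalisedGeodesics.MemH1Curve E (γ (φ (ψ k)))),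
        StrictMono ψ ∧
        Tendsto
          (fun k => (⟨γ (φ (ψ k)), hmem k⟩ : PenalisedGeodesics.H1Curve E M))
          atTop (𝓝 ⟨γlim, hγlim⟩) := by
  have : IsContinuousRiemannianBundle E (fun p : M => TangentSpace 𝓘(ℝ, E) p) := by
    obtain ⟨g, hg, h⟩ := IsContMDiffRiemannianBundle.exists_contMDiff (IB := 𝓘(ℝ, E)) (n := ∞)
      (F := E) (E := fun p : M => TangentSpace 𝓘(ℝ, E) p)
    exact ⟨g, hg.continuous, h⟩
  obtain ⟨L, Λ, h⟩ := PenalisedGeodesics.exists_isMinimisingSequence hbracket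
    (fun j => hγ (φ j)) hφ.monotone hlim
  choose hu hu' η η' hη hη' hweak hweak' hulim hηlim using h.exists_hasWeakDeriv hD
    (fun j => (hγ (φ j)).contMDiff.continuous) hlim
  have hmem : ∀ j, PenalisedGeodesics.MemH1Curve E (γ (φ j)) := fun j f =>
    ⟨hu f j, η f j, hη f j, hweak f j⟩
  have hmem' : PenalisedGeodesics.MemH1Curve E γlim := fun f => ⟨hu' f, η' f, hη' f, hweak' f⟩
  -- no extraction is needed: the whole sequence converges
  refine ⟨hmem', id, hmem, strictMono_id, PenalisedGeodesics.tendsto_H1Curve fun f a => ?_⟩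
  fin_cases a
  · exact hulim f
  · have h1 : ∀ j, ((hmem j f).memLp_weakDerivOrder 1).toLp _ = (hη f j).toLp (η f j) := fun j =>
      (MemLp.toLp_eq_toLp_iff _ _).2 ((hmem j f).weakDeriv_ae_eq (hη f j) (hweak f j))
    have h2 : ((hmem' f).memLp_weakDerivOrder 1).toLp _ = (hη' f).toLp (η' f) :=
      (MemLp.toLp_eq_toLp_iff _ _).2 ((hmem' f).weakDeriv_ae_eq (hη' f) (hweak' f))
    have h3 := hηlim f
    rw [← h2] at h3
    exact h3.congr fun j => (h1 j).symm
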